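/- Let $d\ge 1$ and $\mu>1/2$. Let $a_{mn}\in C^\infty(\mathbb{R}^d;\mathbb{R})$ ($1\le m,n\le d$) be such that $(a_{mn}(x))_{m,n}$ is a positive definite symmetric matrix for every $x\in\mathbb{R}^d$ and such that for every multi-index $\alpha\in\mathbb{Z}_+^d$ there is $C_\alpha>0$ with $$|\partial_x^\alpha(a_{mn}(x)-\delta_{mn})|\le C_\alpha\langle x\rangle^{-\mu-|\alpha|},\qquad x\in\mathbb{R}^d,\ 1\le m,n\le d,\qquad \langle x\rangle=(1+|x|^2)^{1/2}.$$ Put $k(x,\xi)=\frac12\sum_{m,n=1}^d a_{mn}(x)\xi_m\xi_n$ and let $\exp(tH_k)$ be its Hamilton flow, i.e. $(x(t),\xi(t))=\exp(tH_k)(x_0,\xi_0)$ is the solution of $x'=\frac{\partial k}{\partial\xi}(x,\xi)$, $\xi'=-\frac{\partial k}{\partial x}(x,\xi)$, $x(0)=x_0$, $\xi(0)=\xi_0$. Assume that the flow is nontrapping: whenever $\xi_0\ne0$, one has $|x(t)|\to\infty$ both as $t\to+\infty$ and as $t\to-\infty$. Let $\Psi(t,\xi)=\int_0^t k(s\xi,\xi)\,ds$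 (the Dollard modifier for $k$). Then the solution $(x(t),\xi(t))$ exists for all $t\in\mathbb{R}$ and is unique, for every $(x_0,\xi_0)\in\mathbb{R}^d\times\mathbb{R}^d$. For every $(x_0,\xi_0)\in\mathbb{R}^d\times(\mathbb{R}^d\setminus\{0\})$ the limits $$x_\pm=\lim_{t\to\pm\infty}\bigl(x(t)-(\nabla_\xi\Psi)(t,\xi(t))\bigr),\qquad \xi_\pm=\lim_{t\to\pm\infty}\xi(t)$$ exist, with $\xi_\pm\ne0$, and for each choice of sign the classical wave map $W^{cl}_\pm:(x_\pm,\xi_\pm)\mapsto(x_0,\xi_0)$ is a well-defined $C^\infty$ diffeomorphism of $\mathbb{R}^d\times(\mathbb{R}^d\setminus\{0\})$ onto itself. -/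

import Mathlib

open Filter Topology
open scoped ContDiff

namespace ClassicalScattering

/-- The configuration space `ℝ^d` with its Euclidean norm. -/
abbrev Space (d : ℕ) : Type := EuclideanSpace ℝ (Fin d)

/-- The phase space `ℝ^d × ℝ^d`; its points are pairs (position, momentum). -/
abbrev Phase (d : ℕ) : Type := Space d × Space d

/-- `⟨x⟩ = (1 + |x|²)^{1/2}`. -/
noncomputable def bracket {d : ℕ} (x : Space d) : ℝ := Real.sqrt (1 + ‖x‖ ^ 2)

/-- The mixed partial derivative `∂_{i 0} ∂_{i 1} ⋯ ∂_{i (n-1)} f` of order `n` at the point `x`. -/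
noncomputable def partialDeriv {d n : ℕ} (i : Fin n → Fin d) (f : Space d → ℝ) (x : Space d) : ℝ :=
  iteratedFDeriv ℝ n f x (fun j => EuclideanSpace.single (i j) (1 : ℝ))

/-- A smooth field `a` of positive definite symmetric real matrices on `ℝ^d` which tends to the
identity matrix with the long range rate `μ`: every partial derivative of order `n` of
`a_{jk} - δ_{jk}` is `O(⟨x⟩^{-μ-n})`. -/
structure IsLongRangeMetric {d : ℕ} (a : Space d → Matrix (Fin d) (Fin d) ℝ) (μ : ℝ) : Prop where
  smooth : ∀ j k, ContDiff ℝ ∞ (fun x => a x j k)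
  posDef : ∀ x, (a x).PosDef
  decay : ∀ (n : ℕ) (i : Fin n → Fin d) (j k : Fin d), ∃ C : ℝ, 0 < C ∧ ∀ x : Space d,
    |partialDeriv i (fun y => a y j k - (1 : Matrix (Fin d) (Fin d) ℝ) j k) x|
      ≤ C * bracket x ^ (-μ - (n : ℝ))

/-- The kinetic energy `k(x, ξ) = ½ ∑_{j,k} a_{jk}(x) ξ_j ξ_k`. -/
noncomputable def kinetic {d : ℕ} (a : Space d → Matrix (Fin d) (Fin d) ℝ) (x ξ : Space d) : ℝ :=
  (1 / 2) * ∑ j, ∑ k, a x j k * ξ j * ξ k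

/-- `c = (x, ξ) : ℝ → ℝ^d × ℝ^d` is a global solution of the Hamilton equations
`x' = ∂h/∂ξ (x, ξ)`, `ξ' = - ∂h/∂x (x, ξ)`, that is, `c t = exp(t H_h) (c 0)` for all `t`. -/
structure IsHamiltonCurve {d : ℕ} (h : Space d → Space d → ℝ) (c : ℝ → Phase d) : Prop where
  position : ∀ t, HasDerivAt (fun s => (c s).1) (gradient (fun η => h (c t).1 η) (c t).2) t
  momentum : ∀ t, HasDerivAt (fun s => (c s).2) (-gradient (fun y => h y (c t).2) (c t).1) t

/-- Every trajectory with nonzero initial momentum escapes to infinity as `t → ∞` and as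
`t → -∞`. -/
def IsNontrapping {d : ℕ} (h : Space d → Space d → ℝ) : Prop :=
  ∀ c : ℝ → Phase d, IsHamiltonCurve h c → (c 0).2 ≠ 0 →
    Tendsto (fun t => ‖(c t).1‖) atTop atTop ∧ Tendsto (fun t => ‖(c t).1‖) atBot atTop

/-- The Dollard modifier `∫_0^t h(sξ, ξ) ds` of the Hamiltonian `h`. -/
noncomputable def dollard {d : ℕ} (h : Space d → Space d → ℝ) (t : ℝ) (ξ : Space d) : ℝ :=
  ∫ s in (0 : ℝ)..t, h (s • ξ) ξ

/-- `w = (lim (x(t) - ∇_ξ Ψ(t, ξ(t))), lim ξ(t))` along the filter `l`, where `c = (x, ξ)` and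
`Ψ` is the Dollard modifier of `h`. -/
def HasAsymptotics {d : ℕ} (h : Space d → Space d → ℝ) (l : Filter ℝ) (c : ℝ → Phase d)
    (w : Phase d) : Prop :=
  Tendsto (fun t => (c t).1 - gradient (dollard h t) (c t).2) l (𝓝 w.1) ∧
    Tendsto (fun t => (c t).2) l (𝓝 w.2)

/-- The open subset `ℝ^d × (ℝ^d ∖ {0})` of the phase space. -/
def nonzeroMomentum (d : ℕ) : Set (Phase d) := {z | z.2 ≠ 0}

/-- The restriction of `f` to the open set `U` is a (smooth) diffeomorphism of `U` onto itself. -/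
def IsDiffeomorphismOf {E : Type*} [NormedAddCommGroup E] [NormedSpace ℝ E] (f : E → E)
    (U : Set E) : Prop :=
  Set.MapsTo f U U ∧ ContDiffOn ℝ ∞ f U ∧
    ∃ g : E → E, Set.MapsTo g U U ∧ ContDiffOn ℝ ∞ g U ∧ Set.InvOn g f U U

end ClassicalScattering

/-! Write the metric as 1 + B with B a symbol of order -μ, and let Γ(x)(ξ, ξ) be the position
gradient of the energy, so that Γ is a symbol of order -1 - μ. Lowering the exponent if necessary,
one may take 1/2 < μ < 1.

The energy is homogeneous of degree two in ξ, so t Ψ(t, ξ) depends on tξ alone. Hence ∇Ψ(t, ξ) = tξ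
+ `shift`(tξ), where `shift` is a gradient and a symbol of order 1 - μ (`dollard_mul`,
`gradient_dollard`). In the coordinates y = x - tξ - `shift`(tξ), ξ, the Euler identity
`fderiv_shift_apply_self` cancels the leading part of the velocity. What remains is y' = (B(x) -
B(tξ))ξ + t(Γ(x) - Γ(tξ))(ξ, ξ) + t D`shift`(tξ) Γ(x)(ξ, ξ) and ξ' = -Γ(x)(ξ, ξ). If ξ stays away
from zero and x - tξ = O(t^{1-μ}), every term is O(t^{-2μ}), which is integrable because μ > 1/2.

A trajectory with nonzero momentum satisfies these two conditions. Energy conservation bounds |ξ|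
above and below. Once |x| is large, the derivative of ⟪x, ξ⟫ is bounded below by a positive
constant, so escape is linear (`exists_mul_le_bracket`), and integrating the derivative of x - tξ
bounds the deviation (`exists_norm_deviation_le`).

The equation thus becomes u = z + V(N(u)) in the Banach space of bounded paths. Here N is the
rescaled vector field and V is the primitive against the weight (1 + |t|)^{-2μ}, vanishing either at
the initial time (`forward`) or at infinity (`backward`). The map N is smooth because it is built
from Nemytskii operators of symbols (`contDiffAt_nemytskii`). A contraction argument for the
backward equation on (T, ∞) with T large gives existence and uniqueness of the trajectory with
prescribed asymptotic data.

Smoothness needs the equation on all of (0, ∞), where V is not small. But N acts pointwise in t and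
V is of Volterra type, so 1 - V DN(u) is invertible in an exponentially weighted norm
(`IsVolterra.isUnit`). The inverse function theorem then gives smooth families of solutions
(`IsVolterra.exists_smooth_family`): the backward family evaluated at time 0 is the wave map, and
the limit at infinity of the forward family is its inverse. Reversing time and momentum carries t →
∞ to t → -∞. -/

open scoped BoundedContinuousFunction InnerProductSpace Manifold

namespace ClassicalScattering

/-! ### Symbol classes on Euclidean space. -/

section Symbols

variable {d : ℕ} {F G H : Type} [NormedAddCommGroup F] [NormedSpace ℝ F]
  [NormedAddCommGroup G] [NormedSpace ℝ G] [NormedAddCommGroup H] [NormedSpace ℝ H]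

theorem one_le_bracket (x : Space d) : 1 ≤ bracket x := by
  unfold bracket
  rw [Real.one_le_sqrt]
  nlinarith [sq_nonneg ‖x‖]

theorem bracket_pos (x : Space d) : 0 < bracket x := lt_of_lt_of_le one_pos (one_le_bracket x)

theorem norm_le_bracket (x : Space d) : ‖x‖ ≤ bracket x :=
  Real.le_sqrt_of_sq_le (by linarith)

theorem bracket_le_one_add_norm (x : Space d) : bracket x ≤ 1 + ‖x‖ := by
  refine Real.sqrt_le_iff.2 ⟨by positivity, ?_⟩
  nlinarith [norm_nonneg x]

theorem one_add_norm_le_two_mul_bracket (x : Space d) : 1 + ‖x‖ ≤ 2 * bracket x := by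
  linarith [one_le_bracket x, norm_le_bracket x]

/-- Since s ≤ 1, s²(1 + |x|²) ≤ 1 + s²|x|². This turns decay at s • x into decay at x at the price
of a power of s. -/
theorem mul_bracket_le_bracket_smul (x : Space d) {s : ℝ} (h0 : 0 ≤ s) (h1 : s ≤ 1) :
    s * bracket x ≤ bracket (s • x) := by
  unfold bracket
  refine Real.le_sqrt_of_sq_le ?_
  rw [mul_pow, Real.sq_sqrt (by positivity), norm_smul, mul_pow, Real.norm_of_nonneg h0]
  nlinarith

/-- Symbols of order `m`: smooth functions whose `n`-th derivative is `O(⟨x⟩^{m-n})`. -/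
structure IsSymbol (m : ℝ) (f : Space d → F) : Prop where
  contDiff : ContDiff ℝ ∞ f
  bound : ∀ n : ℕ, ∃ C : ℝ, ∀ x, ‖iteratedFDeriv ℝ n f x‖ ≤ C * bracket x ^ (m - n)

namespace IsSymbol

variable {m m' : ℝ} {f g : Space d → F}

theorem exists_bound (hf : IsSymbol m f) (n : ℕ) :
    ∃ C : ℝ, 0 ≤ C ∧ ∀ x, ‖iteratedFDeriv ℝ n f x‖ ≤ C * bracket x ^ (m - n) := by
  obtain ⟨C, hC⟩ := hf.bound n
  refine ⟨C, ?_, hC⟩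
  have h := (norm_nonneg _).trans (hC 0)
  exact nonneg_of_mul_nonneg_left h (Real.rpow_pos_of_pos (bracket_pos _) _)

theorem exists_norm_le (hf : IsSymbol m f) : ∃ C : ℝ, 0 ≤ C ∧ ∀ x, ‖f x‖ ≤ C * bracket x ^ m := by
  simpa using hf.exists_bound 0

theorem differentiable (hf : IsSymbol m f) : Differentiable ℝ f :=
  hf.contDiff.differentiable (by simp)

theorem fderiv (hf : IsSymbol m f) : IsSymbol (m - 1) (fderiv ℝ f) := by
  refine ⟨hf.contDiff.fderiv_right (by simp), fun n => ?_⟩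
  obtain ⟨C, hC⟩ := hf.bound (n + 1)
  refine ⟨C, fun x => ?_⟩
  rw [norm_iteratedFDeriv_fderiv]
  refine (hC x).trans (le_of_eq ?_)
  push_cast
  ring_nf

theorem clm_comp (hf : IsSymbol m f) (L : F →L[ℝ] G) : IsSymbol m (fun x => L (f x)) := by
  refine ⟨L.contDiff.comp hf.contDiff, fun n => ?_⟩
  obtain ⟨C, hC⟩ := hf.bound n
  refine ⟨‖L‖ * C, fun x => ?_⟩
  refine (L.norm_iteratedFDeriv_comp_left (f := f) hf.contDiff.contDiffAt
    (WithTop.coe_le_coe.2 le_top)).trans ?_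
  rw [mul_assoc]
  gcongr
  exact hC x

theorem add (hf : IsSymbol m f) (hg : IsSymbol m g) : IsSymbol m (fun x => f x + g x) := by
  refine ⟨hf.contDiff.add hg.contDiff, fun n => ?_⟩
  obtain ⟨C, hC⟩ := hf.bound n
  obtain ⟨D, hD⟩ := hg.bound n
  refine ⟨C + D, fun x => ?_⟩
  have h := iteratedFDeriv_add_apply (𝕜 := ℝ) (i := n) (x := x)
    ((hf.contDiff.of_le (WithTop.coe_le_coe.2 le_top)).contDiffAt)
    ((hg.contDiff.of_le (WithTop.coe_le_coe.2 le_top)).contDiffAt)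
  have h' : iteratedFDeriv ℝ n (fun x => f x + g x) x
    = iteratedFDeriv ℝ n f x + iteratedFDeriv ℝ n g x := h
  rw [h', add_mul]
  exact (norm_add_le _ _).trans (add_le_add (hC x) (hD x))

theorem zero : IsSymbol m (fun _ : Space d => (0 : F)) := by
  refine ⟨contDiff_const, fun n => ⟨0, fun x => ?_⟩⟩
  have : iteratedFDeriv ℝ n (fun _ : Space d => (0 : F)) = 0 := iteratedFDeriv_fun_zero
  simp [this]

theorem sum {ι : Type*} (s : Finset ι) {f : ι → Space d → F} (hf : ∀ i ∈ s, IsSymbol m (f i)) :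
    IsSymbol m (fun x => ∑ i ∈ s, f i x) := by
  classical
  induction s using Finset.induction_on with
  | empty => simpa using zero
  | insert i s hi ih =>
    simp only [Finset.sum_insert hi]
    exact (hf i (by simp)).add (ih fun j hj => hf j (by simp [hj]))

/-- Leibniz rule: the term with i derivatives on f has weight (m - i) + (m' - (n - i)), the same for
all i. -/
theorem bilinear {f : Space d → F} {g : Space d → G} (hf : IsSymbol m f) (hg : IsSymbol m' g)
    (L : F →L[ℝ] G →L[ℝ] H) : IsSymbol (m + m') (fun x => L (f x) (g x)) := by
  refine ⟨(L.contDiff.comp hf.contDiff).clm_apply hg.contDiff, fun n => ?_⟩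
  choose C hC0 hC using hf.exists_bound
  choose D hD0 hD using hg.exists_bound
  refine ⟨‖L‖ * ∑ i ∈ Finset.range (n + 1), (n.choose i : ℝ) * C i * D (n - i), fun x => ?_⟩
  refine (L.norm_iteratedFDeriv_le_of_bilinear hf.contDiff hg.contDiff x
    (WithTop.coe_le_coe.2 le_top)).trans ?_
  rw [mul_assoc, Finset.sum_mul]
  refine mul_le_mul_of_nonneg_left (Finset.sum_le_sum fun i hi => ?_) L.opNorm_nonneg
  have hin : i ≤ n := Nat.lt_succ_iff.1 (Finset.mem_range.1 hi)
  calc (n.choose i : ℝ) * ‖iteratedFDeriv ℝ i f x‖ * ‖iteratedFDeriv ℝ (n - i) g x‖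
      ≤ (n.choose i : ℝ) * (C i * bracket x ^ (m - i))
        * (D (n - i) * bracket x ^ (m' - ((n - i : ℕ) : ℝ))) := by
        have := bracket_pos x
        have := hC0 i
        gcongr
        · exact hC i x
        · exact hD _ x
    _ = (n.choose i : ℝ) * C i * D (n - i) *
        (bracket x ^ (m - i) * bracket x ^ (m' - ((n - i : ℕ) : ℝ))) := by ring
    _ = _ := by
        rw [← Real.rpow_add (bracket_pos x), Nat.cast_sub hin]
        ring_nf

theorem apply {f : Space d → G →L[ℝ] H} {g : Space d → G} (hf : IsSymbol m f)
    (hg : IsSymbol m' g) : IsSymbol (m + m') (fun x => f x (g x)) :=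
  hf.bilinear hg (ContinuousLinearMap.id ℝ (G →L[ℝ] H))

theorem clm (L : Space d →L[ℝ] F) : IsSymbol 1 (fun x => L x) := by
  refine ⟨L.contDiff, fun n => ?_⟩
  match n with
  | 0 =>
    refine ⟨‖L‖, fun x => ?_⟩
    simp only [norm_iteratedFDeriv_zero, Nat.cast_zero, sub_zero, Real.rpow_one]
    exact (L.le_opNorm x).trans (by gcongr; exact norm_le_bracket x)
  | 1 =>
    refine ⟨‖L‖, fun x => ?_⟩
    rw [norm_iteratedFDeriv_one]
    simp
  | n + 2 =>
    refine ⟨0, fun x => ?_⟩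
    have h1 : _root_.fderiv ℝ (fun x => L x) = fun _ => L := by ext1 x; exact L.fderiv
    rw [← norm_iteratedFDeriv_fderiv, h1, ← norm_iteratedFDeriv_fderiv, fderiv_fun_const]
    have : iteratedFDeriv ℝ n (0 : Space d → Space d →L[ℝ] Space d →L[ℝ] F) = 0 :=
      iteratedFDeriv_fun_zero
    rw [this]
    simp

theorem id : IsSymbol 1 (fun x : Space d => x) := clm (ContinuousLinearMap.id ℝ (Space d))

end IsSymbol

end Symbols

/-! ### Radial averages of symbols. -/

/-- A weighted average of `f` along the segment from the origin. -/
noncomputable def radialAverage {d : ℕ} {F : Type} [NormedAddCommGroup F] [NormedSpace ℝ F]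
    (k : ℕ) (f : Space d → F) (x : Space d) : F :=
  ∫ s in (0 : ℝ)..1, s ^ k • f (s • x)

section Average

variable {d : ℕ}

theorem intervalIntegrable_radialAverage {F : Type} [NormedAddCommGroup F] [NormedSpace ℝ F]
    {f : Space d → F} (hf : Continuous f) (k : ℕ) (x : Space d) (a b : ℝ) :
    IntervalIntegrable (fun s : ℝ => s ^ k • f (s • x)) MeasureTheory.volume a b :=
  Continuous.intervalIntegrable (by fun_prop) _ _

/-- For m ≤ 0 the integrand is at most C s^{m+k} ⟨x⟩^m, and s^{m+k} is integrable at 0 exactly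
because m + k > -1. -/
theorem norm_radialAverage_le {F : Type} [NormedAddCommGroup F] [NormedSpace ℝ F] {m C : ℝ}
    {f : Space d → F} (hC0 : 0 ≤ C) (hC : ∀ x, ‖f x‖ ≤ C * bracket x ^ m)
    (hm : m ≤ 0) {k : ℕ} (hk : -1 < m + k) (x : Space d) :
    ‖radialAverage k f x‖ ≤ C * (1 / (m + k + 1)) * bracket x ^ m := by
  have hb := bracket_pos x
  have key : ∀ s : ℝ, s ∈ Set.Ioc (0 : ℝ) 1 →
      ‖s ^ k • f (s • x)‖ ≤ C * bracket x ^ m * s ^ (m + k) := by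
    intro s hs
    rw [norm_smul, Real.norm_of_nonneg (pow_nonneg hs.1.le k)]
    have h1 : bracket (s • x) ^ m ≤ (s * bracket x) ^ m :=
      Real.rpow_le_rpow_of_nonpos (mul_pos hs.1 hb)
        (mul_bracket_le_bracket_smul x hs.1.le hs.2) hm
    rw [Real.mul_rpow hs.1.le hb.le] at h1
    calc s ^ k * ‖f (s • x)‖ ≤ s ^ k * (C * (s ^ m * bracket x ^ m)) := by
          have := hs.1
          gcongr
          exact (hC _).trans (by gcongr)
      _ = C * bracket x ^ m * (s ^ m * s ^ k) := by ring
      _ = _ := by rw [Real.rpow_add_natCast hs.1.ne']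
  have hint : IntervalIntegrable (fun s : ℝ => C * bracket x ^ m * s ^ (m + k))
      MeasureTheory.volume 0 1 := (intervalIntegral.intervalIntegrable_rpow' hk).const_mul _
  refine (intervalIntegral.norm_integral_le_of_norm_le zero_le_one
    (MeasureTheory.ae_of_all _ key) hint).trans (le_of_eq ?_)
  rw [intervalIntegral.integral_const_mul, integral_rpow (Or.inl hk), Real.one_rpow,
    Real.zero_rpow (by linarith)]
  ring

theorem hasFDerivAt_radialAverage {F : Type} [NormedAddCommGroup F] [NormedSpace ℝ F]
    {f : Space d → F} (hf : ContDiff ℝ 1 f) (k : ℕ) (x : Space d) :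
    HasFDerivAt (radialAverage k f) (radialAverage (k + 1) (fderiv ℝ f) x) x := by
  have hc : Continuous (fun p : ℝ × Space d => p.1 ^ (k + 1) • fderiv ℝ f (p.1 • p.2)) := by
    have := hf.continuous_fderiv (by simp)
    fun_prop
  obtain ⟨C, hC⟩ := (isCompact_Icc.prod (isCompact_closedBall x 1)).exists_bound_of_continuousOn
    (hc.continuousOn (s := Set.Icc (0 : ℝ) 1 ×ˢ Metric.closedBall x 1))
  have hfc := hf.continuous
  unfold radialAverage
  refine intervalIntegral.hasFDerivAt_integral_of_dominated_of_fderiv_le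
    (F' := fun x s => s ^ (k + 1) • fderiv ℝ f (s • x)) (bound := fun _ => C)
    (Metric.closedBall_mem_nhds x one_pos) ?_ ?_ ?_ ?_ ?_ ?_
  · exact Eventually.of_forall fun y => Continuous.aestronglyMeasurable (by fun_prop)
  · exact intervalIntegrable_radialAverage hfc k x 0 1
  · have : SecondCountableTopologyEither ℝ (Space d →L[ℝ] F) :=
      secondCountableTopologyEither_of_left _ _
    refine Continuous.aestronglyMeasurable ?_
    exact hc.comp (by fun_prop : Continuous fun s : ℝ => (s, x))
  · refine MeasureTheory.ae_of_all _ fun s hs y hy => ?_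
    rw [Set.uIoc_of_le zero_le_one] at hs
    exact hC (s, y) ⟨⟨hs.1.le, hs.2⟩, hy⟩
  · exact intervalIntegrable_const
  · refine MeasureTheory.ae_of_all _ fun s _ y _ => ?_
    have h1 : HasFDerivAt (fun y : Space d => s • y) (s • ContinuousLinearMap.id ℝ (Space d)) y :=
      (hasFDerivAt_id y).const_smul s
    have h2 := ((hf.differentiable (by simp)).differentiableAt (x := s • y)).hasFDerivAt
    convert! (h2.comp y h1).const_smul (s ^ k) using 1
    ext v
    simp [pow_succ, mul_smul]

/-- Differentiation lowers m and raises k by one, so m + k > -1 is preserved. The induction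
therefore has to run over all k and all target spaces. -/
theorem IsSymbol.radialAverage_aux (n : ℕ) : ∀ {F : Type} [NormedAddCommGroup F] [NormedSpace ℝ F]
    {m : ℝ} {f : Space d → F} {k : ℕ}, IsSymbol m f → m ≤ 0 → -1 < m + k →
    ContDiff ℝ n (ClassicalScattering.radialAverage k f) ∧ ∃ C : ℝ, ∀ x,
      ‖iteratedFDeriv ℝ n (ClassicalScattering.radialAverage k f) x‖ ≤ C * bracket x ^ (m - n) := by
  induction n with
  | zero =>
    intro F _ _ m f k hf hm hk
    obtain ⟨C, hC0, hC⟩ := hf.exists_norm_le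
    refine ⟨contDiff_zero.2 (continuous_iff_continuousAt.2 fun x =>
      (hasFDerivAt_radialAverage (hf.contDiff.of_le (by simp)) k x).continuousAt), ?_⟩
    refine ⟨C * (1 / (m + k + 1)), fun x => ?_⟩
    simpa using norm_radialAverage_le hC0 hC hm hk x
  | succ n ih =>
    intro F _ _ m f k hf hm hk
    have h1 : _root_.fderiv ℝ (ClassicalScattering.radialAverage k f)
        = ClassicalScattering.radialAverage (k + 1) (_root_.fderiv ℝ f) := by
      ext1 x
      exact (hasFDerivAt_radialAverage (hf.contDiff.of_le (by simp)) k x).fderiv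
    obtain ⟨h2, C, hC⟩ := ih (k := k + 1) hf.fderiv (by linarith) (by push_cast; linarith)
    refine ⟨?_, C, fun x => ?_⟩
    · push_cast
      refine contDiff_succ_iff_fderiv.2 ⟨fun x =>
        (hasFDerivAt_radialAverage (hf.contDiff.of_le (by simp)) k x).differentiableAt,
        by simp, ?_⟩
      rwa [h1]
    · rw [← norm_iteratedFDeriv_fderiv, h1]
      refine (hC x).trans (le_of_eq ?_)
      push_cast
      ring_nf

theorem IsSymbol.radialAverage {F : Type} [NormedAddCommGroup F] [NormedSpace ℝ F]
    {m : ℝ} {f : Space d → F} (hf : IsSymbol m f) (hm : m ≤ 0) (hm1 : -1 < m) :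
    IsSymbol m (ClassicalScattering.radialAverage 0 f) :=
  ⟨contDiff_infty.2 fun n => (radialAverage_aux n hf hm (by simpa using hm1)).1,
    fun n => (radialAverage_aux n hf hm (by simpa using hm1)).2⟩

end Average

/-- A function with scalar values is a symbol if its mixed partial derivatives are. -/
theorem isSymbol_of_partialDeriv {d : ℕ} {m : ℝ} {f : Space d → ℝ} (hf : ContDiff ℝ ∞ f)
    (h : ∀ (n : ℕ) (i : Fin n → Fin d), ∃ C : ℝ, ∀ x,
      |partialDeriv i f x| ≤ C * bracket x ^ (m - n)) : IsSymbol m f := by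
  refine ⟨hf, fun n => ?_⟩
  choose C hC using h n
  refine ⟨∑ i, C i, fun x => ?_⟩
  have h0 : ∀ i, 0 ≤ C i * bracket x ^ (m - n) := fun i => (abs_nonneg _).trans (hC i x)
  rw [Finset.sum_mul]
  refine ContinuousMultilinearMap.opNorm_le_bound (Finset.sum_nonneg fun i _ => h0 i) fun v => ?_
  have hv : v = fun j => ∑ l, v j l • EuclideanSpace.single l (1 : ℝ) := by
    funext j
    have := (EuclideanSpace.basisFun (Fin d) ℝ).sum_repr (v j)
    simpa using this.symm
  have h1 : iteratedFDeriv ℝ n f x v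
      = ∑ i : Fin n → Fin d, (∏ j, v j (i j)) * partialDeriv i f x := by
    conv_lhs => rw [hv]
    have := (iteratedFDeriv ℝ n f x).toMultilinearMap.map_sum
      (fun (j : Fin n) (l : Fin d) => v j l • EuclideanSpace.single l (1 : ℝ))
    refine this.trans (Finset.sum_congr rfl fun i _ => ?_)
    rw [MultilinearMap.map_smul_univ]
    rfl
  rw [h1, Finset.sum_mul]
  refine (norm_sum_le _ _).trans (Finset.sum_le_sum fun i _ => ?_)
  rw [norm_mul, mul_comm]
  refine mul_le_mul (hC i x) ?_ (norm_nonneg _) (h0 i)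
  rw [norm_prod]
  exact Finset.prod_le_prod (fun _ _ => norm_nonneg _) fun j _ => PiLp.norm_apply_le _ _

/-! ### Operations on bounded continuous functions. -/

open Classical in
/-- The bounded continuous function with values `g t`, if `g` is bounded and continuous. -/
noncomputable def toBCF {T F : Type} [TopologicalSpace T] [NormedAddCommGroup F] (g : T → F) :
    T →ᵇ F :=
  if h : Continuous g ∧ ∃ C, ∀ t, ‖g t‖ ≤ C then
    BoundedContinuousFunction.ofNormedAddCommGroup g h.1 h.2.choose h.2.choose_spec else 0

theorem toBCF_apply {T F : Type} [TopologicalSpace T] [NormedAddCommGroup F] {g : T → F}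
    (hg : Continuous g) {C : ℝ} (hC : ∀ t, ‖g t‖ ≤ C) (t : T) : toBCF g t = g t := by
  unfold toBCF
  rw [dif_pos ⟨hg, C, hC⟩]
  rfl

section BoundedFunctions

variable {T S : Type} [TopologicalSpace T] [TopologicalSpace S]
  {F G H : Type} [NormedAddCommGroup F] [NormedSpace ℝ F]
  [NormedAddCommGroup G] [NormedSpace ℝ G] [NormedAddCommGroup H] [NormedSpace ℝ H]

/-- The pointwise action of a bilinear map on bounded continuous functions. -/
noncomputable def bcfBilinear (T : Type) [TopologicalSpace T] (L : F →L[ℝ] G →L[ℝ] H) :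
    (T →ᵇ F) →L[ℝ] (T →ᵇ G) →L[ℝ] (T →ᵇ H) :=
  LinearMap.mkContinuous₂
    (LinearMap.mk₂ ℝ (fun (f : T →ᵇ F) (g : T →ᵇ G) =>
      BoundedContinuousFunction.ofNormedAddCommGroup (fun t => L (f t) (g t))
        ((L.continuous.comp f.continuous).clm_apply g.continuous) (‖L‖ * ‖f‖ * ‖g‖) (fun t =>
          (L.le_opNorm₂ _ _).trans (by
            have := f.norm_coe_le_norm t
            have := g.norm_coe_le_norm t
            gcongr)))
      (fun f f' g => by ext t; simp)
      (fun c f g => by ext t; simp)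
      (fun f g g' => by ext t; simp)
      (fun c f g => by ext t; simp))
    ‖L‖ (fun f g => (BoundedContinuousFunction.norm_le (by positivity)).2 fun t =>
      (L.le_opNorm₂ _ _).trans (by
        have := f.norm_coe_le_norm t
        have := g.norm_coe_le_norm t
        gcongr))

/-- Pointwise application of a bounded family of continuous linear maps. -/
noncomputable def bcfApply (T : Type) [TopologicalSpace T] (F G : Type) [NormedAddCommGroup F]
    [NormedSpace ℝ F] [NormedAddCommGroup G] [NormedSpace ℝ G] :
    (T →ᵇ (F →L[ℝ] G)) →L[ℝ] (T →ᵇ F) →L[ℝ] (T →ᵇ G) :=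
  bcfBilinear T (ContinuousLinearMap.id ℝ (F →L[ℝ] G))

@[simp]
theorem bcfApply_apply (f : T →ᵇ (F →L[ℝ] G)) (g : T →ᵇ F) (t : T) :
    bcfApply T F G f g t = f t (g t) := rfl

/-- Pointwise multiplication by a bounded scalar function. -/
noncomputable def bcfSmul (F : Type) [NormedAddCommGroup F] [NormedSpace ℝ F] (ρ : T →ᵇ ℝ) :
    (T →ᵇ F) →L[ℝ] (T →ᵇ F) :=
  bcfBilinear T (ContinuousLinearMap.lsmul ℝ ℝ) ρ

@[simp]
theorem bcfSmul_apply (ρ : T →ᵇ ℝ) (g : T →ᵇ F) (t : T) : bcfSmul F ρ g t = ρ t • g t := rfl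

/-- Composition with a continuous map of the index space. -/
noncomputable def bcfComp (F : Type) [NormedAddCommGroup F] [NormedSpace ℝ F] (π : C(T, S)) :
    (S →ᵇ F) →L[ℝ] (T →ᵇ F) :=
  LinearMap.mkContinuous
    { toFun := fun g => g.compContinuous π
      map_add' := fun _ _ => rfl
      map_smul' := fun _ _ => rfl } 1
    (fun g => by
      rw [one_mul]
      exact (BoundedContinuousFunction.norm_le (norm_nonneg g)).2 fun t => g.norm_coe_le_norm _)

/-- Integration over the unit interval in the second variable. -/
noncomputable def bcfIntegral (T : Type) [TopologicalSpace T] (F : Type) [NormedAddCommGroup F]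
    [NormedSpace ℝ F] : (T × ℝ →ᵇ F) →L[ℝ] (T →ᵇ F) :=
  LinearMap.mkContinuous
    { toFun := fun g => BoundedContinuousFunction.ofNormedAddCommGroup
        (fun t => ∫ r in (0 : ℝ)..1, g (t, r))
        (intervalIntegral.continuous_parametric_intervalIntegral_of_continuous'
          (f := fun t r => g (t, r)) g.continuous 0 1) ‖g‖
        (fun t => by
          simpa using intervalIntegral.norm_integral_le_of_norm_le_const (a := 0) (b := 1)
            (f := fun r => g (t, r)) (C := ‖g‖) fun r _ => g.norm_coe_le_norm _)
      map_add' := fun f g => by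
        ext t
        have h (g : T × ℝ →ᵇ F) :
            IntervalIntegrable (fun r => g (t, r)) MeasureTheory.volume 0 1 :=
          Continuous.intervalIntegrable (by fun_prop) _ _
        simpa using intervalIntegral.integral_add (h f) (h g)
      map_smul' := fun c g => by
        ext t
        simp } 1
    (fun g => by
      rw [one_mul]
      exact (BoundedContinuousFunction.norm_le (norm_nonneg _)).2 fun t => by
        simpa using intervalIntegral.norm_integral_le_of_norm_le_const (a := 0) (b := 1)
          (f := fun r => g (t, r)) (C := ‖g‖) fun r _ => g.norm_coe_le_norm _)

/-- Constant functions, as a continuous linear map. -/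
noncomputable def bcfConst (T : Type) [TopologicalSpace T] (F : Type) [NormedAddCommGroup F]
    [NormedSpace ℝ F] : F →L[ℝ] (T →ᵇ F) :=
  LinearMap.mkContinuous
    { toFun := fun x => BoundedContinuousFunction.const T x
      map_add' := fun _ _ => rfl
      map_smul' := fun _ _ => rfl } 1
    (fun x => by rw [one_mul]; exact BoundedContinuousFunction.norm_const_le x)

@[simp]
theorem bcfConst_apply (x : F) (t : T) : bcfConst T F x t = x := rfl

end BoundedFunctions

/-! ### Smoothness of the action of symbols on bounded paths. -/

section Nemytskii

variable {T : Type} [TopologicalSpace T] {d : ℕ}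

/-- Bounded paths `u` such that `τ u` stays in the region where `⟨τ u⟩ ≥ c τ`. -/
def awayFromZero (d : ℕ) (τ : T → ℝ) : Set (T →ᵇ Space d) :=
  {u | ∃ c > 0, ∀ t, c ≤ (τ t)⁻¹ + ‖u t‖}

theorem isOpen_awayFromZero (τ : T → ℝ) : IsOpen (awayFromZero d τ) := by
  rw [Metric.isOpen_iff]
  rintro u ⟨c, hc, h⟩
  refine ⟨c / 2, by positivity, fun v hv => ⟨c / 2, by positivity, fun t => ?_⟩⟩
  have h1 := BoundedContinuousFunction.dist_coe_le_dist (f := v) (g := u) t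
  have h2 : ‖u t‖ ≤ ‖v t‖ + ‖v t - u t‖ := by
    have := norm_sub_norm_le (u t) (v t)
    rw [norm_sub_rev] at this
    linarith
  rw [dist_eq_norm] at h1
  have := Metric.mem_ball.1 hv
  linarith [h t]

/-- The action `u ↦ τ^{-m} b(τ u)` of a symbol of order `m` on bounded paths. -/
noncomputable def nemytskii {F : Type} [NormedAddCommGroup F] [NormedSpace ℝ F] (τ : T → ℝ)
    (m : ℝ) (b : Space d → F) (u : T →ᵇ Space d) : T →ᵇ F :=
  toBCF fun t => τ t ^ (-m) • b (τ t • u t)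

/-- The quotient ⟨s x⟩ / s is confined to [c/2, 1 + |R|], so its m-th power is bounded uniformly in
s ≥ 1. -/
theorem IsSymbol.exists_scaled_bound {F : Type} [NormedAddCommGroup F] [NormedSpace ℝ F] {m : ℝ}
    {b : Space d → F} (hb : IsSymbol m b) {c : ℝ} (hc : 0 < c) (R : ℝ) :
    ∃ C : ℝ, 0 ≤ C ∧ ∀ (s : ℝ) (x : Space d), 1 ≤ s → c ≤ s⁻¹ + ‖x‖ → ‖x‖ ≤ R →
      ‖s ^ (-m) • b (s • x)‖ ≤ C := by
  obtain ⟨C, hC0, hC⟩ := hb.exists_norm_le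
  -- The sum of the two endpoint values covers both signs of m.
  refine ⟨C * ((1 + |R|) ^ m + (c / 2) ^ m), by positivity, fun s x hs hx hxR => ?_⟩
  have hs0 : 0 < s := by linarith
  have hp := bracket_pos (s • x)
  have h1 : c / 2 ≤ bracket (s • x) / s := by
    have h := one_add_norm_le_two_mul_bracket (s • x)
    rw [norm_smul, Real.norm_of_nonneg hs0.le] at h
    rw [le_div_iff₀ hs0]
    have h' : c * s ≤ (s⁻¹ + ‖x‖) * s := by gcongr
    have h'' : (s⁻¹ + ‖x‖) * s = 1 + s * ‖x‖ := by field_simp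
    linarith
  have h2 : bracket (s • x) / s ≤ 1 + |R| := by
    have h := bracket_le_one_add_norm (s • x)
    rw [norm_smul, Real.norm_of_nonneg hs0.le] at h
    rw [div_le_iff₀ hs0]
    have : ‖x‖ ≤ |R| := hxR.trans (le_abs_self R)
    nlinarith
  have h3 : (bracket (s • x) / s) ^ m ≤ (1 + |R|) ^ m + (c / 2) ^ m := by
    have hR : 0 ≤ (1 + |R|) ^ m := by positivity
    have hc' : 0 ≤ (c / 2) ^ m := by positivity
    rcases le_total 0 m with hm | hm
    · have := Real.rpow_le_rpow (by positivity) h2 hm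
      linarith
    · have := Real.rpow_le_rpow_of_nonpos (by positivity) h1 hm
      linarith
  calc ‖s ^ (-m) • b (s • x)‖ = s ^ (-m) * ‖b (s • x)‖ := by
        rw [norm_smul, Real.norm_of_nonneg (by positivity)]
    _ ≤ s ^ (-m) * (C * bracket (s • x) ^ m) := by gcongr; exact hC _
    _ = C * (bracket (s • x) / s) ^ m := by
        rw [Real.div_rpow hp.le hs0.le, Real.rpow_neg hs0.le]
        field_simp
    _ ≤ _ := by gcongr

theorem nemytskii_apply {τ : T → ℝ} (hτc : Continuous τ) (hτ : ∀ t, 1 ≤ τ t)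
    {F : Type} [NormedAddCommGroup F] [NormedSpace ℝ F] {m : ℝ}
    {b : Space d → F} (hb : IsSymbol m b) {u : T →ᵇ Space d} (hu : u ∈ awayFromZero d τ) (t : T) :
    nemytskii τ m b u t = τ t ^ (-m) • b (τ t • u t) := by
  obtain ⟨c, hc, h⟩ := hu
  obtain ⟨C, -, hC⟩ := hb.exists_scaled_bound hc ‖u‖
  refine toBCF_apply ?_ (fun t => hC (τ t) (u t) (hτ t) (h t) (u.norm_coe_le_norm t)) t
  have := hb.contDiff.continuous
  have h1 : Continuous fun t => τ t ^ (-m) :=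
    hτc.rpow_const fun t => Or.inl (by linarith [hτ t])
  fun_prop

/-- The chain rule produces one factor s, which is exactly the change of normalization from order m
to order m - 1. The derivative thus has the same form as the function. -/
theorem IsSymbol.hasFDerivAt_scaled {F : Type} [NormedAddCommGroup F] [NormedSpace ℝ F] {m : ℝ}
    {b : Space d → F} (hb : IsSymbol m b) {s : ℝ} (hs : 0 < s) (x : Space d) :
    HasFDerivAt (fun x => s ^ (-m) • b (s • x)) (s ^ (-(m - 1)) • _root_.fderiv ℝ b (s • x)) x := by
  have h1 : HasFDerivAt (fun y : Space d => s • y) (s • ContinuousLinearMap.id ℝ (Space d)) x :=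
    (hasFDerivAt_id x).const_smul s
  have h2 := (hb.differentiable.differentiableAt (x := s • x)).hasFDerivAt
  convert! (h2.comp x h1).const_smul (s ^ (-m)) using 1
  ext v
  have : s ^ (-(m - 1)) = s ^ (-m) * s := by
    rw [neg_sub, sub_eq_add_neg, add_comm, Real.rpow_add hs, Real.rpow_one]
  change s ^ (-(m - 1)) • _root_.fderiv ℝ b (s • x) v = s ^ (-m) • _root_.fderiv ℝ b (s • x) (s • v)
  rw [map_smul, this, mul_smul]

/-- Second order Taylor remainder, by two applications of the mean value inequality. It makes the
differentiability estimate below uniform in t. -/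
theorem norm_sub_sub_le_of_hasFDerivAt {X Y : Type} [NormedAddCommGroup X] [NormedSpace ℝ X]
    [NormedAddCommGroup Y] [NormedSpace ℝ Y] {f : X → Y} {f' : X → X →L[ℝ] Y}
    {f'' : X → X →L[ℝ] X →L[ℝ] Y} {x v : X} {r C : ℝ} (hr : 0 ≤ r) (hv : ‖v‖ ≤ r)
    (hf : ∀ y ∈ Metric.closedBall x r, HasFDerivAt f (f' y) y)
    (hf' : ∀ y ∈ Metric.closedBall x r, HasFDerivAt f' (f'' y) y)
    (hC : ∀ y ∈ Metric.closedBall x r, ‖f'' y‖ ≤ C) :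
    ‖f (x + v) - f x - f' x v‖ ≤ C * r * r := by
  have hx : x ∈ Metric.closedBall x r := Metric.mem_closedBall_self hr
  have hC0 : 0 ≤ C := (f'' x).opNorm_nonneg.trans (hC x hx)
  have hxv : x + v ∈ Metric.closedBall x r := by
    rw [mem_closedBall_iff_norm]
    simpa using hv
  have hlip : ∀ y ∈ Metric.closedBall x r, ‖f' y - f' x‖ ≤ C * r := by
    intro y hy
    refine ((convex_closedBall x r).norm_image_sub_le_of_norm_hasFDerivWithin_le
      (fun y hy => (hf' y hy).hasFDerivWithinAt) hC hx hy).trans ?_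
    rw [mem_closedBall_iff_norm] at hy
    gcongr
  have h := (convex_closedBall x r).norm_image_sub_le_of_norm_hasFDerivWithin_le'
    (fun y hy => (hf y hy).hasFDerivWithinAt) hlip hx hxv
  rw [add_sub_cancel_left] at h
  exact h.trans (by gcongr)

theorem hasFDerivAt_nemytskii {τ : T → ℝ} (hτc : Continuous τ) (hτ : ∀ t, 1 ≤ τ t)
    {F : Type} [NormedAddCommGroup F] [NormedSpace ℝ F] {m : ℝ}
    {b : Space d → F} (hb : IsSymbol m b) {u : T →ᵇ Space d} (hu : u ∈ awayFromZero d τ) :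
    HasFDerivAt (nemytskii τ m b)
      (bcfApply T (Space d) F (nemytskii τ (m - 1) (fderiv ℝ b) u)) u := by
  obtain ⟨c, hc, h⟩ := id hu
  -- Every point within c/2 of some u t satisfies the lower bound with c/2 and the upper bound with
  -- ‖u‖ + c/2, so a single C bounds all the second derivatives needed.
  obtain ⟨C, hC0, hC⟩ := hb.fderiv.fderiv.exists_scaled_bound (half_pos hc) (‖u‖ + c / 2)
  rw [hasFDerivAt_iff_isLittleO_nhds_zero]
  refine Asymptotics.IsBigO.trans_isLittleO (g := fun h => ‖h‖ ^ 2) ?_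
    (Asymptotics.isLittleO_norm_pow_id one_lt_two)
  refine Asymptotics.IsBigO.of_bound C ?_
  have hopen : ∀ᶠ v in 𝓝 (0 : T →ᵇ Space d), u + v ∈ awayFromZero d τ := by
    have : Tendsto (fun v => u + v) (𝓝 0) (𝓝 u) := by
      simpa using (continuous_const_add u).tendsto 0
    exact this ((isOpen_awayFromZero τ).mem_nhds hu)
  filter_upwards [hopen, Metric.ball_mem_nhds (0 : T →ᵇ Space d) (half_pos hc)] with v hv1 hv2
  rw [mem_ball_zero_iff] at hv2
  rw [norm_pow, norm_norm]
  refine (BoundedContinuousFunction.norm_le (by positivity)).2 fun t => ?_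
  have hs0 : 0 < τ t := by linarith [hτ t]
  have hvt : ‖v t‖ ≤ ‖v‖ := v.norm_coe_le_norm t
  simp only [BoundedContinuousFunction.coe_sub, BoundedContinuousFunction.coe_add, Pi.sub_apply,
    bcfApply_apply, nemytskii_apply hτc hτ hb hv1, nemytskii_apply hτc hτ hb hu,
    nemytskii_apply hτc hτ hb.fderiv hu, Pi.add_apply]
  have h4 := norm_sub_sub_le_of_hasFDerivAt (norm_nonneg v) hvt
    (fun y _ => hb.hasFDerivAt_scaled hs0 y) (fun y _ => hb.fderiv.hasFDerivAt_scaled hs0 y)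
    (C := C) (x := u t) (fun x hx => by
      rw [mem_closedBall_iff_norm] at hx
      have h1 := norm_sub_norm_le x (u t)
      have h2 := norm_sub_norm_le (u t) x
      rw [norm_sub_rev] at h2
      have h3 := u.norm_coe_le_norm t
      exact hC (τ t) x (hτ t) (by linarith [h t]) (by linarith))
  refine h4.trans ?_
  rw [sq, ← mul_assoc]

/-- The derivative is pointwise application of the Nemytskii operator of the symbol `fderiv ℝ b`, of
order m - 1. Induction over all symbols with all target spaces then gives every order. -/
theorem contDiffAt_nemytskii_nat {τ : T → ℝ} (hτc : Continuous τ) (hτ : ∀ t, 1 ≤ τ t)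
    (n : ℕ) : ∀ {F : Type} [NormedAddCommGroup F] [NormedSpace ℝ F]
    {m : ℝ} {b : Space d → F} (_ : IsSymbol m b) {u : T →ᵇ Space d}
    (_ : u ∈ awayFromZero d τ), ContDiffAt ℝ n (nemytskii τ m b) u := by
  induction n with
  | zero =>
    intro F _ _ m b hb u hu
    refine contDiffAt_zero.2 ⟨awayFromZero d τ, (isOpen_awayFromZero τ).mem_nhds hu, ?_⟩
    exact fun v hv => (hasFDerivAt_nemytskii hτc hτ hb hv).continuousAt.continuousWithinAt
  | succ n ih =>
    intro F _ _ m b hb u hu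
    push_cast
    refine contDiffAt_succ_iff_hasFDerivAt.2
      ⟨fun u => bcfApply T (Space d) F (nemytskii τ (m - 1) (fderiv ℝ b) u),
        ⟨awayFromZero d τ, (isOpen_awayFromZero τ).mem_nhds hu,
          fun v hv => hasFDerivAt_nemytskii hτc hτ hb hv⟩, ?_⟩
    exact (bcfApply T (Space d) F).contDiff.contDiffAt.comp u (ih hb.fderiv hu)

theorem contDiffAt_nemytskii {τ : T → ℝ} (hτc : Continuous τ) (hτ : ∀ t, 1 ≤ τ t)
    {F : Type} [NormedAddCommGroup F] [NormedSpace ℝ F]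
    {m : ℝ} {b : Space d → F} (hb : IsSymbol m b) {u : T →ᵇ Space d}
    (hu : u ∈ awayFromZero d τ) : ContDiffAt ℝ ∞ (nemytskii τ m b) u :=
  contDiffAt_infty.2 fun n => contDiffAt_nemytskii_nat hτc hτ n hb hu

end Nemytskii

/-! ### Weighted primitives of bounded paths. -/

/-- A nonnegative continuous integrable weight on the time axis. -/
structure TimeWeight where
  toFun : ℝ → ℝ
  continuous : Continuous toFun
  nonneg : ∀ t, 0 ≤ toFun t
  integrable : MeasureTheory.Integrable toFun

namespace TimeWeight

variable (w : TimeWeight) {E : Type} [NormedAddCommGroup E] [NormedSpace ℝ E]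

theorem continuous_smul (g : ℝ →ᵇ E) : Continuous fun t => w.toFun t • g t :=
  w.continuous.smul g.continuous

theorem norm_smul_le (g : ℝ →ᵇ E) (t : ℝ) : ‖w.toFun t • g t‖ ≤ w.toFun t * ‖g‖ := by
  rw [norm_smul, Real.norm_of_nonneg (w.nonneg t)]
  exact mul_le_mul_of_nonneg_left (g.norm_coe_le_norm t) (w.nonneg t)

theorem integrable_smul (g : ℝ →ᵇ E) : MeasureTheory.Integrable fun t => w.toFun t • g t :=
  (w.integrable.mul_const ‖g‖).mono' (w.continuous_smul g).aestronglyMeasurable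
    (MeasureTheory.ae_of_all _ (w.norm_smul_le g))

theorem integral_Ioi_nonneg (T : ℝ) : 0 ≤ ∫ t in Set.Ioi T, w.toFun t :=
  MeasureTheory.integral_nonneg w.nonneg

theorem intervalIntegral_le_integral_Ioi {T s : ℝ} (h : T ≤ s) :
    ∫ r in T..s, w.toFun r ≤ ∫ r in Set.Ioi T, w.toFun r := by
  rw [intervalIntegral.integral_of_le h]
  exact MeasureTheory.setIntegral_mono_set w.integrable.integrableOn
    (MeasureTheory.ae_of_all _ w.nonneg) Set.Ioc_subset_Ioi_self.eventuallyLE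

theorem norm_intervalIntegral_smul_le (g : ℝ →ᵇ E) {T s : ℝ} (h : T ≤ s) :
    ‖∫ r in T..s, w.toFun r • g r‖ ≤ (∫ r in Set.Ioi T, w.toFun r) * ‖g‖ := by
  refine (intervalIntegral.norm_integral_le_of_norm_le h
    (MeasureTheory.ae_of_all _ fun t _ => w.norm_smul_le g t)
    (w.integrable.mul_const ‖g‖).intervalIntegrable).trans ?_
  rw [intervalIntegral.integral_mul_const]
  exact mul_le_mul_of_nonneg_right (w.intervalIntegral_le_integral_Ioi h) (norm_nonneg g)

/-- The total weighted integral of a bounded function over `(T, ∞)`. -/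
noncomputable def total (E : Type) [NormedAddCommGroup E] [NormedSpace ℝ E] (T : ℝ) :
    (ℝ →ᵇ E) →L[ℝ] E :=
  LinearMap.mkContinuous
    { toFun := fun g => ∫ t in Set.Ioi T, w.toFun t • g t
      map_add' := fun f g => by
        simpa using MeasureTheory.integral_add (w.integrable_smul f).integrableOn
          (w.integrable_smul g).integrableOn
      map_smul' := fun c g => by
        simp only [BoundedContinuousFunction.coe_smul, RingHom.id_apply, smul_comm _ c]
        rw [MeasureTheory.integral_smul] }
    (∫ t in Set.Ioi T, w.toFun t)
    (fun g => by
      refine (MeasureTheory.norm_integral_le_of_norm_le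
        (w.integrable.mul_const ‖g‖).integrableOn
        (MeasureTheory.ae_of_all _ (w.norm_smul_le g))).trans (le_of_eq ?_)
      exact MeasureTheory.integral_mul_const _ _)

theorem norm_total_le (T : ℝ) : ‖w.total E T‖ ≤ ∫ t in Set.Ioi T, w.toFun t :=
  LinearMap.mkContinuous_norm_le _ (w.integral_Ioi_nonneg T) _

/-- The weighted primitive which vanishes on `(-∞, T]`. -/
noncomputable def forward (E : Type) [NormedAddCommGroup E] [NormedSpace ℝ E] (T : ℝ) :
    (ℝ →ᵇ E) →L[ℝ] (ℝ →ᵇ E) :=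
  LinearMap.mkContinuous
    { toFun := fun g => BoundedContinuousFunction.ofNormedAddCommGroup
        (fun t => ∫ r in T..(max t T), w.toFun r • g r)
        ((intervalIntegral.continuous_primitive
          (fun _ _ => (w.integrable_smul g).intervalIntegrable) T).comp
          (continuous_id.max continuous_const))
        ((∫ r in Set.Ioi T, w.toFun r) * ‖g‖)
        (fun t => w.norm_intervalIntegral_smul_le g (le_max_right _ _))
      map_add' := fun f g => by
        ext t
        simpa using intervalIntegral.integral_add (w.integrable_smul f).intervalIntegrable
          (w.integrable_smul g).intervalIntegrable
      map_smul' := fun c g => by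
        ext t
        simp [smul_comm _ c] }
    (∫ r in Set.Ioi T, w.toFun r)
    (fun g => (BoundedContinuousFunction.norm_le
      (mul_nonneg (w.integral_Ioi_nonneg T) (norm_nonneg g))).2
      fun _ => w.norm_intervalIntegral_smul_le g (le_max_right _ _))

theorem forward_apply (T : ℝ) (g : ℝ →ᵇ E) (t : ℝ) :
    w.forward E T g t = ∫ r in T..(max t T), w.toFun r • g r := rfl

theorem norm_forward_le (T : ℝ) : ‖w.forward E T‖ ≤ ∫ t in Set.Ioi T, w.toFun t :=
  LinearMap.mkContinuous_norm_le _ (w.integral_Ioi_nonneg T) _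

/-- The weighted primitive which vanishes at infinity and is constant on `(-∞, T]`. -/
noncomputable def backward (E : Type) [NormedAddCommGroup E] [NormedSpace ℝ E] (T : ℝ) :
    (ℝ →ᵇ E) →L[ℝ] (ℝ →ᵇ E) :=
  w.forward E T - (bcfConst ℝ E).comp (w.total E T)

theorem backward_apply (T : ℝ) (g : ℝ →ᵇ E) (t : ℝ) :
    w.backward E T g t = (∫ r in T..(max t T), w.toFun r • g r)
      - ∫ r in Set.Ioi T, w.toFun r • g r := rfl

theorem backward_apply' (T : ℝ) (g : ℝ →ᵇ E) (t : ℝ) :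
    w.backward E T g t = -∫ r in Set.Ioi (max t T), w.toFun r • g r := by
  rw [backward_apply, ← intervalIntegral.integral_Ioi_sub_Ioi
    (w.integrable_smul g).integrableOn (le_max_right t T)]
  abel

theorem norm_bcfConst_le : ‖bcfConst ℝ E‖ ≤ 1 :=
  LinearMap.mkContinuous_norm_le _ zero_le_one _

theorem norm_backward_le (T : ℝ) : ‖w.backward E T‖ ≤ 2 * ∫ t in Set.Ioi T, w.toFun t := by
  refine (norm_sub_le _ _).trans ?_
  have h1 := w.norm_forward_le (E := E) T
  have h2 := (ContinuousLinearMap.opNorm_comp_le (bcfConst ℝ E) (w.total E T))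
  have h3 := w.norm_total_le (E := E) T
  have h4 := norm_bcfConst_le (E := E)
  have h5 : ‖bcfConst ℝ E‖ * ‖w.total E T‖ ≤ 1 * ‖w.total E T‖ := by gcongr
  linarith

theorem tendsto_integral_Ioi : Tendsto (fun T => ∫ t in Set.Ioi T, w.toFun t) atTop (𝓝 0) := by
  have h := MeasureTheory.intervalIntegral_tendsto_integral_Ioi 0
    w.integrable.integrableOn tendsto_id (f := w.toFun) (l := atTop)
  have h2 := (tendsto_const_nhds (x := ∫ t in Set.Ioi 0, w.toFun t)).sub h
  rw [sub_self] at h2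
  refine h2.congr' ?_
  filter_upwards [eventually_ge_atTop 0] with T hT
  rw [id, ← intervalIntegral.integral_Ioi_sub_Ioi w.integrable.integrableOn hT]
  simp

theorem tendsto_norm_backward : Tendsto (fun T => ‖w.backward E T‖) atTop (𝓝 0) := by
  refine squeeze_zero (fun _ => norm_nonneg _) w.norm_backward_le ?_
  simpa using w.tendsto_integral_Ioi.const_mul 2

theorem hasDerivAt_forward [CompleteSpace E] {T : ℝ} (g : ℝ →ᵇ E) {t : ℝ} (ht : T < t) :
    HasDerivAt (w.forward E T g) (w.toFun t • g t) t := by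
  have h := intervalIntegral.integral_hasDerivAt_right
    (w.integrable_smul g).intervalIntegrable (a := T) (b := t)
    ((w.continuous_smul g).stronglyMeasurableAtFilter _ _) (w.continuous_smul g).continuousAt
  refine h.congr_of_eventuallyEq ?_
  filter_upwards [eventually_gt_nhds ht] with s hs
  rw [forward_apply, max_eq_left hs.le]

theorem hasDerivAt_backward [CompleteSpace E] {T : ℝ} (g : ℝ →ᵇ E) {t : ℝ} (ht : T < t) :
    HasDerivAt (w.backward E T g) (w.toFun t • g t) t :=
  (w.hasDerivAt_forward g ht).sub_const _

theorem tendsto_forward (T : ℝ) (g : ℝ →ᵇ E) :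
    Tendsto (w.forward E T g) atTop (𝓝 (w.total E T g)) := by
  have h := MeasureTheory.intervalIntegral_tendsto_integral_Ioi T
    (w.integrable_smul g).integrableOn tendsto_id (l := atTop)
  refine h.congr' ?_
  filter_upwards [eventually_ge_atTop T] with t ht
  rw [forward_apply, max_eq_left ht]
  rfl

theorem tendsto_backward (T : ℝ) (g : ℝ →ᵇ E) : Tendsto (w.backward E T g) atTop (𝓝 0) := by
  have := (w.tendsto_forward T g).sub (tendsto_const_nhds (x := w.total E T g))
  rw [sub_self] at this
  exact this

/-- Passage from the differential equation on (T, ∞) to the integral equation on the whole line.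
Freezing u before T makes both sides constant there. -/
theorem eq_const_add_forward [CompleteSpace E] {T : ℝ} {u g : ℝ →ᵇ E} (hu : ∀ t, u t = u (max t T))
    (hd : ∀ t, T < t → HasDerivAt u (w.toFun t • g t) t) :
    u = bcfConst ℝ E (u T) + w.forward E T g := by
  ext t
  have h := intervalIntegral.integral_eq_sub_of_hasDerivAt_of_le (le_max_right t T)
    u.continuous.continuousOn (fun x hx => hd x hx.1) (w.integrable_smul g).intervalIntegrable
  simp [forward_apply, h, ← hu]

theorem eq_const_add_backward [CompleteSpace E] {T : ℝ} {u g : ℝ →ᵇ E} {z : E}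
    (hu : ∀ t, u t = u (max t T))
    (hd : ∀ t, T < t → HasDerivAt u (w.toFun t • g t) t) (hz : Tendsto u atTop (𝓝 z)) :
    u = bcfConst ℝ E z + w.backward E T g := by
  ext t
  have h := MeasureTheory.integral_Ioi_of_hasDerivAt_of_tendsto (a := max t T)
    u.continuous.continuousWithinAt
    (fun x hx => hd x (lt_of_le_of_lt (le_max_right t T) hx))
    (w.integrable_smul g).integrableOn hz
  simp [backward_apply', h, ← hu]

end TimeWeight

/-! ### Operators of Volterra type. -/

section Volterra

variable {E : Type} [NormedAddCommGroup E] [NormedSpace ℝ E]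

/-- An operator is of Volterra type if it is small in suitable equivalent weighted norms. -/
def IsVolterra (V : (ℝ →ᵇ E) →L[ℝ] (ℝ →ᵇ E)) : Prop :=
  ∀ ε > 0, ∃ p q : ℝ →ᵇ ℝ, (∀ t, 0 < p t) ∧ (∀ t, p t * q t = 1) ∧
    ∀ (g : ℝ →ᵇ E) (K : ℝ), (∀ s, ‖g s‖ ≤ K * q s) → ∀ t, p t * ‖V g t‖ ≤ ε * K

/-- A pointwise bounded A commutes with the weights up to its bound M. Conjugating V * A by the
weight p, with inverse q, therefore gives an operator of norm at most 1/2, and 1 - V * A is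
conjugate to an invertible operator by a Neumann series. -/
theorem IsVolterra.isUnit [CompleteSpace E] {V A : (ℝ →ᵇ E) →L[ℝ] (ℝ →ᵇ E)} (hV : IsVolterra V)
    {M : ℝ} (hA : ∀ v t, ‖A v t‖ ≤ M * ‖v t‖) : IsUnit (1 - V * A) := by
  obtain ⟨p, q, hp, hpq, h⟩ := hV (1 / (2 * (|M| + 1))) (by positivity)
  have hq : ∀ t, 0 < q t := fun t => by
    have := hpq t
    exact pos_of_mul_pos_right (by rw [this]; exact one_pos) (hp t).le
  set P := bcfSmul E p with hP
  set Q := bcfSmul E q with hQ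
  have hPQ : P * Q = 1 := by
    ext v t
    simp [hP, hQ, smul_smul, hpq]
  have hQP : Q * P = 1 := by
    ext v t
    simp [hP, hQ, smul_smul, mul_comm (q t), hpq]
  have hnorm : ‖P * (V * A) * Q‖ ≤ 1 / 2 := by
    refine ContinuousLinearMap.opNorm_le_bound _ (by norm_num) fun v => ?_
    refine (BoundedContinuousFunction.norm_le (by positivity)).2 fun t => ?_
    have h1 : ∀ s, ‖A (Q v) s‖ ≤ (|M| * ‖v‖) * q s := by
      intro s
      refine (hA _ s).trans ?_
      rw [hQ, bcfSmul_apply, norm_smul, Real.norm_of_nonneg (hq s).le]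
      have h2 := v.norm_coe_le_norm s
      have h3 := hq s
      calc M * (q s * ‖v s‖) ≤ |M| * (q s * ‖v‖) := by
            gcongr
            exact le_abs_self M
        _ = _ := by ring
    have h2 := h (A (Q v)) _ h1 t
    have h3 : (P * (V * A) * Q) v t = p t • V (A (Q v)) t := rfl
    rw [h3, norm_smul, Real.norm_of_nonneg (hp t).le]
    refine h2.trans ?_
    rw [← mul_assoc]
    refine mul_le_mul_of_nonneg_right ?_ (norm_nonneg v)
    rw [one_div, inv_mul_le_iff₀ (by positivity)]
    linarith [abs_nonneg M]
  have hu : IsUnit (1 - P * (V * A) * Q) :=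
    (Units.oneSub _ (lt_of_le_of_lt hnorm (by norm_num))).isUnit
  have hPu : IsUnit P := ⟨⟨P, Q, hPQ, hQP⟩, rfl⟩
  have hQu : IsUnit Q := ⟨⟨Q, P, hQP, hPQ⟩, rfl⟩
  have key : 1 - V * A = Q * (1 - P * (V * A) * Q) * P := by
    have : Q * (1 - P * (V * A) * Q) * P = Q * P - (Q * P) * (V * A) * (Q * P) := by
      simp only [mul_sub, sub_mul, mul_assoc, mul_one]
    rw [this, hQP, one_mul, mul_one]
  rw [key]
  exact (hQu.mul hu).mul hPu

variable (w : TimeWeight)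

theorem TimeWeight.exists_primitive_weights :
    ∃ W : ℝ → ℝ, Continuous W ∧ W 0 = 0 ∧ (∃ I, ∀ t, |W t| ≤ I) ∧
      ∀ t, HasDerivAt W (w.toFun t) t := by
  refine ⟨fun t => ∫ r in (0 : ℝ)..t, w.toFun r, intervalIntegral.continuous_primitive
    (fun _ _ => w.integrable.intervalIntegrable) 0, by simp,
    ⟨∫ r, w.toFun r, fun t => ?_⟩, fun t => ?_⟩
  · have h := intervalIntegral.norm_integral_le_integral_norm_uIoc (f := w.toFun) (a := 0) (b := t)
      (μ := MeasureTheory.volume)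
    rw [← Real.norm_eq_abs]
    refine h.trans ?_
    simp only [Real.norm_of_nonneg (w.nonneg _)]
    exact MeasureTheory.setIntegral_le_integral w.integrable (MeasureTheory.ae_of_all _ w.nonneg)
  · exact intervalIntegral.integral_hasDerivAt_right w.integrable.intervalIntegrable
      (w.continuous.stronglyMeasurableAtFilter _ _) w.continuous.continuousAt

/-- The bounded function `exp (c W)`. -/
theorem exists_bcf_exp {W : ℝ → ℝ} (hW : Continuous W) {I : ℝ} (hI : ∀ t, |W t| ≤ I) (c : ℝ) :
    ∃ p : ℝ →ᵇ ℝ, ∀ t, p t = Real.exp (c * W t) := by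
  refine ⟨BoundedContinuousFunction.ofNormedAddCommGroup (fun t => Real.exp (c * W t))
    (by fun_prop) (Real.exp (|c| * I)) (fun t => ?_), fun t => rfl⟩
  rw [Real.norm_of_nonneg (Real.exp_pos _).le, Real.exp_le_exp]
  refine (le_abs_self _).trans ?_
  rw [abs_mul]
  exact mul_le_mul_of_nonneg_left (hI t) (abs_nonneg c)

/-- With W a primitive of w, the derivative of ε exp(W/ε) is w exp(W/ε). Hence integrating a
function of size exp(W/ε) against w gains the factor ε. As W is bounded, the weighted norm is
equivalent to the original one. -/
theorem TimeWeight.isVolterra_forward : IsVolterra (w.forward E 0) := by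
  intro ε hε
  obtain ⟨W, hWc, hW0, ⟨I, hI⟩, hWd⟩ := w.exists_primitive_weights
  have hWc' : Continuous fun t => W (max t 0) := hWc.comp (continuous_id.max continuous_const)
  obtain ⟨p, hp⟩ := exists_bcf_exp hWc' (fun t => hI _) (-ε⁻¹)
  obtain ⟨q, hq⟩ := exists_bcf_exp hWc' (fun t => hI _) ε⁻¹
  refine ⟨p, q, fun t => by rw [hp]; exact Real.exp_pos _, fun t => ?_, fun g K hg t => ?_⟩
  · rw [hp, hq, ← Real.exp_add]
    simp
  · have hK : 0 ≤ K := by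
      have h := (norm_nonneg _).trans (hg 0)
      rw [hq] at h
      exact nonneg_of_mul_nonneg_left h (Real.exp_pos _)
    have hs : 0 ≤ max t 0 := le_max_right _ _
    have hder : ∀ r, HasDerivAt (fun r => K * ε * Real.exp (ε⁻¹ * W r))
        (w.toFun r * (K * Real.exp (ε⁻¹ * W r))) r := by
      intro r
      convert! (((hWd r).const_mul ε⁻¹).exp).const_mul (K * ε) using 1
      field_simp
    have hcont : Continuous fun r => w.toFun r * (K * Real.exp (ε⁻¹ * W r)) := by
      have := w.continuous
      fun_prop
    have h1 : ‖w.forward E 0 g t‖ ≤ K * ε * Real.exp (ε⁻¹ * W (max t 0)) - K * ε := by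
      rw [w.forward_apply]
      refine (intervalIntegral.norm_integral_le_of_norm_le hs
        (MeasureTheory.ae_of_all _ fun r hr => ?_) (hcont.intervalIntegrable _ _)).trans
        (le_of_eq ?_)
      · rw [norm_smul, Real.norm_of_nonneg (w.nonneg r)]
        refine mul_le_mul_of_nonneg_left ?_ (w.nonneg r)
        have := hg r
        rwa [hq, max_eq_left hr.1.le] at this
      · rw [intervalIntegral.integral_eq_sub_of_hasDerivAt (fun r _ => hder r)
          (hcont.intervalIntegrable _ _), hW0]
        simp
    calc p t * ‖w.forward E 0 g t‖
        ≤ p t * (K * ε * Real.exp (ε⁻¹ * W (max t 0))) := by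
          refine mul_le_mul_of_nonneg_left (h1.trans ?_) (by rw [hp]; positivity)
          linarith [mul_nonneg hK hε.le]
      _ = K * ε * (Real.exp (-ε⁻¹ * W (max t 0)) * Real.exp (ε⁻¹ * W (max t 0))) := by
          rw [hp]; ring
      _ = ε * K := by
          rw [← Real.exp_add]
          simp [mul_comm]

/-- The argument for the forward primitive with the sign of the exponent reversed, because the
integral now runs from t to infinity. -/
theorem TimeWeight.isVolterra_backward : IsVolterra (w.backward E 0) := by
  intro ε hε
  obtain ⟨W, hWc, hW0, ⟨I, hI⟩, hWd⟩ := w.exists_primitive_weights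
  have hWc' : Continuous fun t => W (max t 0) := hWc.comp (continuous_id.max continuous_const)
  obtain ⟨p, hp⟩ := exists_bcf_exp hWc' (fun t => hI _) ε⁻¹
  obtain ⟨q, hq⟩ := exists_bcf_exp hWc' (fun t => hI _) (-ε⁻¹)
  refine ⟨p, q, fun t => by rw [hp]; exact Real.exp_pos _, fun t => ?_, fun g K hg t => ?_⟩
  · rw [hp, hq, ← Real.exp_add]
    simp
  · have hK : 0 ≤ K := by
      have h := (norm_nonneg _).trans (hg 0)
      rw [hq] at h
      exact nonneg_of_mul_nonneg_left h (Real.exp_pos _)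
    have hs : 0 ≤ max t 0 := le_max_right _ _
    have hder : ∀ r, HasDerivAt (fun r => -(K * ε) * Real.exp (-ε⁻¹ * W r))
        (w.toFun r * (K * Real.exp (-ε⁻¹ * W r))) r := by
      intro r
      convert! (((hWd r).const_mul (-ε⁻¹)).exp).const_mul (-(K * ε)) using 1
      field_simp
    have hcont : Continuous fun r => w.toFun r * (K * Real.exp (-ε⁻¹ * W r)) := by
      have := w.continuous
      fun_prop
    have hlim : Tendsto (fun b => ∫ r in (max t 0)..b, w.toFun r • g r) atTop
        (𝓝 (∫ r in Set.Ioi (max t 0), w.toFun r • g r)) :=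
      MeasureTheory.intervalIntegral_tendsto_integral_Ioi _
        (w.integrable_smul g).integrableOn tendsto_id
    have h1 : ‖w.backward E 0 g t‖ ≤ K * ε * Real.exp (-ε⁻¹ * W (max t 0)) := by
      rw [w.backward_apply', norm_neg]
      refine le_of_tendsto hlim.norm ?_
      filter_upwards [eventually_ge_atTop (max t 0)] with b hb
      refine (intervalIntegral.norm_integral_le_of_norm_le hb
        (MeasureTheory.ae_of_all _ fun r hr => ?_) (hcont.intervalIntegrable _ _)).trans ?_
      · rw [norm_smul, Real.norm_of_nonneg (w.nonneg r)]
        refine mul_le_mul_of_nonneg_left ?_ (w.nonneg r)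
        have := hg r
        rwa [hq, max_eq_left (hs.trans hr.1.le)] at this
      · rw [intervalIntegral.integral_eq_sub_of_hasDerivAt (fun r _ => hder r)
          (hcont.intervalIntegrable _ _)]
        -- The boundary term at b has a favourable sign and is dropped, leaving a bound that does
        -- not depend on b.
        have : 0 ≤ K * ε * Real.exp (-ε⁻¹ * W b) := by positivity
        linarith
    calc p t * ‖w.backward E 0 g t‖
        ≤ p t * (K * ε * Real.exp (-ε⁻¹ * W (max t 0))) :=
          mul_le_mul_of_nonneg_left h1 (by rw [hp]; positivity)
      _ = K * ε * (Real.exp (ε⁻¹ * W (max t 0)) * Real.exp (-ε⁻¹ * W (max t 0))) := by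
          rw [hp]; ring
      _ = ε * K := by
          rw [← Real.exp_add]
          simp [mul_comm]

end Volterra

/-! ### Integral equations in the space of bounded paths. -/

section Families

variable {E : Type} [NormedAddCommGroup E] [NormedSpace ℝ E]

/-- The derivative of a pointwise defined map of paths acts pointwise. -/
theorem norm_fderiv_apply_le_of_local {N : (ℝ →ᵇ E) → (ℝ →ᵇ E)} {U : Set (ℝ →ᵇ E)}
    (hU : IsOpen U) (hloc : ∀ u ∈ U, ∀ v ∈ U, ∀ t, u t = v t → N u t = N v t)
    {u : ℝ →ᵇ E} (hu : u ∈ U) (hN : DifferentiableAt ℝ N u) (v : ℝ →ᵇ E) (t : ℝ) :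
    ‖fderiv ℝ N u v t‖ ≤ ‖fderiv ℝ N u‖ * ‖v t‖ := by
  have hder : ∀ v : ℝ →ᵇ E,
      HasDerivAt (fun s : ℝ => N (u + s • v) t) (fderiv ℝ N u v t) 0 := by
    intro v
    have h1 : HasDerivAt (fun s : ℝ => u + s • v) v 0 := by
      simpa using ((hasDerivAt_id (0 : ℝ)).smul_const v).const_add u
    have h2 : HasFDerivAt N (fderiv ℝ N u) (u + (0 : ℝ) • v) := by simpa using hN.hasFDerivAt
    have h3 := h2.comp_hasDerivAt (0 : ℝ) h1
    exact (BoundedContinuousFunction.evalCLM ℝ t : (ℝ →ᵇ E) →L[ℝ] E).hasFDerivAt.comp_hasDerivAt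
      (0 : ℝ) h3
  have hmem : ∀ v : ℝ →ᵇ E, ∀ᶠ s : ℝ in 𝓝 0, u + s • v ∈ U := by
    intro v
    have hc : Continuous fun s : ℝ => u + s • v := by fun_prop
    have := hc.tendsto 0
    simp only [zero_smul, add_zero] at this
    exact this (hU.mem_nhds hu)
  -- By locality the value at t of the derivative depends only on v t, so v may be replaced by the
  -- constant path with that value, whose norm is at most ‖v t‖.
  set c := bcfConst ℝ E (v t) with hc
  have heq : fderiv ℝ N u v t = fderiv ℝ N u c t := by
    refine ((hder v).congr_of_eventuallyEq ?_).unique (hder c) |>.symm ▸ rfl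
    filter_upwards [hmem v, hmem c] with s h1 h2
    exact hloc _ h2 _ h1 t (by simp [hc])
  rw [heq]
  refine ((fderiv ℝ N u c).norm_coe_le_norm t).trans ?_
  refine ((fderiv ℝ N u).le_opNorm c).trans ?_
  refine mul_le_mul_of_nonneg_left ?_ (fderiv ℝ N u).opNorm_nonneg
  exact BoundedContinuousFunction.norm_const_le _

/-- Solutions of the integral equation `u = z + V (N u)` depend smoothly on `z`. -/
theorem IsVolterra.exists_smooth_family [CompleteSpace E] {V : (ℝ →ᵇ E) →L[ℝ] (ℝ →ᵇ E)}
    (hV : IsVolterra V) {N : (ℝ →ᵇ E) → (ℝ →ᵇ E)} {U : Set (ℝ →ᵇ E)} (hU : IsOpen U)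
    (hN : ∀ u ∈ U, ContDiffAt ℝ ∞ N u)
    (hloc : ∀ u ∈ U, ∀ v ∈ U, ∀ t, u t = v t → N u t = N v t) {u : ℝ →ᵇ E} (hu : u ∈ U) {z : E}
    (h : u = bcfConst ℝ E z + V (N u)) :
    ∃ S : E → (ℝ →ᵇ E), ContDiffAt ℝ ∞ S z ∧ S z = u ∧
      ∀ᶠ y in 𝓝 z, S y ∈ U ∧ S y = bcfConst ℝ E y + V (N (S y)) := by
  have hNd : DifferentiableAt ℝ N u := (hN u hu).differentiableAt (by simp)
  obtain ⟨Φu, hΦu⟩ := hV.isUnit (A := fderiv ℝ N u)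
    (norm_fderiv_apply_le_of_local hU hloc hu hNd)
  -- The equation says that Φ u is the constant path z. The derivative of Φ at u is invertible by
  -- the Volterra property, so the local inverse of Φ restricted to constant paths is the required
  -- family.
  set Φ : (ℝ →ᵇ E) → (ℝ →ᵇ E) := fun u => u - V (N u) with hΦ
  have hΦc : ContDiffAt ℝ ∞ Φ u :=
    contDiffAt_id.sub (V.contDiff.contDiffAt.comp u (hN u hu))
  let e : (ℝ →ᵇ E) ≃L[ℝ] (ℝ →ᵇ E) := ContinuousLinearEquiv.ofUnit Φu
  have he : (e : (ℝ →ᵇ E) →L[ℝ] (ℝ →ᵇ E)) = 1 - V * fderiv ℝ N u := by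
    rw [← hΦu]
    rfl
  have hΦd : HasFDerivAt Φ (e : (ℝ →ᵇ E) →L[ℝ] (ℝ →ᵇ E)) u := by
    rw [he]
    exact (hasFDerivAt_id u).sub (V.hasFDerivAt.comp u hNd.hasFDerivAt)
  have hne : (∞ : WithTop ℕ∞) ≠ 0 := by simp
  have hzu : Φ u = bcfConst ℝ E z := by
    rw [hΦ]
    exact sub_eq_of_eq_add h
  set g := hΦc.localInverse hΦd hne with hg
  have hgz : ContDiffAt ℝ ∞ g (bcfConst ℝ E z) := by
    rw [← hzu]
    exact hΦc.to_localInverse hΦd hne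
  have hgu : g (bcfConst ℝ E z) = u := by
    rw [← hzu]
    exact HasStrictFDerivAt.localInverse_apply_image _
  have hright : ∀ᶠ y in 𝓝 (bcfConst ℝ E z), Φ (g y) = y := by
    rw [← hzu]
    exact HasStrictFDerivAt.eventually_right_inverse _
  have hcont : Tendsto (bcfConst ℝ E) (𝓝 z) (𝓝 (bcfConst ℝ E z)) :=
    (bcfConst ℝ E).continuous.tendsto z
  have hS : ContDiffAt ℝ ∞ (fun y => g (bcfConst ℝ E y)) z :=
    ContDiffAt.comp z hgz (bcfConst ℝ E).contDiff.contDiffAt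
  refine ⟨fun y => g (bcfConst ℝ E y), hS, hgu, ?_⟩
  have hUev : ∀ᶠ y in 𝓝 z, g (bcfConst ℝ E y) ∈ U :=
    hS.continuousAt (by simpa only [hgu] using hU.mem_nhds hu)
  filter_upwards [hUev, hcont.eventually hright] with y h1 h2
  exact ⟨h1, eq_add_of_sub_eq h2⟩

/-- Existence and uniqueness near a constant path for the integral equation with a small
integral operator. -/
theorem exists_forall_unique_solution [CompleteSpace E] {ι : Type} {l : Filter ι}
    {V : ι → (ℝ →ᵇ E) →L[ℝ] (ℝ →ᵇ E)} (hV : Tendsto (fun i => ‖V i‖) l (𝓝 0))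
    {N : (ℝ →ᵇ E) → (ℝ →ᵇ E)} {U : Set (ℝ →ᵇ E)} (hU : IsOpen U) {u : ℝ →ᵇ E} (hu : u ∈ U)
    (hN : ContDiffAt ℝ 1 N u) :
    ∃ r > 0, Metric.closedBall u r ⊆ U ∧ ∀ᶠ i in l,
      (∃ v ∈ Metric.closedBall u r, v = u + V i (N v)) ∧
      ∀ v ∈ Metric.closedBall u r, ∀ v' ∈ Metric.closedBall u r,
        v = u + V i (N v) → v' = u + V i (N v') → v = v' := by
  obtain ⟨K, s, hs, hK⟩ := hN.exists_lipschitzOnWith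
  obtain ⟨r, hr, hrs⟩ := Metric.nhds_basis_closedBall.mem_iff.1
    (Filter.inter_mem hs (hU.mem_nhds hu))
  have hrU : Metric.closedBall u r ⊆ U := fun v hv => (hrs hv).2
  have hL : LipschitzOnWith K N (Metric.closedBall u r) := hK.mono fun v hv => (hrs hv).1
  refine ⟨r, hr, hrU, ?_⟩
  have hu_mem : u ∈ Metric.closedBall u r := Metric.mem_closedBall_self hr.le
  -- The first bound gives the contraction constant 1/2; the second maps the ball into itself. The
  -- radius r is fixed before i, so the same ball of uniqueness serves for all late i.
  have hsmall : ∀ᶠ i in l, ‖V i‖ < min (1 / (2 * ((K : ℝ) + 1))) (r / (‖N u‖ + K * r + 1)) :=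
    hV.eventually (gt_mem_nhds (by have := K.coe_nonneg; positivity))
  filter_upwards [hsmall] with i hi
  have h1 : ‖V i‖ * (2 * ((K : ℝ) + 1)) ≤ 1 :=
    (le_div_iff₀ (by positivity)).1 (hi.le.trans (min_le_left _ _))
  have h2 : ‖V i‖ * (‖N u‖ + K * r + 1) ≤ r :=
    (le_div_iff₀ (by positivity)).1 (hi.le.trans (min_le_right _ _))
  have hV0 : 0 ≤ ‖V i‖ := norm_nonneg _
  have hdist : ∀ v ∈ Metric.closedBall u r, ∀ v' ∈ Metric.closedBall u r,
      dist (u + V i (N v)) (u + V i (N v')) ≤ 1 / 2 * dist v v' := by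
    intro v hv v' hv'
    rw [dist_add_left, dist_eq_norm, ← map_sub]
    have h3 := hL.dist_le_mul v hv v' hv'
    rw [dist_eq_norm (N v)] at h3
    calc ‖V i (N v - N v')‖ ≤ ‖V i‖ * (K * dist v v') :=
          ((V i).le_opNorm _).trans (by gcongr)
      _ = (‖V i‖ * K) * dist v v' := by ring
      _ ≤ _ := by
        refine mul_le_mul_of_nonneg_right ?_ dist_nonneg
        nlinarith
  have hmaps : Set.MapsTo (fun v => u + V i (N v)) (Metric.closedBall u r)
      (Metric.closedBall u r) := by
    intro v hv
    rw [mem_closedBall_iff_norm, add_sub_cancel_left]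
    have h3 := hL.dist_le_mul v hv u hu_mem
    rw [dist_eq_norm (N v)] at h3
    have h4 : ‖N v‖ ≤ ‖N u‖ + K * r := by
      have h5 := norm_sub_norm_le (N v) (N u)
      have h6 : (K : ℝ) * dist v u ≤ K * r := by
        gcongr
        exact hv
      linarith
    refine ((V i).le_opNorm _).trans (le_trans ?_ h2)
    gcongr
    linarith
  constructor
  · have hcontr : ContractingWith (1 / 2) (hmaps.restrict _ _ _) := by
      refine ⟨by norm_num, LipschitzWith.of_dist_le_mul fun v v' => ?_⟩
      refine (hdist v v.2 v' v'.2).trans (le_of_eq ?_)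
      simp [Subtype.dist_eq]
    obtain ⟨v, hv, hfix, -⟩ := hcontr.exists_fixedPoint' Metric.isClosed_closedBall.isComplete
      hmaps hu_mem (edist_ne_top _ _)
    exact ⟨v, hv, hfix.symm⟩
  · intro v hv v' hv' h3 h4
    have h5 := hdist v hv v' hv'
    rw [← h3, ← h4] at h5
    have := dist_nonneg (x := v) (y := v')
    exact dist_le_zero.1 (by linarith)

end Families

/-! ### Uniqueness and global existence for autonomous equations. -/

section AutonomousODE

variable {E : Type} [NormedAddCommGroup E] [NormedSpace ℝ E]

theorem hasFDerivAt_smulRight_iff_hasDerivAt {γ : ℝ → E} {y : E} {t : ℝ} :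
    HasFDerivAt γ ((1 : ℝ →L[ℝ] ℝ).smulRight y) t ↔ HasDerivAt γ y t := by
  have e : (1 : ℝ →L[ℝ] ℝ).smulRight y = ContinuousLinearMap.toSpanSingleton ℝ y := by
    ext
    simp
  rw [e, hasDerivAt_iff_hasFDerivAt]

theorem isMIntegralCurveOn_iff_hasDerivAt {γ : ℝ → E} {v : E → E} {s : Set ℝ} (hs : IsOpen s) :
    IsMIntegralCurveOn (I := 𝓘(ℝ, E)) (M := E) γ v s ↔ ∀ t ∈ s, HasDerivAt γ (v (γ t)) t :=
  forall₂_congr fun _ ht => (hasMFDerivWithinAt_iff_hasFDerivWithinAt.trans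
    (hasFDerivWithinAt_of_isOpen hs ht)).trans hasFDerivAt_smulRight_iff_hasDerivAt

theorem isMIntegralCurve_iff_hasDerivAt {γ : ℝ → E} {v : E → E} :
    IsMIntegralCurve (I := 𝓘(ℝ, E)) (M := E) γ v ↔ ∀ t, HasDerivAt γ (v (γ t)) t :=
  forall_congr' fun _ => hasMFDerivAt_iff_hasFDerivAt.trans hasFDerivAt_smulRight_iff_hasDerivAt

theorem eqOn_Ioi_of_hasDerivAt [CompleteSpace E] {v : E → E} (hv : ContDiff ℝ 1 v)
    {γ γ' : ℝ → E} {a t₀ : ℝ} (ht₀ : a < t₀) (h : ∀ t, a < t → HasDerivAt γ (v (γ t)) t)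
    (hder : ∀ t, a < t → HasDerivAt γ' (v (γ' t)) t) (heq : γ t₀ = γ' t₀) {t : ℝ} (ht : a < t) :
    γ t = γ' t := by
  refine isMIntegralCurveOn_Ioo_eqOn_of_contMDiff_boundaryless (I := 𝓘(ℝ, E)) (M := E)
    (t₀ := t₀) (a := a) (b := max t t₀ + 1) (v := v) (γ := γ) (γ' := γ')
    ⟨ht₀, lt_of_le_of_lt (le_max_right _ _) (lt_add_one _)⟩
    (contMDiff_vectorSpace_iff_contDiff.2 hv)
    ((isMIntegralCurveOn_iff_hasDerivAt isOpen_Ioo).2 fun s hs => h s hs.1)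
    ((isMIntegralCurveOn_iff_hasDerivAt isOpen_Ioo).2 fun s hs => hder s hs.1) heq
    ⟨ht, lt_of_le_of_lt (le_max_left _ _) (lt_add_one _)⟩

theorem eq_of_hasDerivAt [CompleteSpace E] {v : E → E} (hv : ContDiff ℝ 1 v) {γ γ' : ℝ → E}
    {t₀ : ℝ} (h : ∀ t, HasDerivAt γ (v (γ t)) t) (h' : ∀ t, HasDerivAt γ' (v (γ' t)) t)
    (heq : γ t₀ = γ' t₀) : γ = γ' :=
  isMIntegralCurve_Ioo_eq_of_contMDiff_boundaryless (I := 𝓘(ℝ, E)) (M := E)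
    (contMDiff_vectorSpace_iff_contDiff.2 hv) (isMIntegralCurve_iff_hasDerivAt.2 h)
    (isMIntegralCurve_iff_hasDerivAt.2 h') heq

/-- A bounded continuously differentiable vector field is complete. -/
theorem exists_global_solution_of_bounded [FiniteDimensional ℝ E] {v : E → E}
    (hv : ContDiff ℝ 1 v) {M : ℝ} (hM : ∀ z, ‖v z‖ ≤ M) (z : E) :
    ∃ γ : ℝ → E, γ 0 = z ∧ ∀ t, HasDerivAt γ (v (γ t)) t := by
  have : CompleteSpace E := FiniteDimensional.complete ℝ E
  have : ProperSpace E := FiniteDimensional.proper ℝ E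
  have hM0 : 0 ≤ M := (norm_nonneg _).trans (hM 0)
  -- At speed at most M a curve stays in the closed unit ball around its starting point for this
  -- time. The time of existence is thus the same for all starting points, which yields global
  -- solutions.
  set ε : ℝ := 1 / (M + 1) with hε
  have hε0 : 0 < ε := by positivity
  obtain ⟨γ, h0, hγ⟩ := exists_isMIntegralCurve_of_isMIntegralCurveOn (I := 𝓘(ℝ, E)) (M := E)
    (v := v) (contMDiff_vectorSpace_iff_contDiff.2 hv) hε0 (fun x => by
      obtain ⟨K, hK⟩ : ∃ K, LipschitzOnWith K v (Metric.closedBall x (1 : NNReal)) :=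
        hv.contDiffOn.exists_lipschitzOnWith one_ne_zero (convex_closedBall _ _)
          (isCompact_closedBall _ _)
      have hpl : IsPicardLindelof (fun _ => v) (tmin := -ε) (tmax := ε)
          ⟨0, by constructor <;> linarith⟩ x 1 0 M.toNNReal K :=
        { lipschitzOnWith := fun _ _ => hK
          continuousOn := fun _ _ => continuousOn_const
          norm_le := fun _ _ y _ => (hM y).trans (Real.le_coe_toNNReal M)
          mul_max_le := by
            simp only [sub_zero, zero_sub, neg_neg, max_self, Real.coe_toNNReal M hM0,
              NNReal.coe_one, NNReal.coe_zero]
            rw [hε, mul_one_div, div_le_one (by positivity)]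
            linarith }
      obtain ⟨α, hα0, hα⟩ := hpl.exists_eq_forall_mem_Icc_hasDerivWithinAt
        (Metric.mem_closedBall_self le_rfl)
      refine ⟨α, hα0, (isMIntegralCurveOn_iff_hasDerivAt isOpen_Ioo).2 fun t ht => ?_⟩
      exact (hα t (Set.Ioo_subset_Icc_self ht)).hasDerivAt (Icc_mem_nhds ht.1 ht.2)) z
  exact ⟨γ, h0, isMIntegralCurve_iff_hasDerivAt.1 hγ⟩

end AutonomousODE

/-! ### The metric in coordinate free form. -/

/-- A long range perturbation of the Euclidean metric, in coordinate free form: `1 + B` is the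
metric and `Γ(x)(ξ, ξ)` is the gradient of the kinetic energy in the position variable. -/
structure Perturbation (d : ℕ) (μ : ℝ) where
  B : Space d → Space d →L[ℝ] Space d
  Γ : Space d → Space d →L[ℝ] Space d →L[ℝ] Space d
  symbol_B : IsSymbol (-μ) B
  symbol_Γ : IsSymbol (-1 - μ) Γ
  symm : ∀ x ξ η, ⟪B x ξ, η⟫_ℝ = ⟪ξ, B x η⟫_ℝ
  inner_Γ : ∀ x ξ h, ⟪Γ x ξ ξ, h⟫_ℝ = 1 / 2 * ⟪fderiv ℝ B x h ξ, ξ⟫_ℝ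
  pos : ∀ x ξ, ξ ≠ 0 → 0 < ⟪ξ + B x ξ, ξ⟫_ℝ

section Metric

variable {d : ℕ} {a : Space d → Matrix (Fin d) (Fin d) ℝ} {μ : ℝ}

theorem IsLongRangeMetric.isSymbol (ha : IsLongRangeMetric a μ) (j k : Fin d) :
    IsSymbol (-μ) (fun x => a x j k - (1 : Matrix (Fin d) (Fin d) ℝ) j k) :=
  isSymbol_of_partialDeriv ((ha.smooth j k).sub contDiff_const) fun n i => by
    obtain ⟨C, -, hC⟩ := ha.decay n i j k
    exact ⟨C, hC⟩

/-- The matrix unit `ξ ↦ ξ_k e_j`. -/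
noncomputable def matrixUnit (j k : Fin d) : Space d →L[ℝ] Space d :=
  (EuclideanSpace.proj k : Space d →L[ℝ] ℝ).smulRight (EuclideanSpace.single j (1 : ℝ))

/-- The tensor `(ξ, η) ↦ ξ_j η_k e_i`. -/
noncomputable def tensorUnit (i j k : Fin d) : Space d →L[ℝ] Space d →L[ℝ] Space d :=
  (EuclideanSpace.proj j : Space d →L[ℝ] ℝ).smulRight (matrixUnit i k)

theorem matrixUnit_apply (j k : Fin d) (ξ : Space d) :
    matrixUnit j k ξ = ξ k • EuclideanSpace.single j (1 : ℝ) := rfl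

theorem tensorUnit_apply (i j k : Fin d) (ξ η : Space d) :
    tensorUnit i j k ξ η = ξ j • η k • EuclideanSpace.single i (1 : ℝ) := rfl

/-- B sums the entries of a - 1 against matrix units. In Γ the index of differentiation is the
output index, so pairing with h gives the derivative of B in the direction h. Symmetry of B is the
Hermitian part of positive definiteness. -/
theorem IsLongRangeMetric.exists_perturbation (ha : IsLongRangeMetric a μ) :
    ∃ P : Perturbation d μ, ∀ x ξ, kinetic a x ξ = 1 / 2 * ⟪ξ + P.B x ξ, ξ⟫_ℝ := by
  set b : Fin d → Fin d → Space d → ℝ :=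
    fun j k x => a x j k - (1 : Matrix (Fin d) (Fin d) ℝ) j k with hb
  have hsym : ∀ j k, IsSymbol (-μ) (b j k) := ha.isSymbol
  have hbsymm : ∀ j k x, b j k x = b k j x := by
    intro j k x
    have h1 := (ha.posDef x).isHermitian.apply j k
    simp only [star_trivial] at h1
    simp [hb, h1, Matrix.one_apply, eq_comm]
  set B : Space d → Space d →L[ℝ] Space d := fun x => ∑ j, ∑ k, b j k x • matrixUnit j k with hB
  set Γ : Space d → Space d →L[ℝ] Space d →L[ℝ] Space d := fun x => ∑ i, ∑ j, ∑ k,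
    fderiv ℝ (b j k) x (EuclideanSpace.single i (1 : ℝ)) • ((1 / 2 : ℝ) • tensorUnit i j k) with hΓ
  have hBs : IsSymbol (-μ) B := IsSymbol.sum _ fun j _ => IsSymbol.sum _ fun k _ =>
    (hsym j k).clm_comp ((ContinuousLinearMap.id ℝ ℝ).smulRight (matrixUnit j k))
  have hΓs : IsSymbol (-1 - μ) Γ := by
    refine IsSymbol.sum _ fun i _ => IsSymbol.sum _ fun j _ => IsSymbol.sum _ fun k _ => ?_
    have h1 := (hsym j k).fderiv.clm_comp
      (ContinuousLinearMap.apply ℝ ℝ (EuclideanSpace.single i (1 : ℝ) : Space d))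
    have h2 := h1.clm_comp ((ContinuousLinearMap.id ℝ ℝ).smulRight
      ((1 / 2 : ℝ) • tensorUnit i j k))
    rw [show -1 - μ = -μ - 1 by ring]
    exact h2
  have hBi : ∀ x ξ η, ⟪B x ξ, η⟫_ℝ = ∑ j, ∑ k, b j k x * ξ k * η j := by
    intro x ξ η
    simp only [hB, sum_apply, smul_apply,
      matrixUnit_apply, sum_inner, real_inner_smul_left, EuclideanSpace.inner_single_left]
    simp [mul_assoc]
  have hBsymm : ∀ x ξ η, ⟪B x ξ, η⟫_ℝ = ⟪ξ, B x η⟫_ℝ := by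
    intro x ξ η
    rw [real_inner_comm (B x η) ξ, hBi, hBi, Finset.sum_comm]
    refine Finset.sum_congr rfl fun k _ => Finset.sum_congr rfl fun j _ => ?_
    rw [hbsymm j k]
    ring
  have hΓi : ∀ x ξ h, ⟪Γ x ξ ξ, h⟫_ℝ = 1 / 2 * ⟪fderiv ℝ B x h ξ, ξ⟫_ℝ := by
    intro x ξ h
    have hd : HasFDerivAt B (∑ j, ∑ k, (fderiv ℝ (b j k) x).smulRight (matrixUnit j k)) x := by
      refine HasFDerivAt.fun_sum fun j _ => HasFDerivAt.fun_sum fun k _ => ?_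
      exact ((hsym j k).differentiable x).hasFDerivAt.smul_const (matrixUnit j k)
    have hh : ∀ j k, fderiv ℝ (b j k) x h
        = ∑ i, fderiv ℝ (b j k) x (EuclideanSpace.single i (1 : ℝ)) * h i := by
      intro j k
      have h1 : h = ∑ i, h i • EuclideanSpace.single i (1 : ℝ) := by
        simpa using ((EuclideanSpace.basisFun (Fin d) ℝ).sum_repr h).symm
      conv_lhs => rw [h1]
      simp [mul_comm]
    rw [hd.fderiv]
    simp only [hΓ, sum_apply, smul_apply,
      ContinuousLinearMap.smulRight_apply,
      matrixUnit_apply, tensorUnit_apply, sum_inner, real_inner_smul_left,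
      EuclideanSpace.inner_single_left, hh, Finset.sum_mul, Finset.mul_sum]
    rw [Finset.sum_comm]
    refine Finset.sum_congr rfl fun j _ => ?_
    rw [Finset.sum_comm]
    refine Finset.sum_congr rfl fun k _ => Finset.sum_congr rfl fun i _ => ?_
    simp
    ring
  have hkin : ∀ x ξ, kinetic a x ξ = 1 / 2 * ⟪ξ + B x ξ, ξ⟫_ℝ := by
    intro x ξ
    have h1 : ⟪ξ, ξ⟫_ℝ = ∑ j, ∑ k, (1 : Matrix (Fin d) (Fin d) ℝ) j k * ξ k * ξ j := by
      rw [PiLp.inner_apply]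
      simp [Matrix.one_apply, sq]
    rw [inner_add_left, hBi, h1, kinetic, ← Finset.sum_add_distrib]
    congr 1
    refine Finset.sum_congr rfl fun j _ => ?_
    rw [← Finset.sum_add_distrib]
    refine Finset.sum_congr rfl fun k _ => ?_
    simp only [hb]
    ring
  have hpos : ∀ x ξ, ξ ≠ 0 → 0 < ⟪ξ + B x ξ, ξ⟫_ℝ := by
    intro x ξ hξ
    have h0 : (fun i => ξ i) ≠ 0 := fun h => hξ (by ext i; exact congrFun h i)
    have h1 := (ha.posDef x).dotProduct_mulVec_pos h0
    have h2 := hkin x ξ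
    have h3 : kinetic a x ξ = 1 / 2 * (star (fun i => ξ i) ⬝ᵥ (a x).mulVec fun i => ξ i) := by
      simp only [kinetic, dotProduct, Matrix.mulVec, star_trivial, Finset.mul_sum]
      refine Finset.sum_congr rfl fun j _ => Finset.sum_congr rfl fun k _ => ?_
      simp
      ring
    linarith
  exact ⟨⟨B, Γ, hBs, hΓs, hBsymm, hΓi, hpos⟩, hkin⟩

end Metric

/-! ### The kinetic energy and the completeness of its flow. -/

namespace Perturbation

variable {d : ℕ} {μ : ℝ} (P : Perturbation d μ)

/-- The kinetic energy. -/
noncomputable def energy (x ξ : Space d) : ℝ := 1 / 2 * ⟪ξ + P.B x ξ, ξ⟫_ℝ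

/-- The Hamilton vector field of the kinetic energy. -/
noncomputable def field (z : Phase d) : Phase d := (z.2 + P.B z.1 z.2, -(P.Γ z.1 z.2 z.2))

theorem hasFDerivAt_energy (z : Phase d) :
    HasFDerivAt (fun z : Phase d => P.energy z.1 z.2)
      ((innerSL ℝ (P.Γ z.1 z.2 z.2)).comp (ContinuousLinearMap.fst ℝ (Space d) (Space d)) +
        (innerSL ℝ (z.2 + P.B z.1 z.2)).comp (ContinuousLinearMap.snd ℝ (Space d) (Space d))) z := by
  have h1 : HasFDerivAt (fun z : Phase d => z.1) (ContinuousLinearMap.fst ℝ _ _) z :=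
    hasFDerivAt_fst
  have h2 : HasFDerivAt (fun z : Phase d => z.2) (ContinuousLinearMap.snd ℝ _ _) z :=
    hasFDerivAt_snd
  have hB := (P.symbol_B.differentiable z.1).hasFDerivAt.comp z h1
  have h3 := ((h2.add (hB.clm_apply h2)).inner ℝ h2).const_mul (1 / 2)
  unfold energy
  convert! h3 using 1
  ext h
  · have hs := P.inner_Γ z.1 z.2 h
    simp [hs]
  · have hs := P.symm z.1 z.2 h
    simp [inner_add_left, hs]
    rw [real_inner_comm z.2 h, real_inner_comm z.2]
    ring

theorem hasGradientAt_energy_momentum (x ξ : Space d) :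
    HasGradientAt (fun η => P.energy x η) (ξ + P.B x ξ) ξ := by
  rw [hasGradientAt_iff_hasFDerivAt]
  have h := (P.hasFDerivAt_energy (x, ξ)).comp ξ (hasFDerivAt_prodMk_right (𝕜 := ℝ) x ξ)
  refine h.congr_fderiv ?_
  ext h
  simp [InnerProductSpace.toDual_apply_apply]

theorem hasGradientAt_energy_position (x ξ : Space d) :
    HasGradientAt (fun y => P.energy y ξ) (P.Γ x ξ ξ) x := by
  rw [hasGradientAt_iff_hasFDerivAt]
  have h := (P.hasFDerivAt_energy (x, ξ)).comp x (hasFDerivAt_prodMk_left (𝕜 := ℝ) x ξ)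
  refine h.congr_fderiv ?_
  ext h
  simp [InnerProductSpace.toDual_apply_apply]

theorem isHamiltonCurve_iff {c : ℝ → Phase d} :
    IsHamiltonCurve P.energy c ↔ ∀ t, HasDerivAt c (P.field (c t)) t := by
  have e1 : ∀ t, gradient (fun η => P.energy (c t).1 η) (c t).2 = (P.field (c t)).1 :=
    fun t => (P.hasGradientAt_energy_momentum _ _).gradient
  have e2 : ∀ t, -gradient (fun y => P.energy y (c t).2) (c t).1 = (P.field (c t)).2 :=
    fun t => by rw [(P.hasGradientAt_energy_position _ _).gradient]; rfl
  constructor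
  · rintro ⟨h1, h2⟩ t
    have h1 := h1 t
    have h2 := h2 t
    rw [e1] at h1
    rw [e2] at h2
    exact h1.prodMk h2
  · intro h
    refine ⟨fun t => ?_, fun t => ?_⟩
    · rw [e1]
      exact (hasFDerivAt_fst.comp_hasDerivAt t (h t) :)
    · rw [e2]
      exact (hasFDerivAt_snd.comp_hasDerivAt t (h t) :)

theorem contDiff_field : ContDiff ℝ ∞ P.field := by
  have hB := P.symbol_B.contDiff
  have hΓ := P.symbol_Γ.contDiff
  unfold field
  fun_prop

theorem contDiff_energy : ContDiff ℝ ∞ fun z : Phase d => P.energy z.1 z.2 := by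
  have hB := P.symbol_B.contDiff
  unfold energy
  refine contDiff_const.mul (ContDiff.inner ℝ ?_ contDiff_snd)
  fun_prop

/-- The energy gradient (Γ(ξ, ξ), ξ + Bξ) is orthogonal to the Hamilton field (ξ + Bξ, -Γ(ξ, ξ)).
The scalar s admits a change of time, used for the rescaled field in `exists_curve`. -/
theorem hasDerivAt_energy_zero {c : ℝ → Phase d} {c' : Phase d} {t s : ℝ}
    (h : HasDerivAt c c' t) (hc : c' = s • P.field (c t)) :
    HasDerivAt (fun t => P.energy (c t).1 (c t).2) 0 t := by
  refine ((P.hasFDerivAt_energy (c t)).comp_hasDerivAt t h).congr_deriv ?_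
  simp only [hc, field, add_apply, ContinuousLinearMap.comp_apply,
    ContinuousLinearMap.coe_fst', ContinuousLinearMap.coe_snd', Prod.smul_fst, Prod.smul_snd,
    innerSL_apply_apply, real_inner_smul_right, inner_neg_right]
  rw [real_inner_comm]
  ring

theorem energy_eq_of_hasDerivAt {c : ℝ → Phase d} {s : ℝ → ℝ}
    (h : ∀ t, HasDerivAt c (s t • P.field (c t)) t) (t t' : ℝ) :
    P.energy (c t).1 (c t).2 = P.energy (c t').1 (c t').2 :=
  is_const_of_deriv_eq_zero (fun t => (P.hasDerivAt_energy_zero (h t) rfl).differentiableAt)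
    (fun t => (P.hasDerivAt_energy_zero (h t) rfl).deriv) t t'

section Bounds

theorem exists_norm_B_le (hμ : 0 < μ) : ∃ C : ℝ, 0 ≤ C ∧ ∀ x, ‖P.B x‖ ≤ C := by
  obtain ⟨C, hC0, hC⟩ := P.symbol_B.exists_norm_le
  refine ⟨C, hC0, fun x => (hC x).trans ?_⟩
  exact mul_le_of_le_one_right hC0
    (Real.rpow_le_one_of_one_le_of_nonpos (one_le_bracket x) (by linarith))

theorem exists_norm_Γ_le (hμ : 0 < μ) : ∃ C : ℝ, 0 ≤ C ∧ ∀ x, ‖P.Γ x‖ ≤ C := by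
  obtain ⟨C, hC0, hC⟩ := P.symbol_Γ.exists_norm_le
  refine ⟨C, hC0, fun x => (hC x).trans ?_⟩
  exact mul_le_of_le_one_right hC0
    (Real.rpow_le_one_of_one_le_of_nonpos (one_le_bracket x) (by linarith))

theorem tendsto_bracket_rpow_neg {m : ℝ} (hm : 0 < m) :
    Tendsto (fun x : Space d => bracket x ^ (-m)) (comap norm atTop) (𝓝 0) :=
  (tendsto_rpow_neg_atTop hm).comp
    (tendsto_atTop_mono norm_le_bracket tendsto_comap)

/-- Far from the origin ‖B‖ ≤ 1/2, which gives the constant 1/4. Over the remaining ball,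
compactness of the unit sphere and homogeneity in ξ give a positive constant. -/
theorem exists_energy_ge (hμ : 0 < μ) :
    ∃ c > 0, ∀ x ξ, c * ‖ξ‖ ^ 2 ≤ P.energy x ξ := by
  obtain ⟨C, hC0, hC⟩ := P.symbol_B.exists_norm_le
  have h1 : Tendsto (fun x : Space d => C * bracket x ^ (-μ)) (comap norm atTop) (𝓝 0) := by
    simpa using (tendsto_bracket_rpow_neg hμ).const_mul C
  have h2 := h1.eventually (gt_mem_nhds (show (0 : ℝ) < 1 / 2 by norm_num))
  rw [eventually_comap, eventually_atTop] at h2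
  obtain ⟨R, hR⟩ := h2
  obtain ⟨c, hc0, hc⟩ := ((isCompact_closedBall (0 : Space d) R).prod
    (isCompact_sphere (0 : Space d) 1)).exists_forall_le'
    P.contDiff_energy.continuous.continuousOn (a := 0) (by
      rintro ⟨x, ξ⟩ ⟨-, hξ⟩
      have : ξ ≠ 0 := by
        rintro rfl
        simp at hξ
      have := P.pos x ξ this
      simp only [energy]
      linarith)
  refine ⟨min c (1 / 4), by positivity, fun x ξ => ?_⟩
  rcases le_or_gt R ‖x‖ with hx | hx
  · have hB : ‖P.B x‖ ≤ 1 / 2 := (hC x).trans (hR _ hx x rfl).le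
    have h3 : |⟪P.B x ξ, ξ⟫_ℝ| ≤ 1 / 2 * ‖ξ‖ ^ 2 := by
      refine (abs_real_inner_le_norm _ _).trans ?_
      rw [sq, ← mul_assoc]
      gcongr
      exact ((P.B x).le_opNorm ξ).trans (by gcongr)
    have h4 := neg_le_of_abs_le h3
    unfold energy
    rw [inner_add_left, real_inner_self_eq_norm_sq]
    have h5 : min c (1 / 4) * ‖ξ‖ ^ 2 ≤ 1 / 4 * ‖ξ‖ ^ 2 := by
      gcongr
      exact min_le_right _ _
    linarith
  · rcases eq_or_ne ξ 0 with rfl | hξ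
    · simp [energy]
    · have hξ' : 0 < ‖ξ‖ := norm_pos_iff.2 hξ
      have h3 := hc (x, ‖ξ‖⁻¹ • ξ) ⟨by simpa using hx.le, by simp [norm_smul, hξ'.ne']⟩
      have h4 : P.energy x (‖ξ‖⁻¹ • ξ) = (‖ξ‖ ^ 2)⁻¹ * P.energy x ξ := by
        simp only [energy, map_smul, ← smul_add, real_inner_smul_left, real_inner_smul_right]
        field_simp
      simp only [h4] at h3
      rw [inv_mul_eq_div, le_div_iff₀ (by positivity)] at h3
      exact (mul_le_mul_of_nonneg_right (min_le_left _ _) (by positivity)).trans h3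

theorem energy_nonneg (x ξ : Space d) : 0 ≤ P.energy x ξ := by
  rcases eq_or_ne ξ 0 with rfl | h
  · simp [energy]
  · have := P.pos x ξ h
    unfold energy
    linarith

/-- The field grows at most quadratically in ξ and is bounded in x, while the energy controls |ξ|².
-/
theorem exists_norm_field_le (hμ : 0 < μ) :
    ∃ M : ℝ, ∀ z, ‖(1 + P.energy z.1 z.2)⁻¹ • P.field z‖ ≤ M := by
  obtain ⟨c, hc0, hc⟩ := P.exists_energy_ge hμ
  obtain ⟨C₁, hC₁0, hC₁⟩ := P.exists_norm_B_le hμ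
  obtain ⟨C₂, hC₂0, hC₂⟩ := P.exists_norm_Γ_le hμ
  refine ⟨(1 + C₁ + C₂) * (1 + c⁻¹), fun z => ?_⟩
  have hE := P.energy_nonneg z.1 z.2
  have hξ : ‖z.2‖ ^ 2 ≤ c⁻¹ * P.energy z.1 z.2 := by
    rw [inv_mul_eq_div, le_div_iff₀ hc0, mul_comm]
    exact hc _ _
  have h0 : 1 + ‖z.2‖ ^ 2 ≤ (1 + c⁻¹) * (1 + P.energy z.1 z.2) := by
    have : 0 < c⁻¹ := by positivity
    nlinarith
  have h1 : ‖z.2 + P.B z.1 z.2‖ ≤ (1 + C₁) * ‖z.2‖ := by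
    have := ((P.B z.1).le_opNorm z.2).trans
      (mul_le_mul_of_nonneg_right (hC₁ z.1) (norm_nonneg _))
    have := norm_add_le z.2 (P.B z.1 z.2)
    linarith
  have h2 : ‖P.Γ z.1 z.2 z.2‖ ≤ C₂ * ‖z.2‖ ^ 2 := by
    have h3 := (P.Γ z.1).le_opNorm₂ z.2 z.2
    have h4 : ‖P.Γ z.1‖ * ‖z.2‖ * ‖z.2‖ ≤ C₂ * ‖z.2‖ * ‖z.2‖ := by
      gcongr
      exact hC₂ z.1
    rw [sq, ← mul_assoc]
    exact h3.trans h4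
  have h3 : ‖P.field z‖ ≤ (1 + C₁ + C₂) * (1 + ‖z.2‖ ^ 2) := by
    rw [field, Prod.norm_def, norm_neg]
    have hsq := sq_nonneg (‖z.2‖ - 1)
    have h4 : ‖z.2‖ ≤ 1 + ‖z.2‖ ^ 2 := by nlinarith [norm_nonneg z.2]
    refine max_le (h1.trans ?_) (h2.trans ?_)
    · exact mul_le_mul (by linarith) h4 (norm_nonneg _) (by positivity)
    · exact mul_le_mul (by linarith) (by linarith) (by positivity) (by positivity)
  rw [norm_smul, Real.norm_of_nonneg (by positivity), inv_mul_eq_div,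
    div_le_iff₀ (by positivity), mul_assoc]
  exact h3.trans (by gcongr)

end Bounds

/-- The Hamilton flow of the kinetic energy is complete. -/
theorem exists_curve (hμ : 0 < μ) (z : Phase d) :
    ∃ c : ℝ → Phase d, c 0 = z ∧ ∀ t, HasDerivAt c (P.field (c t)) t := by
  obtain ⟨M, hM⟩ := P.exists_norm_field_le hμ
  have hne : ∀ z : Phase d, 1 + P.energy z.1 z.2 ≠ 0 := fun z => by
    have := P.energy_nonneg z.1 z.2
    positivity
  have hv : ContDiff ℝ 1 fun z : Phase d => (1 + P.energy z.1 z.2)⁻¹ • P.field z :=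
    ((contDiff_const.add (P.contDiff_energy.of_le (by simp))).inv hne).smul
      (P.contDiff_field.of_le (by simp))
  obtain ⟨γ, hγ0, hγ⟩ := exists_global_solution_of_bounded hv hM z
  set κ := 1 + P.energy z.1 z.2 with hκ
  have hconst : ∀ t, 1 + P.energy (γ t).1 (γ t).2 = κ := fun t => by
    rw [P.energy_eq_of_hasDerivAt (s := fun t => (1 + P.energy (γ t).1 (γ t).2)⁻¹) hγ t 0, hγ0]
  -- The factor 1 + energy is constant along γ, so a linear change of time turns the rescaled flow
  -- into the Hamilton flow.
  refine ⟨fun t => γ (t * κ), by simp [hγ0], fun t => ?_⟩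
  have h := (hγ (t * κ)).scomp t (hasDerivAt_mul_const κ)
  rw [hconst, smul_smul, mul_inv_cancel₀ (hne z), one_smul] at h
  exact h

theorem curve_unique {c c' : ℝ → Phase d} (hc : ∀ t, HasDerivAt c (P.field (c t)) t)
    (hc' : ∀ t, HasDerivAt c' (P.field (c' t)) t) {t : ℝ} (h : c t = c' t) : c = c' :=
  eq_of_hasDerivAt (P.contDiff_field.of_le (by simp)) hc hc' h

/-- A solution on `(0, ∞)` which is continuous up to `t = 0` extends to a global solution. -/
theorem eq_of_hasDerivAt_Ioi (hμ : 0 < μ) {c γ : ℝ → Phase d}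
    (hc : ∀ t, HasDerivAt c (P.field (c t)) t)
    (hγc : ContinuousWithinAt γ (Set.Ioi 0) 0)
    (hγ : ∀ t, 0 < t → HasDerivAt γ (P.field (γ t)) t) (h0 : c 0 = γ 0) {t : ℝ} (ht : 0 ≤ t) :
    c t = γ t := by
  -- Time 1 is interior to the interval where γ solves the equation, so uniqueness identifies γ
  -- there with a global trajectory; continuity then reaches time 0.
  obtain ⟨c₁, h1, hc₁⟩ := P.exists_curve hμ (γ 1)
  have hc₂ : ∀ t, HasDerivAt (fun s => c₁ (s - 1)) (P.field (c₁ (t - 1))) t :=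
    fun t => (hc₁ (t - 1)).comp_sub_const t 1
  have heq : ∀ t, 0 < t → γ t = c₁ (t - 1) := fun t ht =>
    eqOn_Ioi_of_hasDerivAt (P.contDiff_field.of_le (by simp)) one_pos hγ
      (γ' := fun s => c₁ (s - 1)) (fun t _ => hc₂ t) (by simp [h1]) ht
  have h2 : γ 0 = c₁ (0 - 1) := by
    refine tendsto_nhds_unique hγc (((hc₂ 0).continuousAt.tendsto.mono_left
      nhdsWithin_le_nhds).congr' ?_)
    filter_upwards [self_mem_nhdsWithin] with t ht
    exact (heq t ht).symm
  have h3 : c = fun s => c₁ (s - 1) := P.curve_unique hc hc₂ (h0.trans h2)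
  rcases ht.eq_or_lt with rfl | ht
  · exact h0
  · rw [heq t ht, h3]

end Perturbation

/-! ### The Dollard modifier and its gradient. -/

/-- The Riesz isomorphism from functionals to vectors, as a real linear map. -/
noncomputable def rieszVector (d : ℕ) : (Space d →L[ℝ] ℝ) →L[ℝ] Space d :=
  LinearMap.mkContinuous
    { toFun := fun L => (InnerProductSpace.toDual ℝ (Space d)).symm L
      map_add' := fun L L' => map_add _ L L'
      map_smul' := fun c L => by simp } 1 (fun L => by simp)

theorem inner_rieszVector {d : ℕ} (L : Space d →L[ℝ] ℝ) (h : Space d) :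
    ⟪rieszVector d L, h⟫_ℝ = L h := by
  exact InnerProductSpace.toDual_symm_apply

namespace Perturbation

variable {d : ℕ} {μ : ℝ} (P : Perturbation d μ)

/-- The contribution of the perturbation to the Dollard modifier at time `1`. -/
noncomputable def phase (η : Space d) : ℝ := 1 / 2 * ⟪radialAverage 0 P.B η η, η⟫_ℝ

/-- The gradient of `phase`. -/
noncomputable def shift (η : Space d) : Space d := rieszVector d (fderiv ℝ P.phase η)

theorem isSymbol_phase (h0 : 0 < μ) (h1 : μ < 1) : IsSymbol (2 - μ) P.phase := by
  have hM : IsSymbol (-μ) (radialAverage 0 P.B) :=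
    P.symbol_B.radialAverage (by linarith) (by linarith)
  have h2 := ((hM.apply IsSymbol.id).bilinear IsSymbol.id
    (innerSL ℝ : Space d →L[ℝ] Space d →L[ℝ] ℝ)).clm_comp
    ((1 / 2 : ℝ) • ContinuousLinearMap.id ℝ ℝ)
  rw [show 2 - μ = -μ + 1 + 1 by ring]
  exact h2

theorem isSymbol_shift (h0 : 0 < μ) (h1 : μ < 1) : IsSymbol (1 - μ) P.shift := by
  rw [show 1 - μ = 2 - μ - 1 by ring]
  exact (P.isSymbol_phase h0 h1).fderiv.clm_comp (rieszVector d)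

theorem dollard_eq (t : ℝ) (ξ : Space d) :
    dollard P.energy t ξ =
      t * (1 / 2 * ⟪ξ, ξ⟫_ℝ + 1 / 2 * ⟪radialAverage 0 P.B (t • ξ) ξ, ξ⟫_ℝ) := by
  have hB := P.symbol_B.contDiff.continuous
  have h1 : dollard P.energy t ξ = t * ∫ s in (0 : ℝ)..1, P.energy ((t * s) • ξ) ξ := by
    have := intervalIntegral.smul_integral_comp_mul_left (a := 0) (b := 1)
      (fun s => P.energy (s • ξ) ξ) t
    rw [mul_zero, mul_one] at this
    exact this.symm
  let L : (Space d →L[ℝ] Space d) →L[ℝ] ℝ :=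
    (innerSL ℝ ξ).comp (ContinuousLinearMap.apply ℝ (Space d) ξ)
  have hint : IntervalIntegrable (fun s : ℝ => s ^ 0 • P.B (s • t • ξ)) MeasureTheory.volume 0 1 :=
    intervalIntegrable_radialAverage hB 0 _ _ _
  have h2 : ⟪radialAverage 0 P.B (t • ξ) ξ, ξ⟫_ℝ
      = ∫ s in (0 : ℝ)..1, ⟪P.B ((t * s) • ξ) ξ, ξ⟫_ℝ := by
    have := L.intervalIntegral_comp_comm hint
    rw [real_inner_comm]
    refine this.symm.trans (intervalIntegral.integral_congr fun s _ => ?_)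
    simp [L, smul_smul, mul_comm, real_inner_comm]
  have hint2 : IntervalIntegrable (fun s : ℝ => ⟪P.B ((t * s) • ξ) ξ, ξ⟫_ℝ)
      MeasureTheory.volume 0 1 := by
    refine Continuous.intervalIntegrable ?_ _ _
    refine Continuous.inner ?_ continuous_const
    fun_prop
  rw [h1, h2]
  simp only [energy, inner_add_left, mul_add]
  rw [intervalIntegral.integral_add intervalIntegrable_const (hint2.const_mul _),
    intervalIntegral.integral_const_mul]
  simp [mul_add]

/-- The Dollard modifier at time `1`. -/
noncomputable def fullPhase (η : Space d) : ℝ := 1 / 2 * ⟪η, η⟫_ℝ + P.phase η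

theorem hasFDerivAt_fullPhase (h0 : 0 < μ) (h1 : μ < 1) (η : Space d) :
    HasFDerivAt P.fullPhase (innerSL ℝ (η + P.shift η)) η := by
  have h2 := ((P.isSymbol_phase h0 h1).differentiable η).hasFDerivAt
  have h3 := (((hasFDerivAt_id η).inner ℝ (hasFDerivAt_id η)).const_mul (1 / 2)).add h2
  refine h3.congr_fderiv ?_
  ext h
  simp only [shift, innerSL_apply_apply, inner_add_left, inner_rieszVector]
  simp [real_inner_comm h]
  ring

/-- The energy is homogeneous of degree two in the momentum. This scaling reduces the modifier at
every time to the modifier at time 1. -/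
theorem dollard_mul (t : ℝ) (ξ : Space d) : t * dollard P.energy t ξ = P.fullPhase (t • ξ) := by
  rw [dollard_eq, fullPhase, phase]
  simp only [map_smul, real_inner_smul_left, real_inner_smul_right]
  ring

theorem gradient_dollard (h0 : 0 < μ) (h1 : μ < 1) {t : ℝ} (ht : t ≠ 0) (ξ : Space d) :
    gradient (dollard P.energy t) ξ = t • ξ + P.shift (t • ξ) := by
  have h2 : dollard P.energy t = fun ξ => t⁻¹ * P.fullPhase (t • ξ) := by
    funext ξ
    rw [← dollard_mul, inv_mul_cancel_left₀ ht]
  rw [h2]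
  refine HasGradientAt.gradient ?_
  rw [hasGradientAt_iff_hasFDerivAt]
  have h3 : HasFDerivAt (fun y : Space d => t • y) (t • ContinuousLinearMap.id ℝ (Space d)) ξ :=
    (hasFDerivAt_id ξ).const_smul t
  refine (((P.hasFDerivAt_fullPhase h0 h1 (t • ξ)).comp ξ h3).const_mul t⁻¹).congr_fderiv ?_
  ext h
  simp only [InnerProductSpace.toDual_apply_apply, smul_apply, ContinuousLinearMap.comp_apply,
    innerSL_apply_apply, ContinuousLinearMap.id_apply, real_inner_smul_right, smul_eq_mul]
  rw [inv_mul_cancel_left₀ ht]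

/-- The derivative at t = 1 of the identity `dollard_mul`, computed on both sides. -/
theorem inner_shift_self (h0 : 0 < μ) (h1 : μ < 1) (η : Space d) :
    ⟪η + P.shift η, η⟫_ℝ = P.fullPhase η + P.energy η η := by
  have hB := P.symbol_B.contDiff.continuous
  have h2 : HasDerivAt (fun t : ℝ => P.fullPhase (t • η)) ⟪η + P.shift η, η⟫_ℝ 1 := by
    have h3 : HasDerivAt (fun t : ℝ => t • η) η 1 := by
      simpa using (hasDerivAt_id (1 : ℝ)).smul_const η
    have h4 := P.hasFDerivAt_fullPhase h0 h1 ((1 : ℝ) • η)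
    have h5 := h4.comp_hasDerivAt (1 : ℝ) h3
    rw [one_smul] at h5
    exact h5
  have hcont : Continuous fun s : ℝ => P.energy (s • η) η := by
    unfold energy
    refine continuous_const.mul (Continuous.inner ?_ continuous_const)
    fun_prop
  have h3 : HasDerivAt (fun t : ℝ => dollard P.energy t η) (P.energy ((1 : ℝ) • η) η) 1 :=
    intervalIntegral.integral_hasDerivAt_right (hcont.intervalIntegrable _ _)
      (hcont.stronglyMeasurableAtFilter _ _) hcont.continuousAt
  have h4 := (hasDerivAt_id (1 : ℝ)).mul h3
  have h5 := h2.unique (h4.congr_of_eventuallyEq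
    (Eventually.of_forall fun t => (P.dollard_mul t η).symm))
  rw [h5, ← one_smul ℝ η, ← P.dollard_mul]
  simp

/-- The map `shift` is the gradient of `phase`, so this is the symmetry of a second derivative. -/
theorem inner_fderiv_shift_comm (h0 : 0 < μ) (h1 : μ < 1) (η h k : Space d) :
    ⟪fderiv ℝ P.shift η h, k⟫_ℝ = ⟪fderiv ℝ P.shift η k, h⟫_ℝ := by
  have hs := P.isSymbol_phase h0 h1
  have h2 : ∀ h k, ⟪fderiv ℝ P.shift η h, k⟫_ℝ = fderiv ℝ (fderiv ℝ P.phase) η h k := by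
    intro h k
    have h3 : HasFDerivAt P.shift ((rieszVector d).comp (fderiv ℝ (fderiv ℝ P.phase) η)) η :=
      (rieszVector d).hasFDerivAt.comp η (hs.fderiv.differentiable η).hasFDerivAt
    rw [h3.fderiv, ContinuousLinearMap.comp_apply, inner_rieszVector]
  rw [h2, h2]
  exact (hs.contDiff.contDiffAt.isSymmSndFDerivAt
    (by simpa using WithTop.coe_le_coe.2 (le_top (a := (2 : ℕ∞))))).eq h k

/-- The Euler identity for the Dollard modifier, differentiated. -/
theorem fderiv_shift_apply_self (h0 : 0 < μ) (h1 : μ < 1) (η : Space d) :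
    fderiv ℝ P.shift η η = P.B η η + P.Γ η η η := by
  have hsh := (P.isSymbol_shift h0 h1).differentiable η
  have h2 : HasFDerivAt (fun η => ⟪η + P.shift η, η⟫_ℝ)
      (innerSL ℝ (η + P.shift η) + (innerSL ℝ (P.Γ η η η) + innerSL ℝ (η + P.B η η))) η := by
    have h3 := (P.hasFDerivAt_energy (η, η)).comp (f := fun η => (η, η)) η
      ((hasFDerivAt_id (𝕜 := ℝ) η).prodMk (hasFDerivAt_id η))
    have h4 := (P.hasFDerivAt_fullPhase h0 h1 η).add h3
    have h5 : (fun η => ⟪η + P.shift η, η⟫_ℝ) = fun η => P.fullPhase η + P.energy η η :=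
      funext (P.inner_shift_self h0 h1)
    rw [h5]
    refine h4.congr_fderiv ?_
    ext h
    simp
  have h3 := ((hasFDerivAt_id η).add hsh.hasFDerivAt).inner ℝ (hasFDerivAt_id η)
  have h4 := h2.unique h3
  refine ext_inner_right ℝ fun h => ?_
  have h5 := congrArg (fun L : Space d →L[ℝ] ℝ => L h) h4
  -- The product rule gives the derivative of `shift` in the direction h, paired with η. By symmetry
  -- it is the derivative in the direction η, paired with h.
  have h6 := P.inner_fderiv_shift_comm h0 h1 η η h
  simp only [add_apply, innerSL_apply_apply, ContinuousLinearMap.comp_apply,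
    ContinuousLinearMap.prod_apply, ContinuousLinearMap.id_apply, fderivInnerCLM_apply,
    inner_add_left, id] at h5
  rw [h6, inner_add_left]
  have h7 := real_inner_comm h η
  simp only [Pi.add_apply, id, inner_add_left] at h5
  linarith

end Perturbation

theorem contDiffAt_clm_comp {X F G : Type} [NormedAddCommGroup X] [NormedSpace ℝ X]
    [NormedAddCommGroup F] [NormedSpace ℝ F] [NormedAddCommGroup G] [NormedSpace ℝ G]
    (L : F →L[ℝ] G) {f : X → F} {x : X} (hf : ContDiffAt ℝ ∞ f x) :
    ContDiffAt ℝ ∞ (fun x => L (f x)) x :=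
  L.contDiff.contDiffAt.comp x hf

theorem contDiffAt_bcfApply {T : Type} [TopologicalSpace T] {X F G : Type} [NormedAddCommGroup X]
    [NormedSpace ℝ X] [NormedAddCommGroup F] [NormedSpace ℝ F] [NormedAddCommGroup G]
    [NormedSpace ℝ G] {f : X → T →ᵇ (F →L[ℝ] G)} {g : X → T →ᵇ F} {x : X}
    (hf : ContDiffAt ℝ ∞ f x) (hg : ContDiffAt ℝ ∞ g x) :
    ContDiffAt ℝ ∞ (fun x => bcfApply T F G (f x) (g x)) x :=
  (contDiffAt_clm_comp (bcfApply T F G) hf).clm_apply hg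

/-! ### Scales of growth and decay in time. -/

section Scales

/-- The growing weight `1 + |t|`. -/
def timeScale (t : ℝ) : ℝ := 1 + |t|

theorem one_le_timeScale (t : ℝ) : 1 ≤ timeScale t := by
  unfold timeScale
  linarith [abs_nonneg t]

theorem timeScale_pos (t : ℝ) : 0 < timeScale t := lt_of_lt_of_le one_pos (one_le_timeScale t)

theorem continuous_timeScale : Continuous timeScale := by
  unfold timeScale
  fun_prop

/-- The bounded function `(1 + |t|)^{-ν}`. -/
noncomputable def decayScale (ν : ℝ) (hν : 0 ≤ ν) : ℝ →ᵇ ℝ :=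
  BoundedContinuousFunction.ofNormedAddCommGroup (fun t => timeScale t ^ (-ν))
    (continuous_timeScale.rpow_const fun t => Or.inl (timeScale_pos t).ne') 1
    (fun t => by
      rw [Real.norm_of_nonneg (Real.rpow_nonneg (timeScale_pos t).le _)]
      exact Real.rpow_le_one_of_one_le_of_nonpos (one_le_timeScale t) (by linarith))

theorem decayScale_apply (ν : ℝ) (hν : 0 ≤ ν) (t : ℝ) : decayScale ν hν t = timeScale t ^ (-ν) :=
  rfl

/-- The bounded function `|t| / (1 + |t|)`. -/
noncomputable def ratioScale : ℝ →ᵇ ℝ :=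
  BoundedContinuousFunction.ofNormedAddCommGroup (fun t => |t| / timeScale t)
    (continuous_abs.div continuous_timeScale fun t => (timeScale_pos t).ne') 1
    (fun t => by
      rw [Real.norm_of_nonneg (div_nonneg (abs_nonneg t) (timeScale_pos t).le),
        div_le_one (timeScale_pos t)]
      unfold timeScale
      linarith)

theorem ratioScale_apply (t : ℝ) : ratioScale t = |t| / timeScale t := rfl

theorem one_sub_ratioScale (t : ℝ) : 1 - ratioScale t = (timeScale t)⁻¹ := by
  rw [ratioScale_apply]
  have := (timeScale_pos t).ne'
  field_simp
  unfold timeScale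
  ring

/-- The bounded function equal to `r` on the unit interval, and constant on its complement. -/
noncomputable def clip : ℝ →ᵇ ℝ :=
  BoundedContinuousFunction.ofNormedAddCommGroup (fun r => max 0 (min r 1)) (by fun_prop) 1
    (fun r => by
      rw [Real.norm_of_nonneg (le_max_left _ _)]
      exact max_le zero_le_one (min_le_right _ _))

theorem clip_of_mem {r : ℝ} (hr : r ∈ Set.Icc (0 : ℝ) 1) : clip r = r := by
  change max 0 (min r 1) = r
  rw [min_eq_left hr.2, max_eq_right hr.1]

theorem norm_clip_le (r : ℝ) : ‖clip r‖ ≤ 1 := by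
  change ‖max 0 (min r 1)‖ ≤ 1
  rw [Real.norm_of_nonneg (le_max_left _ _)]
  exact max_le zero_le_one (min_le_right _ _)

end Scales

/-! ### Rescaled free and perturbed paths. -/

section Paths

variable {d : ℕ}

/-- For large time scales the deviation is below c/2. On bounded time scales the inverse scale alone
is bounded below, so nothing is asked of x there. -/
theorem mem_awayFromZero_of_norm_sub_le {S : Type} [TopologicalSpace S] {π : S → ℝ}
    {ξ : ℝ →ᵇ Space d} (hξ : ξ ∈ awayFromZero d timeScale) {x : S →ᵇ Space d} {C ν : ℝ}
    (hν : 0 < ν) (h : ∀ s, ‖x s - ξ (π s)‖ ≤ C * timeScale (π s) ^ (-ν)) :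
    x ∈ awayFromZero d fun s => timeScale (π s) := by
  obtain ⟨c, hc, hξ⟩ := hξ
  have h1 : Tendsto (fun τ : ℝ => C * τ ^ (-ν)) atTop (𝓝 0) := by
    simpa using (tendsto_rpow_neg_atTop hν).const_mul C
  obtain ⟨T, hT0, hT⟩ := (h1.eventually (gt_mem_nhds (half_pos hc))).exists_forall_of_atTop.imp
    fun T hT => (⟨lt_of_lt_of_le one_pos (le_max_left 1 T), fun τ hτ =>
      hT τ ((le_max_right 1 T).trans hτ)⟩ :
        0 < max 1 T ∧ ∀ τ ≥ max 1 T, C * τ ^ (-ν) < c / 2)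
  refine ⟨min (c / 2) (max 1 T)⁻¹, by positivity, fun s => ?_⟩
  have hτ := timeScale_pos (π s)
  have hinv : 0 ≤ (timeScale (π s))⁻¹ := by positivity
  rcases le_total (max 1 T) (timeScale (π s)) with h2 | h2
  · refine (min_le_left _ _).trans ?_
    have h3 := hξ (π s)
    have h4 := norm_sub_norm_le (ξ (π s)) (x s)
    rw [norm_sub_rev] at h4
    have h5 := h s
    have h6 := hT _ h2
    linarith
  · refine (min_le_right _ _).trans ?_
    have h3 : (max 1 T)⁻¹ ≤ (timeScale (π s))⁻¹ := by gcongr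
    linarith [norm_nonneg (x s)]

/-- The path of the free motion, divided by the time scale. -/
noncomputable def freePath (d : ℕ) : (ℝ →ᵇ Space d) →L[ℝ] (ℝ →ᵇ Space d) :=
  bcfSmul (Space d) ratioScale

theorem freePath_apply (ξ : ℝ →ᵇ Space d) (t : ℝ) : freePath d ξ t = ratioScale t • ξ t := rfl

theorem timeScale_smul_freePath (ξ : ℝ →ᵇ Space d) (t : ℝ) :
    timeScale t • freePath d ξ t = |t| • ξ t := by
  rw [freePath_apply, ratioScale_apply, smul_smul, mul_div_cancel₀ _ (timeScale_pos t).ne']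

theorem norm_freePath_sub_le (ξ : ℝ →ᵇ Space d) (t : ℝ) :
    ‖freePath d ξ t - ξ t‖ ≤ ‖ξ‖ * (timeScale t)⁻¹ := by
  have h : freePath d ξ t - ξ t = -((1 - ratioScale t) • ξ t) := by
    rw [freePath_apply, sub_smul, one_smul]
    abel
  rw [h, norm_neg, one_sub_ratioScale, norm_smul,
    Real.norm_of_nonneg (inv_nonneg.2 (timeScale_pos t).le), mul_comm]
  exact mul_le_mul_of_nonneg_right (ξ.norm_coe_le_norm t) (inv_nonneg.2 (timeScale_pos t).le)

theorem freePath_mem {ξ : ℝ →ᵇ Space d} (hξ : ξ ∈ awayFromZero d timeScale) :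
    freePath d ξ ∈ awayFromZero d timeScale := by
  refine mem_awayFromZero_of_norm_sub_le (π := fun t => t) (ν := 1) hξ one_pos (C := ‖ξ‖)
    fun t => ?_
  rw [Real.rpow_neg_one]
  exact norm_freePath_sub_le ξ t

variable {μ : ℝ} (h0 : 0 < μ)

/-- The path of the perturbed motion divided by the time scale. The deviation from the free
motion is `τ^{1-μ} q`. -/
noncomputable def deviatedPath (d : ℕ) (h0 : 0 < μ) :
    (ℝ →ᵇ Space d) × (ℝ →ᵇ Space d) →L[ℝ] (ℝ →ᵇ Space d) :=
  (bcfSmul (Space d) (decayScale μ h0.le)).comp (ContinuousLinearMap.fst ℝ _ _) +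
    (freePath d).comp (ContinuousLinearMap.snd ℝ _ _)

theorem deviatedPath_apply (z : (ℝ →ᵇ Space d) × (ℝ →ᵇ Space d)) (t : ℝ) :
    deviatedPath d h0 z t = timeScale t ^ (-μ) • z.1 t + freePath d z.2 t := rfl

/-- The segments between the free and the perturbed motions. -/
noncomputable def segmentPath (d : ℕ) (h0 : 0 < μ) :
    (ℝ →ᵇ Space d) × (ℝ →ᵇ Space d) →L[ℝ] (ℝ × ℝ →ᵇ Space d) :=
  ((bcfSmul (Space d) (bcfComp ℝ ⟨Prod.snd, continuous_snd⟩ clip)).comp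
    (bcfComp (Space d) ⟨Prod.fst, continuous_fst⟩)).comp
      ((bcfSmul (Space d) (decayScale μ h0.le)).comp (ContinuousLinearMap.fst ℝ _ _)) +
    ((bcfComp (Space d) ⟨Prod.fst, continuous_fst⟩).comp (freePath d)).comp
      (ContinuousLinearMap.snd ℝ _ _)

theorem segmentPath_apply (z : (ℝ →ᵇ Space d) × (ℝ →ᵇ Space d)) (s : ℝ × ℝ) :
    segmentPath d h0 z s = clip s.2 • timeScale s.1 ^ (-μ) • z.1 s.1 + freePath d z.2 s.1 := rfl

theorem timeScale_smul_rpow_neg_smul (t : ℝ) (x : Space d) :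
    timeScale t • timeScale t ^ (-μ) • x = timeScale t ^ (1 - μ) • x := by
  rw [smul_smul, sub_eq_add_neg, Real.rpow_add (timeScale_pos t), Real.rpow_one]

theorem timeScale_smul_deviatedPath (z : (ℝ →ᵇ Space d) × (ℝ →ᵇ Space d)) (t : ℝ) :
    timeScale t • deviatedPath d h0 z t = |t| • z.2 t + timeScale t ^ (1 - μ) • z.1 t := by
  rw [deviatedPath_apply, smul_add, timeScale_smul_freePath, timeScale_smul_rpow_neg_smul,
    add_comm]

theorem timeScale_smul_segmentPath (z : (ℝ →ᵇ Space d) × (ℝ →ᵇ Space d)) (t : ℝ) {r : ℝ}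
    (hr : r ∈ Set.Icc (0 : ℝ) 1) : timeScale t • segmentPath d h0 z (t, r)
      = |t| • z.2 t + r • timeScale t ^ (1 - μ) • z.1 t := by
  rw [segmentPath_apply, smul_add, timeScale_smul_freePath, smul_comm (timeScale t),
    timeScale_smul_rpow_neg_smul, clip_of_mem hr, add_comm]

theorem segmentPath_mem (h1 : μ < 1) {z : (ℝ →ᵇ Space d) × (ℝ →ᵇ Space d)}
    (hz : z.2 ∈ awayFromZero d timeScale) :
    segmentPath d h0 z ∈ awayFromZero d fun s : ℝ × ℝ => timeScale s.1 := by
  refine mem_awayFromZero_of_norm_sub_le (π := Prod.fst) (ν := μ) hz h0 (C := ‖z.1‖ + ‖z.2‖)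
    fun s => ?_
  have h2 := norm_freePath_sub_le z.2 s.1
  have h3 : (timeScale s.1)⁻¹ ≤ timeScale s.1 ^ (-μ) := by
    rw [← Real.rpow_neg_one]
    exact Real.rpow_le_rpow_of_exponent_le (one_le_timeScale _) (by linarith)
  have h4 : ‖clip s.2 • timeScale s.1 ^ (-μ) • z.1 s.1‖ ≤ ‖z.1‖ * timeScale s.1 ^ (-μ) := by
    have hp : 0 ≤ timeScale s.1 ^ (-μ) := Real.rpow_nonneg (timeScale_pos _).le _
    rw [norm_smul, norm_smul, Real.norm_of_nonneg hp]
    have h5 := norm_clip_le s.2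
    have h6 := z.1.norm_coe_le_norm s.1
    calc ‖clip s.2‖ * (timeScale s.1 ^ (-μ) * ‖z.1 s.1‖)
        ≤ 1 * (timeScale s.1 ^ (-μ) * ‖z.1‖) := by gcongr
      _ = _ := by ring
  rw [segmentPath_apply, add_sub_assoc, add_mul]
  refine (norm_add_le _ _).trans (add_le_add h4 (h2.trans ?_))
  gcongr

theorem deviatedPath_mem (h1 : μ < 1) {z : (ℝ →ᵇ Space d) × (ℝ →ᵇ Space d)}
    (hz : z.2 ∈ awayFromZero d timeScale) :
    deviatedPath d h0 z ∈ awayFromZero d timeScale := by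
  obtain ⟨c, hc, h⟩ := segmentPath_mem h0 h1 hz
  refine ⟨c, hc, fun t => ?_⟩
  have h2 := h (t, 1)
  rwa [segmentPath_apply, clip_of_mem (by simp), one_smul] at h2

end Paths

/-! ### Differences of symbols between the two motions. -/

section Differences

variable {d : ℕ} {F : Type} [NormedAddCommGroup F] [NormedSpace ℝ F] {μ m : ℝ}

theorem integral_fderiv_segment [CompleteSpace F] {b : Space d → F} (hb : ContDiff ℝ 1 b)
    (x h : Space d) :
    ∫ r in (0 : ℝ)..1, fderiv ℝ b (x + r • h) h = b (x + h) - b x := by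
  have hd : ∀ r : ℝ, HasDerivAt (fun r : ℝ => b (x + r • h)) (fderiv ℝ b (x + r • h) h) r := by
    intro r
    have h1 : HasDerivAt (fun r : ℝ => x + r • h) h r := by
      simpa using ((hasDerivAt_id r).smul_const h).const_add x
    exact ((hb.differentiable one_ne_zero).differentiableAt.hasFDerivAt).comp_hasDerivAt r h1
  have hc : Continuous fun r : ℝ => fderiv ℝ b (x + r • h) h := by
    have := hb.continuous_fderiv one_ne_zero
    fun_prop
  rw [intervalIntegral.integral_eq_sub_of_hasDerivAt (fun r _ => hd r)
    (hc.intervalIntegrable _ _)]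
  simp

/-- The difference quotient of a symbol between the free and the perturbed motions. -/
noncomputable def symbolDifference (h0 : 0 < μ) (m : ℝ) (b : Space d → F)
    (z : (ℝ →ᵇ Space d) × (ℝ →ᵇ Space d)) : ℝ →ᵇ (Space d →L[ℝ] F) :=
  bcfIntegral ℝ (Space d →L[ℝ] F) (nemytskii (fun s : ℝ × ℝ => timeScale s.1) (m - 1)
    (fderiv ℝ b) (segmentPath d h0 z))

theorem contDiffAt_symbolDifference (h0 : 0 < μ) (h1 : μ < 1) {b : Space d → F}
    (hb : IsSymbol m b) {z : (ℝ →ᵇ Space d) × (ℝ →ᵇ Space d)}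
    (hz : z.2 ∈ awayFromZero d timeScale) : ContDiffAt ℝ ∞ (symbolDifference h0 m b) z :=
  contDiffAt_clm_comp _ ((contDiffAt_nemytskii (continuous_timeScale.comp continuous_fst)
    (fun s => one_le_timeScale s.1) hb.fderiv (segmentPath_mem h0 h1 hz)).comp z
      (segmentPath d h0).contDiff.contDiffAt)

/-- The derivative of b has order m - 1 along the segment and the displacement has size τ^{1-μ}, so
the difference has size τ^{m-μ}. The integral form keeps its dependence on the paths smooth. -/
theorem symbolDifference_apply [CompleteSpace F] (h0 : 0 < μ) (h1 : μ < 1) {b : Space d → F}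
    (hb : IsSymbol m b) {z : (ℝ →ᵇ Space d) × (ℝ →ᵇ Space d)}
    (hz : z.2 ∈ awayFromZero d timeScale) (t : ℝ) :
    symbolDifference h0 m b z t (z.1 t) = timeScale t ^ (μ - m) •
      (b (|t| • z.2 t + timeScale t ^ (1 - μ) • z.1 t) - b (|t| • z.2 t)) := by
  have hτ := timeScale_pos t
  set g := nemytskii (fun s : ℝ × ℝ => timeScale s.1) (m - 1) (fderiv ℝ b)
    (segmentPath d h0 z) with hg
  have hgi : IntervalIntegrable (fun r => g (t, r)) MeasureTheory.volume 0 1 :=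
    Continuous.intervalIntegrable (by fun_prop) _ _
  have h2 : symbolDifference h0 m b z t (z.1 t) = ∫ r in (0 : ℝ)..1, g (t, r) (z.1 t) :=
    (ContinuousLinearMap.intervalIntegral_apply hgi _)
  rw [h2, ← integral_fderiv_segment (hb.contDiff.of_le (by simp)),
    ← intervalIntegral.integral_smul]
  refine intervalIntegral.integral_congr fun r hr => ?_
  rw [Set.uIcc_of_le zero_le_one] at hr
  simp only [hg]
  rw [nemytskii_apply (τ := fun s : ℝ × ℝ => timeScale s.1)
    (continuous_timeScale.comp continuous_fst) (fun s => one_le_timeScale s.1)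
    hb.fderiv (segmentPath_mem h0 h1 hz), timeScale_smul_segmentPath h0 z t hr]
  have key : ∀ L : Space d →L[ℝ] F, (timeScale t ^ (-(m - 1)) • L) (z.1 t)
      = timeScale t ^ (μ - m) • L (timeScale t ^ (1 - μ) • z.1 t) := fun L => by
    rw [map_smul, smul_smul, smul_apply, ← Real.rpow_add hτ]
    congr 2
    ring
  exact key _

end Differences

section Quadratic

variable {F : Type} [NormedAddCommGroup F] [NormedSpace ℝ F]

/-- Pointwise application of a bounded family of bilinear maps on the diagonal. -/
noncomputable def bcfQuadratic (G : ℝ →ᵇ (F →L[ℝ] F →L[ℝ] F)) (ξ : ℝ →ᵇ F) : ℝ →ᵇ F :=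
  bcfApply ℝ F F (bcfApply ℝ F (F →L[ℝ] F) G ξ) ξ

theorem bcfQuadratic_apply (G : ℝ →ᵇ (F →L[ℝ] F →L[ℝ] F)) (ξ : ℝ →ᵇ F) (t : ℝ) :
    bcfQuadratic G ξ t = G t (ξ t) (ξ t) := rfl

end Quadratic

/-! ### The Hamilton equations in asymptotic coordinates. -/

namespace Perturbation

variable {d : ℕ} {μ : ℝ} (P : Perturbation d μ)

/-- The position as a function of the asymptotic coordinates `z = (y, ξ)`. -/
noncomputable def position (t : ℝ) (z : Phase d) : Space d := z.1 + (t • z.2 + P.shift (t • z.2))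

/-- The Hamilton vector field in asymptotic coordinates, at the position `x`. -/
noncomputable def accel (t : ℝ) (x ξ : Space d) : Phase d :=
  ((P.B x - P.B (t • ξ)) ξ + t • (P.Γ x - P.Γ (t • ξ)) ξ ξ +
      t • fderiv ℝ P.shift (t • ξ) (P.Γ x ξ ξ),
    -(P.Γ x ξ ξ))

theorem fderiv_shift_smul_apply (h0 : 0 < μ) (h1 : μ < 1) {t : ℝ} (ht : t ≠ 0) (ξ : Space d) :
    fderiv ℝ P.shift (t • ξ) ξ = P.B (t • ξ) ξ + t • P.Γ (t • ξ) ξ ξ := by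
  have h := P.fderiv_shift_apply_self h0 h1 (t • ξ)
  simp only [map_smul, smul_apply] at h
  rw [← smul_add] at h
  exact smul_right_injective _ ht h

theorem hasDerivAt_free_shift (h0 : 0 < μ) (h1 : μ < 1) {ξ : ℝ → Space d} {ξ' : Space d} {t : ℝ}
    (ht : t ≠ 0) (h : HasDerivAt ξ ξ' t) :
    HasDerivAt (fun t => t • ξ t + P.shift (t • ξ t))
      ((ξ t + t • ξ') + ((P.B (t • ξ t) (ξ t) + t • P.Γ (t • ξ t) (ξ t) (ξ t))
        + t • fderiv ℝ P.shift (t • ξ t) ξ')) t := by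
  have h2 : HasDerivAt (fun t => t • ξ t) (ξ t + t • ξ') t := by
    have h3 := (hasDerivAt_id t).smul h
    rw [one_smul, add_comm] at h3
    exact h3
  have h3 := ((P.isSymbol_shift h0 h1).differentiable (t • ξ t)).hasFDerivAt.comp_hasDerivAt t h2
  rw [map_add, map_smul, P.fderiv_shift_smul_apply h0 h1 ht] at h3
  exact h2.add h3

theorem accel_fst_add (t : ℝ) (x ξ : Space d) :
    (P.accel t x ξ).1 + ((ξ + t • -(P.Γ x ξ ξ)) + ((P.B (t • ξ) ξ + t • P.Γ (t • ξ) ξ ξ)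
        + t • fderiv ℝ P.shift (t • ξ) (-(P.Γ x ξ ξ)))) = ξ + P.B x ξ := by
  simp only [accel, sub_apply, map_neg, smul_neg, smul_sub]
  abel

/-- Solutions of the Hamilton equations in asymptotic coordinates. -/
theorem hasDerivAt_asymptotic (h0 : 0 < μ) (h1 : μ < 1) {c : ℝ → Phase d} {t : ℝ} (ht : t ≠ 0)
    (h : HasDerivAt c (P.field (c t)) t) :
    HasDerivAt (fun t => ((c t).1 - (t • (c t).2 + P.shift (t • (c t).2)), (c t).2))
      (P.accel t (c t).1 (c t).2) t := by
  have hx : HasDerivAt (fun t => (c t).1) ((c t).2 + P.B (c t).1 (c t).2) t :=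
    (hasFDerivAt_fst.comp_hasDerivAt t h :)
  have hξ : HasDerivAt (fun t => (c t).2) (-(P.Γ (c t).1 (c t).2 (c t).2)) t :=
    (hasFDerivAt_snd.comp_hasDerivAt t h :)
  have h2 := hx.sub (P.hasDerivAt_free_shift h0 h1 ht hξ)
  rw [← P.accel_fst_add t, add_sub_cancel_right] at h2
  exact h2.prodMk hξ

theorem hasDerivAt_of_asymptotic (h0 : 0 < μ) (h1 : μ < 1) {u : ℝ → Phase d} {t : ℝ} (ht : t ≠ 0)
    (h : HasDerivAt u (P.accel t (P.position t (u t)) (u t).2) t) :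
    HasDerivAt (fun t => (P.position t (u t), (u t).2))
      (P.field (P.position t (u t), (u t).2)) t := by
  have hy : HasDerivAt (fun t => (u t).1) (P.accel t (P.position t (u t)) (u t).2).1 t :=
    (hasFDerivAt_fst.comp_hasDerivAt t h :)
  have hξ : HasDerivAt (fun t => (u t).2)
      (-(P.Γ (P.position t (u t)) (u t).2 (u t).2)) t :=
    (hasFDerivAt_snd.comp_hasDerivAt t h :)
  have h2 := hy.add (P.hasDerivAt_free_shift h0 h1 ht hξ)
  rw [P.accel_fst_add] at h2
  exact h2.prodMk hξ

section Reduced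

/-- The rescaled force along the path with deviation `z.1` and momentum `z.2`. -/
noncomputable def reducedForce (h0 : 0 < μ) (z : (ℝ →ᵇ Space d) × (ℝ →ᵇ Space d)) :
    ℝ →ᵇ Space d :=
  bcfQuadratic (nemytskii timeScale (-1 - μ) P.Γ (deviatedPath d h0 z)) z.2

/-- The rescaled velocity of the asymptotic position. -/
noncomputable def reducedVelocity (h0 : 0 < μ) (z : (ℝ →ᵇ Space d) × (ℝ →ᵇ Space d)) :
    ℝ →ᵇ Space d :=
  bcfApply ℝ (Space d) (Space d) (bcfApply ℝ (Space d) (Space d →L[ℝ] Space d)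
      (symbolDifference h0 (-μ) P.B z) z.1) z.2
    + bcfSmul (Space d) ratioScale (bcfQuadratic (bcfApply ℝ (Space d)
      (Space d →L[ℝ] Space d →L[ℝ] Space d) (symbolDifference h0 (-1 - μ) P.Γ z) z.1) z.2)
    + bcfSmul (Space d) ratioScale (bcfApply ℝ (Space d) (Space d)
      (nemytskii timeScale (1 - μ - 1) (fderiv ℝ P.shift) (freePath d z.2)) (P.reducedForce h0 z))

/-- The rescaled vector field in asymptotic coordinates. -/
noncomputable def reducedField (h0 : 0 < μ) (h1 : μ < 1)
    (z : (ℝ →ᵇ Space d) × (ℝ →ᵇ Space d)) : ℝ →ᵇ Phase d :=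
  (ContinuousLinearMap.inl ℝ (Space d) (Space d)).compLeftContinuousBounded ℝ
      (P.reducedVelocity h0 z)
    - (ContinuousLinearMap.inr ℝ (Space d) (Space d)).compLeftContinuousBounded ℝ
      (bcfSmul (Space d) (decayScale (1 - μ) (sub_nonneg.2 h1.le)) (P.reducedForce h0 z))

variable {z : (ℝ →ᵇ Space d) × (ℝ →ᵇ Space d)}

theorem contDiffAt_reducedForce (h0 : 0 < μ) (h1 : μ < 1)
    (hz : z.2 ∈ awayFromZero d timeScale) : ContDiffAt ℝ ∞ (P.reducedForce h0) z :=
  contDiffAt_bcfApply (contDiffAt_bcfApply ((contDiffAt_nemytskii continuous_timeScale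
    one_le_timeScale P.symbol_Γ (deviatedPath_mem h0 h1 hz)).comp z
    (deviatedPath d h0).contDiff.contDiffAt) contDiffAt_snd) contDiffAt_snd

theorem contDiffAt_reducedVelocity (h0 : 0 < μ) (h1 : μ < 1)
    (hz : z.2 ∈ awayFromZero d timeScale) : ContDiffAt ℝ ∞ (P.reducedVelocity h0) z := by
  have e1 := contDiffAt_symbolDifference h0 h1 P.symbol_B hz
  have e2 := contDiffAt_symbolDifference h0 h1 P.symbol_Γ hz
  have e3 := (contDiffAt_nemytskii continuous_timeScale one_le_timeScale
    (P.isSymbol_shift h0 h1).fderiv (freePath_mem hz)).comp z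
    (((freePath d).comp (ContinuousLinearMap.snd ℝ (ℝ →ᵇ Space d) _)).contDiff.contDiffAt)
  have h1' : ContDiffAt ℝ ∞ (fun z : (ℝ →ᵇ Space d) × (ℝ →ᵇ Space d) => z.1) z := contDiffAt_fst
  have h2' : ContDiffAt ℝ ∞ (fun z : (ℝ →ᵇ Space d) × (ℝ →ᵇ Space d) => z.2) z := contDiffAt_snd
  exact ((contDiffAt_bcfApply (contDiffAt_bcfApply e1 h1') h2').add
    (contDiffAt_clm_comp _ (contDiffAt_bcfApply
      (contDiffAt_bcfApply (contDiffAt_bcfApply e2 h1') h2') h2'))).add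
    (contDiffAt_clm_comp _ (contDiffAt_bcfApply e3 (P.contDiffAt_reducedForce h0 h1 hz)))

theorem contDiffAt_reducedField (h0 : 0 < μ) (h1 : μ < 1)
    (hz : z.2 ∈ awayFromZero d timeScale) : ContDiffAt ℝ ∞ (P.reducedField h0 h1) z :=
  (contDiffAt_clm_comp _ (P.contDiffAt_reducedVelocity h0 h1 hz)).sub
    (contDiffAt_clm_comp _ (contDiffAt_clm_comp _ (P.contDiffAt_reducedForce h0 h1 hz)))

theorem reducedForce_apply (h0 : 0 < μ) (h1 : μ < 1) (hz : z.2 ∈ awayFromZero d timeScale)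
    (t : ℝ) : P.reducedForce h0 z t = timeScale t ^ (1 + μ) •
      P.Γ (|t| • z.2 t + timeScale t ^ (1 - μ) • z.1 t) (z.2 t) (z.2 t) := by
  rw [reducedForce, bcfQuadratic_apply, nemytskii_apply continuous_timeScale one_le_timeScale
    P.symbol_Γ (deviatedPath_mem h0 h1 hz), timeScale_smul_deviatedPath, neg_sub, sub_neg_eq_add,
    add_comm μ]
  rfl

/-- Power counting: each term of the velocity of y has size τ^{-2μ}, and the force has size
τ^{-1-μ}, smaller by τ^{-(1-μ)}. This extra decay is the factor `decayScale` in the momentum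
component. -/
theorem reducedField_apply (h0 : 0 < μ) (h1 : μ < 1) (hz : z.2 ∈ awayFromZero d timeScale)
    (t : ℝ) : P.reducedField h0 h1 z t = timeScale t ^ (2 * μ) •
      P.accel |t| (|t| • z.2 t + timeScale t ^ (1 - μ) • z.1 t) (z.2 t) := by
  have hτ := timeScale_pos t
  have e1 : P.reducedField h0 h1 z t = (P.reducedVelocity h0 z t,
      -(timeScale t ^ (-(1 - μ)) • P.reducedForce h0 z t)) := by
    simp [reducedField, bcfSmul_apply, decayScale_apply]
  have e2 : P.reducedVelocity h0 z t = (symbolDifference h0 (-μ) P.B z t (z.1 t)) (z.2 t)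
      + ratioScale t • (symbolDifference h0 (-1 - μ) P.Γ z t (z.1 t)) (z.2 t) (z.2 t)
      + ratioScale t • nemytskii timeScale (1 - μ - 1) (fderiv ℝ P.shift) (freePath d z.2) t
        (P.reducedForce h0 z t) := rfl
  rw [e1, e2, symbolDifference_apply h0 h1 P.symbol_B hz, symbolDifference_apply h0 h1 P.symbol_Γ hz,
    P.reducedForce_apply h0 h1 hz, nemytskii_apply continuous_timeScale one_le_timeScale
    (P.isSymbol_shift h0 h1).fderiv (freePath_mem hz), timeScale_smul_freePath, ratioScale_apply,
    accel]
  set x := |t| • z.2 t + timeScale t ^ (1 - μ) • z.1 t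
  have r1 : timeScale t ^ (μ - -μ) = timeScale t ^ (2 * μ) := by congr 1; ring
  have r2 : |t| / timeScale t * timeScale t ^ (μ - (-1 - μ)) = timeScale t ^ (2 * μ) * |t| := by
    rw [show μ - (-1 - μ) = 2 * μ + 1 by ring, Real.rpow_add_one hτ.ne']
    field_simp
  have r3 : |t| / timeScale t * (timeScale t ^ (1 + μ) * timeScale t ^ (-(1 - μ - 1)))
      = timeScale t ^ (2 * μ) * |t| := by
    rw [← Real.rpow_add hτ, show 1 + μ + -(1 - μ - 1) = 2 * μ + 1 by ring,
      Real.rpow_add_one hτ.ne']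
    field_simp
  have r4 : timeScale t ^ (-(1 - μ)) * timeScale t ^ (1 + μ) = timeScale t ^ (2 * μ) := by
    rw [← Real.rpow_add hτ]
    congr 1
    ring
  simp only [smul_apply, map_smul, smul_smul, Prod.smul_mk, smul_add, smul_neg, r1, r2, r3, r4]

end Reduced

section Transformed

/-- The deviation from the free motion, rescaled. -/
noncomputable def deviation (h1 : μ < 1) (u : ℝ →ᵇ Phase d) : ℝ →ᵇ Space d :=
  bcfSmul (Space d) (decayScale (1 - μ) (sub_nonneg.2 h1.le))
      ((ContinuousLinearMap.fst ℝ (Space d) (Space d)).compLeftContinuousBounded ℝ u)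
    + nemytskii timeScale (1 - μ) P.shift (freePath d
      ((ContinuousLinearMap.snd ℝ (Space d) (Space d)).compLeftContinuousBounded ℝ u))

/-- Paths in asymptotic coordinates with momentum away from zero. -/
def admissible (d : ℕ) : Set (ℝ →ᵇ Phase d) :=
  {u | (ContinuousLinearMap.snd ℝ (Space d) (Space d)).compLeftContinuousBounded ℝ u
    ∈ awayFromZero d timeScale}

theorem isOpen_admissible : IsOpen (admissible d) :=
  (isOpen_awayFromZero timeScale).preimage
    ((ContinuousLinearMap.snd ℝ (Space d) (Space d)).compLeftContinuousBounded ℝ).continuous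

/-- The rescaled vector field along a path in asymptotic coordinates. -/
noncomputable def transformed (h0 : 0 < μ) (h1 : μ < 1) (u : ℝ →ᵇ Phase d) : ℝ →ᵇ Phase d :=
  P.reducedField h0 h1 (P.deviation h1 u,
    (ContinuousLinearMap.snd ℝ (Space d) (Space d)).compLeftContinuousBounded ℝ u)

theorem contDiffAt_transformed (h0 : 0 < μ) (h1 : μ < 1) {u : ℝ →ᵇ Phase d}
    (hu : u ∈ admissible d) : ContDiffAt ℝ ∞ (P.transformed h0 h1) u := by
  have e1 : ContDiffAt ℝ ∞ (fun u : ℝ →ᵇ Phase d =>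
      (ContinuousLinearMap.snd ℝ (Space d) (Space d)).compLeftContinuousBounded ℝ u) u :=
    ContinuousLinearMap.contDiff _ |>.contDiffAt
  have e2 : ContDiffAt ℝ ∞ (fun u : ℝ →ᵇ Phase d =>
      (ContinuousLinearMap.fst ℝ (Space d) (Space d)).compLeftContinuousBounded ℝ u) u :=
    ContinuousLinearMap.contDiff _ |>.contDiffAt
  have e3 := (contDiffAt_nemytskii continuous_timeScale one_le_timeScale (P.isSymbol_shift h0 h1)
    (freePath_mem hu)).comp u (contDiffAt_clm_comp (freePath d) e1)
  exact ContDiffAt.comp u (P.contDiffAt_reducedField h0 h1 (z := (P.deviation h1 u, _)) hu)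
    (((contDiffAt_clm_comp _ e2).add e3).prodMk e1)

theorem deviation_apply (h0 : 0 < μ) (h1 : μ < 1) {u : ℝ →ᵇ Phase d} (hu : u ∈ admissible d)
    (t : ℝ) : |t| • (u t).2 + timeScale t ^ (1 - μ) • P.deviation h1 u t
      = P.position |t| (u t) := by
  have hτ := timeScale_pos t
  have e1 : P.deviation h1 u t = timeScale t ^ (-(1 - μ)) • (u t).1 +
      nemytskii timeScale (1 - μ) P.shift (freePath d
      ((ContinuousLinearMap.snd ℝ (Space d) (Space d)).compLeftContinuousBounded ℝ u)) t := rfl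
  rw [e1, nemytskii_apply continuous_timeScale one_le_timeScale (P.isSymbol_shift h0 h1)
    (freePath_mem hu), timeScale_smul_freePath, smul_add, smul_smul, smul_smul,
    ← Real.rpow_add hτ, add_neg_cancel, Real.rpow_zero, one_smul, one_smul, position]
  exact add_left_comm _ _ _

theorem transformed_apply (h0 : 0 < μ) (h1 : μ < 1) {u : ℝ →ᵇ Phase d} (hu : u ∈ admissible d)
    (t : ℝ) : P.transformed h0 h1 u t = timeScale t ^ (2 * μ) •
      P.accel |t| (P.position |t| (u t)) (u t).2 := by
  have h2 := P.reducedField_apply h0 h1 (z := (P.deviation h1 u,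
    (ContinuousLinearMap.snd ℝ (Space d) (Space d)).compLeftContinuousBounded ℝ u)) hu t
  refine h2.trans (congrArg (fun x => timeScale t ^ (2 * μ) • P.accel |t| x (u t).2) ?_)
  exact P.deviation_apply h0 h1 hu t

end Transformed

end Perturbation

/-- The integrable weight `(1 + |t|)^{-2μ}`. -/
noncomputable def dollardWeight {μ : ℝ} (hμ : 1 / 2 < μ) : TimeWeight where
  toFun t := timeScale t ^ (-(2 * μ))
  continuous := continuous_timeScale.rpow_const fun t => Or.inl (timeScale_pos t).ne'
  nonneg t := Real.rpow_nonneg (timeScale_pos t).le _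
  integrable := by
    have h := integrable_one_add_norm (E := ℝ) (μ := MeasureTheory.volume) (r := 2 * μ)
      (by simp; linarith)
    exact h

theorem dollardWeight_apply {μ : ℝ} (hμ : 1 / 2 < μ) (t : ℝ) :
    (dollardWeight hμ).toFun t = timeScale t ^ (-(2 * μ)) := rfl

theorem Perturbation.dollardWeight_smul_transformed {d : ℕ} {μ : ℝ} (P : Perturbation d μ)
    (hμ : 1 / 2 < μ) (h0 : 0 < μ) (h1 : μ < 1) {u : ℝ →ᵇ Phase d} (hu : u ∈ admissible d) (t : ℝ) :
    (dollardWeight hμ).toFun t • P.transformed h0 h1 u t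
      = P.accel |t| (P.position |t| (u t)) (u t).2 := by
  rw [dollardWeight_apply, P.transformed_apply h0 h1 hu, smul_smul,
    ← Real.rpow_add (timeScale_pos t), neg_add_cancel, Real.rpow_zero, one_smul]

namespace Perturbation

variable {d : ℕ} {μ : ℝ} (P : Perturbation d μ) {c : ℝ → Phase d}

/-! ### Linear escape and boundedness in asymptotic coordinates. -/

section Trajectories

theorem energy_eq (hc : ∀ t, HasDerivAt c (P.field (c t)) t) (t t' : ℝ) :
    P.energy (c t).1 (c t).2 = P.energy (c t').1 (c t').2 :=
  P.energy_eq_of_hasDerivAt (s := fun _ => 1) (fun t => by simpa using hc t) t t'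

/-- The energy is conserved and comparable to |ξ|² from both sides. -/
theorem exists_norm_momentum_bounds (h0 : 0 < μ) (hc : ∀ t, HasDerivAt c (P.field (c t)) t)
    (hξ : (c 0).2 ≠ 0) : ∃ m > 0, ∃ M > 0, ∀ t, m ≤ ‖(c t).2‖ ∧ ‖(c t).2‖ ≤ M := by
  obtain ⟨κ, hκ, hE⟩ := P.exists_energy_ge h0
  obtain ⟨C, hC0, hC⟩ := P.exists_norm_B_le h0
  set E := P.energy (c 0).1 (c 0).2 with hEdef
  have hEpos : 0 < E := lt_of_lt_of_le (by have := norm_pos_iff.2 hξ; positivity) (hE _ _)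
  have hEt : ∀ t, P.energy (c t).1 (c t).2 = E := fun t => P.energy_eq hc t 0
  have hup : ∀ t, E ≤ (1 + C) * ‖(c t).2‖ ^ 2 := fun t => by
    rw [← hEt t, energy, inner_add_left, real_inner_self_eq_norm_sq]
    have h1 : ⟪P.B (c t).1 (c t).2, (c t).2⟫_ℝ ≤ C * ‖(c t).2‖ ^ 2 := by
      refine (real_inner_le_norm _ _).trans ?_
      rw [sq, ← mul_assoc]
      gcongr
      exact ((P.B _).le_opNorm _).trans (by gcongr; exact hC _)
    nlinarith [sq_nonneg ‖(c t).2‖]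
  refine ⟨√(E / (1 + C)), by positivity, √(E / κ), by positivity, fun t => ⟨?_, ?_⟩⟩
  · refine (Real.sqrt_le_left (norm_nonneg _)).2 ?_
    rw [div_le_iff₀ (by positivity), mul_comm]
    exact hup t
  · refine Real.le_sqrt_of_sq_le ?_
    rw [le_div_iff₀ hκ, mul_comm, ← hEt t]
    exact hE _ _

theorem hasDerivAt_inner (hc : ∀ t, HasDerivAt c (P.field (c t)) t) (t : ℝ) :
    HasDerivAt (fun t => ⟪(c t).1, (c t).2⟫_ℝ)
      (2 * P.energy (c t).1 (c t).2 - ⟪(c t).1, P.Γ (c t).1 (c t).2 (c t).2⟫_ℝ) t := by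
  have hx : HasDerivAt (fun t => (c t).1) ((c t).2 + P.B (c t).1 (c t).2) t :=
    (hasFDerivAt_fst.comp_hasDerivAt t (hc t) :)
  have hξ : HasDerivAt (fun t => (c t).2) (-(P.Γ (c t).1 (c t).2 (c t).2)) t :=
    (hasFDerivAt_snd.comp_hasDerivAt t (hc t) :)
  refine (hx.inner ℝ hξ).congr_deriv ?_
  rw [inner_neg_right, energy]
  ring

theorem norm_Γ_apply_le {x ξ : Space d} {C M : ℝ} (hC : ‖P.Γ x‖ ≤ C) (hM : ‖ξ‖ ≤ M) :
    ‖P.Γ x ξ ξ‖ ≤ C * M ^ 2 := by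
  have hC0 := (norm_nonneg (P.Γ x)).trans hC
  have hM0 := (norm_nonneg _).trans hM
  refine ((P.Γ x).le_opNorm₂ ξ ξ).trans ?_
  rw [sq, ← mul_assoc]
  gcongr

/-- Escaping trajectories escape at a linear rate. -/
theorem exists_mul_le_bracket (h0 : 0 < μ) (hc : ∀ t, HasDerivAt c (P.field (c t)) t)
    (hξ : (c 0).2 ≠ 0) (hx : Tendsto (fun t => ‖(c t).1‖) atTop atTop) :
    ∃ κ > 0, ∀ t, 0 ≤ t → κ * timeScale t ≤ bracket (c t).1 := by
  obtain ⟨m, hm, M, hM, hmM⟩ := P.exists_norm_momentum_bounds h0 hc hξ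
  obtain ⟨κ, hκ, hE⟩ := P.exists_energy_ge h0
  obtain ⟨C, hC0, hC⟩ := P.symbol_Γ.exists_norm_le
  set E := P.energy (c 0).1 (c 0).2 with hEdef
  have hEpos : 0 < E := lt_of_lt_of_le (by have := norm_pos_iff.2 hξ; positivity) (hE _ _)
  have hEt : ∀ t, P.energy (c t).1 (c t).2 = E := fun t => P.energy_eq hc t 0
  have h1 : Tendsto (fun t => C * M ^ 2 * bracket (c t).1 ^ (-μ)) atTop (𝓝 0) := by
    simpa using ((tendsto_bracket_rpow_neg h0).comp (tendsto_comap_iff.2 hx)).const_mul (C * M ^ 2)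
  -- After T the error in the derivative 2E - ⟪x, Γ(ξ, ξ)⟫ of ⟪x, ξ⟫ is below E, so the derivative
  -- is at least E.
  obtain ⟨T, hT⟩ := eventually_atTop.1 (h1.eventually (gt_mem_nhds hEpos))
  set G := fun t => ⟪(c t).1, (c t).2⟫_ℝ with hG
  have hGd := P.hasDerivAt_inner hc
  have hder : ∀ t, T ≤ t → E ≤ deriv G t := fun t ht => by
    rw [(hGd t).deriv, hEt]
    have hb := bracket_pos (c t).1
    have h2 : ⟪(c t).1, P.Γ (c t).1 (c t).2 (c t).2⟫_ℝ ≤ C * M ^ 2 * bracket (c t).1 ^ (-μ) := by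
      refine (real_inner_le_norm _ _).trans ?_
      have h3 := P.norm_Γ_apply_le (hC (c t).1) (hmM t).2
      calc ‖(c t).1‖ * ‖P.Γ (c t).1 (c t).2 (c t).2‖
          ≤ bracket (c t).1 * (C * bracket (c t).1 ^ (-1 - μ) * M ^ 2) := by
            gcongr
            exact norm_le_bracket _
        _ = C * M ^ 2 * (bracket (c t).1 ^ (-1 - μ + 1)) := by
            rw [Real.rpow_add_one hb.ne']
            ring
        _ = _ := by
            congr 2
            ring
    have := hT t ht
    linarith
  have hmv : ∀ t, T ≤ t → E * (t - T) ≤ G t - G T := fun t ht =>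
    (convex_Ici T).mul_sub_le_image_sub_of_le_deriv
      (fun t _ => (hGd t).continuousAt.continuousWithinAt)
      (fun t _ => (hGd t).differentiableAt.differentiableWithinAt)
      (fun t ht => hder t (interior_subset ht)) T Set.self_mem_Ici t ht ht
  have hGle : ∀ t, G t ≤ bracket (c t).1 * M := fun t => by
    refine (real_inner_le_norm _ _).trans ?_
    exact mul_le_mul (norm_le_bracket _) (hmM t).2 (norm_nonneg _) (bracket_pos _).le
  obtain ⟨S, hS⟩ : ∃ S, 0 < S ∧ ∀ t, S ≤ t → T ≤ t ∧ E / 2 * (1 + t) ≤ G T + E * (t - T) := by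
    refine ⟨max 1 (max T ((E / 2 + E * T - G T) / (E / 2))), by positivity, fun t ht => ⟨?_, ?_⟩⟩
    · exact (le_max_left _ _).trans ((le_max_right _ _).trans ht)
    · have h4 : (E / 2 + E * T - G T) / (E / 2) ≤ t :=
        (le_max_right _ _).trans ((le_max_right _ _).trans ht)
      rw [div_le_iff₀ (by positivity)] at h4
      linarith
  -- The first constant serves after S, where ⟪x, ξ⟫ ≤ M ⟨x⟩ grows linearly; the second serves
  -- before S, where ⟨x⟩ ≥ 1 is enough.
  refine ⟨min (E / 2 / M) (1 / (1 + S)), by have := hS.1; positivity, fun t ht => ?_⟩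
  rw [timeScale, abs_of_nonneg ht]
  rcases le_or_gt S t with h5 | h5
  · have h6 := hS.2 t h5
    have h7 := hmv t h6.1
    have h8 := hGle t
    calc min (E / 2 / M) (1 / (1 + S)) * (1 + t) ≤ E / 2 / M * (1 + t) := by
          gcongr
          exact min_le_left _ _
      _ = E / 2 * (1 + t) / M := by ring
      _ ≤ bracket (c t).1 := by
          rw [div_le_iff₀ hM]
          linarith
  · have := hS.1
    calc min (E / 2 / M) (1 / (1 + S)) * (1 + t) ≤ 1 / (1 + S) * (1 + S) := by
          gcongr
          exact min_le_right _ _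
      _ = 1 := by field_simp
      _ ≤ _ := one_le_bracket _

/-- The derivative of x - tξ is Bξ + tΓ(ξ, ξ), which linear escape makes O(τ^{-μ}); its integral is
O(τ^{1-μ}). -/
theorem exists_norm_deviation_le (h0 : 0 < μ) (h1 : μ < 1)
    (hc : ∀ t, HasDerivAt c (P.field (c t)) t)
    (hξ : (c 0).2 ≠ 0) (hx : Tendsto (fun t => ‖(c t).1‖) atTop atTop) :
    ∃ K, ∀ t, 0 ≤ t → ‖(c t).1 - t • (c t).2‖ ≤ K * timeScale t ^ (1 - μ) := by
  obtain ⟨m, hm, M, hM, hmM⟩ := P.exists_norm_momentum_bounds h0 hc hξ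
  obtain ⟨κ, hκ, hlin⟩ := P.exists_mul_le_bracket h0 hc hξ hx
  obtain ⟨C₁, hC₁0, hC₁⟩ := P.symbol_B.exists_norm_le
  obtain ⟨C₂, hC₂0, hC₂⟩ := P.symbol_Γ.exists_norm_le
  set L := C₁ * κ ^ (-μ) * M + C₂ * κ ^ (-1 - μ) * M ^ 2 with hL
  have hL0 : 0 ≤ L := by positivity
  have hdec : ∀ p : ℝ, p ≤ 0 → ∀ t, 0 ≤ t → bracket (c t).1 ^ p ≤ κ ^ p * timeScale t ^ p := by
    intro p hp t ht
    have h2 := timeScale_pos t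
    rw [← Real.mul_rpow hκ.le h2.le]
    exact Real.rpow_le_rpow_of_nonpos (by positivity) (hlin t ht) hp
  have hd : ∀ t, HasDerivAt (fun t => (c t).1 - t • (c t).2)
      (P.B (c t).1 (c t).2 + t • P.Γ (c t).1 (c t).2 (c t).2) t := by
    intro t
    have hx : HasDerivAt (fun t => (c t).1) ((c t).2 + P.B (c t).1 (c t).2) t :=
      (hasFDerivAt_fst.comp_hasDerivAt t (hc t) :)
    have hξ : HasDerivAt (fun t => (c t).2) (-(P.Γ (c t).1 (c t).2 (c t).2)) t :=
      (hasFDerivAt_snd.comp_hasDerivAt t (hc t) :)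
    refine (hx.sub ((hasDerivAt_id t).smul hξ)).congr_deriv ?_
    simp only [id, one_smul, smul_neg]
    abel
  have hbound : ∀ t, 0 ≤ t → ‖P.B (c t).1 (c t).2 + t • P.Γ (c t).1 (c t).2 (c t).2‖
      ≤ L * timeScale t ^ (-μ) := by
    intro t ht
    have h2 := timeScale_pos t
    have h3 : ‖P.B (c t).1 (c t).2‖ ≤ C₁ * (κ ^ (-μ) * timeScale t ^ (-μ)) * M :=
      ((P.B _).le_opNorm _).trans (mul_le_mul ((hC₁ _).trans
        (mul_le_mul_of_nonneg_left (hdec _ (by linarith) t ht) hC₁0)) (hmM t).2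
        (norm_nonneg _) (by positivity))
    have h4 : ‖P.Γ (c t).1 (c t).2 (c t).2‖
        ≤ C₂ * (κ ^ (-1 - μ) * timeScale t ^ (-1 - μ)) * M ^ 2 :=
      P.norm_Γ_apply_le ((hC₂ _).trans
        (mul_le_mul_of_nonneg_left (hdec _ (by linarith) t ht) hC₂0)) (hmM t).2
    have h5 : timeScale t * timeScale t ^ (-1 - μ) = timeScale t ^ (-μ) := by
      rw [mul_comm, ← Real.rpow_add_one h2.ne']
      congr 1
      ring
    have h6 : t ≤ timeScale t := by
      rw [timeScale, abs_of_nonneg ht]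
      linarith
    calc _ ≤ ‖P.B (c t).1 (c t).2‖ + t * ‖P.Γ (c t).1 (c t).2 (c t).2‖ := by
          refine (norm_add_le _ _).trans ?_
          rw [norm_smul, Real.norm_of_nonneg ht]
      _ ≤ C₁ * (κ ^ (-μ) * timeScale t ^ (-μ)) * M
          + timeScale t * (C₂ * (κ ^ (-1 - μ) * timeScale t ^ (-1 - μ)) * M ^ 2) := by
          gcongr
      _ = C₁ * (κ ^ (-μ) * timeScale t ^ (-μ)) * M
          + C₂ * κ ^ (-1 - μ) * M ^ 2 * (timeScale t * timeScale t ^ (-1 - μ)) := by ring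
      _ = _ := by
          rw [h5, hL]
          ring
  have hμ1 : 0 < 1 - μ := by linarith
  -- This multiple of (1 + t)^{1-μ} dominates at t = 0, and its derivative is at least L (1 +
  -- t)^{-μ}.
  refine ⟨‖(c 0).1‖ + L / (1 - μ), fun t ht => ?_⟩
  have hB : ∀ s, 0 ≤ s → HasDerivAt (fun t : ℝ => (‖(c 0).1‖ + L / (1 - μ)) * (1 + t) ^ (1 - μ))
      ((‖(c 0).1‖ + L / (1 - μ)) * (1 * (1 - μ) * (1 + s) ^ (1 - μ - 1))) s := fun s hs =>
    (((hasDerivAt_id s).const_add 1).rpow_const (Or.inl (by simp; linarith))).const_mul _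
  have key := image_norm_le_of_norm_deriv_right_le_deriv_boundary'
    (f := fun t => (c t).1 - t • (c t).2) (a := 0) (b := t)
    (fun t _ => (hd t).continuousAt.continuousWithinAt) (fun t _ => (hd t).hasDerivWithinAt)
    (B := fun t => (‖(c 0).1‖ + L / (1 - μ)) * (1 + t) ^ (1 - μ)) (by simp; positivity)
    (fun s hs => (hB s hs.1).continuousAt.continuousWithinAt)
    (fun s hs => (hB s hs.1).hasDerivWithinAt) (fun s hs => (hbound s hs.1).trans ?_)
    (show t ∈ Set.Icc 0 t from ⟨ht, le_rfl⟩)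
  · rwa [timeScale, abs_of_nonneg ht]
  · rw [timeScale, abs_of_nonneg hs.1, show 1 - μ - 1 = -μ by ring, one_mul, ← mul_assoc]
    refine mul_le_mul_of_nonneg_right ?_ (Real.rpow_nonneg (by linarith [hs.1]) _)
    rw [add_mul, div_mul_cancel₀ _ hμ1.ne']
    have := mul_nonneg (norm_nonneg (c 0).1) hμ1.le
    linarith

/-- The asymptotic coordinates of a point of the phase space. -/
noncomputable def asymptotic (t : ℝ) (z : Phase d) : Phase d :=
  (z.1 - (t • z.2 + P.shift (t • z.2)), z.2)

theorem position_asymptotic (t : ℝ) (z : Phase d) : P.position t (P.asymptotic t z) = z.1 :=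
  sub_add_cancel _ _

theorem asymptotic_position (t : ℝ) (z : Phase d) : P.asymptotic t (P.position t z, z.2) = z :=
  Prod.ext (add_sub_cancel_right _ _) rfl

theorem asymptotic_injective (t : ℝ) : Function.Injective (P.asymptotic t) := by
  intro z z' h
  have h2 : z.2 = z'.2 := (Prod.ext_iff.1 h).2
  refine Prod.ext ?_ h2
  rw [← P.position_asymptotic t z, h, position_asymptotic]

theorem hasDerivAt_of_transformed (hμ : 1 / 2 < μ) (h0 : 0 < μ) (h1 : μ < 1) {v : ℝ →ᵇ Phase d}
    (hv : v ∈ admissible d) {t : ℝ} (ht : 0 < t)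
    (h : HasDerivAt v ((dollardWeight hμ).toFun t • P.transformed h0 h1 v t) t) :
    HasDerivAt (fun t => (P.position t (v t), (v t).2))
      (P.field (P.position t (v t), (v t).2)) t := by
  rw [P.dollardWeight_smul_transformed hμ h0 h1 hv, abs_of_pos ht] at h
  exact P.hasDerivAt_of_asymptotic h0 h1 ht.ne' h

/-- The path of an escaping trajectory in asymptotic coordinates is bounded. -/
theorem exists_asymptotic_path (hμ : 1 / 2 < μ) (h0 : 0 < μ) (h1 : μ < 1)
    (hc : ∀ t, HasDerivAt c (P.field (c t)) t)
    (hξ : (c 0).2 ≠ 0) (hx : Tendsto (fun t => ‖(c t).1‖) atTop atTop) :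
    ∃ u ∈ admissible d, (∀ t, u t = P.asymptotic (max t 0) (c (max t 0))) ∧
      ∀ t, 0 < t → HasDerivAt u ((dollardWeight hμ).toFun t • P.transformed h0 h1 u t) t := by
  obtain ⟨m, hm, M, hM, hmM⟩ := P.exists_norm_momentum_bounds h0 hc hξ
  obtain ⟨K, hK⟩ := P.exists_norm_deviation_le h0 h1 hc hξ hx
  have hcc : Continuous c := continuous_iff_continuousAt.2 fun t => (hc t).continuousAt
  have hmax : Continuous fun t : ℝ => max t 0 := continuous_id.max continuous_const
  let ξ : ℝ →ᵇ Space d := BoundedContinuousFunction.ofNormedAddCommGroup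
    (fun t => (c (max t 0)).2) (continuous_snd.comp (hcc.comp hmax)) M (fun t => (hmM _).2)
  let q : ℝ →ᵇ Space d := BoundedContinuousFunction.ofNormedAddCommGroup
    (fun t => timeScale (max t 0) ^ (-(1 - μ)) • ((c (max t 0)).1 - max t 0 • (c (max t 0)).2))
    ((((continuous_timeScale.comp hmax).rpow_const fun t => Or.inl (timeScale_pos _).ne')).smul
      ((continuous_fst.comp (hcc.comp hmax)).sub (hmax.smul (continuous_snd.comp (hcc.comp hmax)))))
    K (fun t => by
      have hτ := timeScale_pos (max t 0)
      rw [norm_smul, Real.norm_of_nonneg (Real.rpow_nonneg hτ.le _), mul_comm,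
        Real.rpow_neg hτ.le, ← div_eq_mul_inv, div_le_iff₀ (Real.rpow_pos_of_pos hτ _)]
      exact hK _ (le_max_right _ _))
  have hξmem : ξ ∈ awayFromZero d timeScale := ⟨m, hm, fun t => by
    have h2 := inv_pos.2 (timeScale_pos t)
    have h3 : m ≤ ‖ξ t‖ := (hmM _).1
    linarith⟩
  -- The reduced field takes the rescaled deviation as its variable, which is already known to be
  -- bounded. So g is bounded before the asymptotic position is, and the boundedness of u follows by
  -- integration.
  set g := P.reducedField h0 h1 (q, ξ) with hg
  have hgt : ∀ t, 0 < t → HasDerivAt (fun t => P.asymptotic t (c t))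
      ((dollardWeight hμ).toFun t • g t) t := by
    intro t ht
    have hτ := timeScale_pos t
    have h2 : |t| • ξ t + timeScale t ^ (1 - μ) • q t = (c t).1 := by
      have e1 : ξ t = (c (max t 0)).2 := rfl
      have e2 : q t = timeScale (max t 0) ^ (-(1 - μ)) •
        ((c (max t 0)).1 - max t 0 • (c (max t 0)).2) := rfl
      rw [e1, e2, max_eq_left ht.le, abs_of_pos ht, smul_smul, ← Real.rpow_add hτ,
        add_neg_cancel, Real.rpow_zero, one_smul, add_sub_cancel]
    have e3 : ξ t = (c t).2 := by
      change (c (max t 0)).2 = _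
      rw [max_eq_left ht.le]
    rw [dollardWeight_apply, hg, P.reducedField_apply h0 h1 (z := (q, ξ)) hξmem, smul_smul,
      ← Real.rpow_add hτ, neg_add_cancel, Real.rpow_zero, one_smul, h2, e3, abs_of_pos ht]
    exact P.hasDerivAt_asymptotic h0 h1 ht.ne' (hc t)
  have hac : Continuous fun t => P.asymptotic t (c t) := by
    have h2 := (P.isSymbol_shift h0 h1).contDiff.continuous
    unfold asymptotic
    fun_prop
  set u : ℝ →ᵇ Phase d := bcfConst ℝ (Phase d) (P.asymptotic 0 (c 0))
    + (dollardWeight hμ).forward (Phase d) 0 g with hu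
  have hut : ∀ t, u t = P.asymptotic (max t 0) (c (max t 0)) := by
    intro t
    have h2 := intervalIntegral.integral_eq_sub_of_hasDerivAt_of_le (le_max_right t 0)
      hac.continuousOn (fun s hs => hgt s hs.1)
      ((dollardWeight hμ).integrable_smul g).intervalIntegrable
    have h3 : u t = P.asymptotic 0 (c 0) + (dollardWeight hμ).forward (Phase d) 0 g t := rfl
    rw [h3, TimeWeight.forward_apply, h2, add_sub_cancel]
  have hmem : u ∈ admissible d := by
    have h2 : (ContinuousLinearMap.snd ℝ (Space d) (Space d)).compLeftContinuousBounded ℝ u = ξ := by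
      ext1 t
      exact congrArg Prod.snd (hut t)
    exact (congrArg (· ∈ awayFromZero d timeScale) h2).mpr hξmem
  refine ⟨u, hmem, hut, fun t ht => ?_⟩
  have h2 : P.position |t| (u t) = (c t).1 ∧ (u t).2 = (c t).2 := by
    rw [hut, max_eq_left ht.le, abs_of_pos ht]
    exact ⟨P.position_asymptotic _ _, rfl⟩
  rw [P.dollardWeight_smul_transformed hμ h0 h1 hmem, h2.1, h2.2, abs_of_pos ht]
  refine (P.hasDerivAt_asymptotic h0 h1 ht.ne' (hc t)).congr_of_eventuallyEq ?_
  filter_upwards [lt_mem_nhds ht] with s hs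
  rw [hut, max_eq_left hs.le]
  rfl

end Trajectories

end Perturbation

/-! ### Asymptotic data and the wave map. -/

/-- The path `u` stopped at the time `T` in the past. -/
noncomputable def delay {E : Type} [NormedAddCommGroup E] [NormedSpace ℝ E] (T : ℝ) :
    (ℝ →ᵇ E) →L[ℝ] (ℝ →ᵇ E) :=
  bcfComp E ⟨fun t => max t T, continuous_id.max continuous_const⟩

theorem delay_apply {E : Type} [NormedAddCommGroup E] [NormedSpace ℝ E] (T : ℝ) (u : ℝ →ᵇ E)
    (t : ℝ) : delay T u t = u (max t T) := rfl

theorem tendsto_delay {E : Type} [NormedAddCommGroup E] [NormedSpace ℝ E] {u : ℝ →ᵇ E} {z : E}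
    (h : Tendsto u atTop (𝓝 z)) : Tendsto (fun T => delay T u) atTop (𝓝 (bcfConst ℝ E z)) := by
  rw [Metric.tendsto_atTop] at h ⊢
  intro ε hε
  obtain ⟨T₀, hT₀⟩ := h (ε / 2) (half_pos hε)
  refine ⟨T₀, fun T hT => lt_of_le_of_lt ?_ (half_lt_self hε)⟩
  exact (BoundedContinuousFunction.dist_le (half_pos hε).le).2 fun t =>
    (hT₀ _ (hT.le.trans (le_max_right t T))).le

namespace Perturbation

variable {d : ℕ} {μ : ℝ} (P : Perturbation d μ) {c : ℝ → Phase d} {w : Phase d}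

section WaveMap

theorem bcfConst_mem_admissible (hw : w.2 ≠ 0) : bcfConst ℝ (Phase d) w ∈ admissible d :=
  ⟨‖w.2‖, norm_pos_iff.2 hw, fun t => le_add_of_nonneg_left (inv_nonneg.2 (timeScale_pos t).le)⟩

theorem snd_ne_zero_of_tendsto {u : ℝ →ᵇ Phase d} (hu : u ∈ admissible d)
    (h : Tendsto u atTop (𝓝 w)) : w.2 ≠ 0 := by
  obtain ⟨κ, hκ, hle⟩ := hu
  have h1 : Tendsto (fun t => (timeScale t)⁻¹ + ‖(u t).2‖) atTop (𝓝 (0 + ‖w.2‖)) := by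
    refine Tendsto.add ?_ ((continuous_snd.tendsto w).comp h).norm
    refine tendsto_inv_atTop_zero.comp (tendsto_atTop_mono (fun t => ?_) tendsto_id)
    simp only [timeScale, id]
    linarith [le_abs_self t]
  have h2 : κ ≤ 0 + ‖w.2‖ := ge_of_tendsto h1 (Eventually.of_forall hle)
  rw [zero_add] at h2
  exact norm_pos_iff.1 (hκ.trans_le h2)

/-- Zero initial momentum means zero energy, hence zero momentum at all times and in the limit. -/
theorem momentum_ne_zero (h0 : 0 < μ) (hc : ∀ t, HasDerivAt c (P.field (c t)) t)
    (h : Tendsto (fun t => P.asymptotic t (c t)) atTop (𝓝 w)) (hw : w.2 ≠ 0) : (c 0).2 ≠ 0 := by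
  intro h1
  obtain ⟨κ, hκ, hE⟩ := P.exists_energy_ge h0
  refine hw (tendsto_nhds_unique ((continuous_snd.tendsto w).comp h)
    (tendsto_const_nhds.congr fun t => ?_))
  have h2 := hE (c t).1 (c t).2
  rw [P.energy_eq hc t 0, h1, energy, inner_zero_right, mul_zero] at h2
  have h3 : ‖(c t).2‖ ^ 2 ≤ 0 := nonpos_of_mul_nonpos_right h2 hκ
  exact (norm_eq_zero.1 (pow_eq_zero_iff two_ne_zero |>.1 (le_antisymm h3 (sq_nonneg _)))).symm

theorem transformed_congr (h0 : 0 < μ) (h1 : μ < 1) : ∀ u ∈ admissible d, ∀ v ∈ admissible d,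
    ∀ t, u t = v t → P.transformed h0 h1 u t = P.transformed h0 h1 v t := by
  intro u hu v hv t h
  rw [P.transformed_apply h0 h1 hu, P.transformed_apply h0 h1 hv, h]

variable (hμ : 1 / 2 < μ) (h0 : 0 < μ) (h1 : μ < 1)

/-- The transformed Hamilton equations on `(T, ∞)` for a path in asymptotic coordinates. -/
def IsSolution (T : ℝ) (u : ℝ →ᵇ Phase d) : Prop :=
  ∀ t, T < t → HasDerivAt u ((dollardWeight hμ).toFun t • P.transformed h0 h1 u t) t

variable {hμ h0 h1}

theorem isSolution_of_eq_forward {u : ℝ →ᵇ Phase d} {z : Phase d} {T : ℝ}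
    (h : u = bcfConst ℝ (Phase d) z
      + (dollardWeight hμ).forward (Phase d) T (P.transformed h0 h1 u)) :
    P.IsSolution hμ h0 h1 T u := by
  intro t ht
  have h2 := ((dollardWeight hμ).hasDerivAt_forward (P.transformed h0 h1 u) ht).const_add z
  exact h2.congr_of_eventuallyEq (Eventually.of_forall fun s => DFunLike.congr_fun h s)

theorem isSolution_of_eq_backward {u : ℝ →ᵇ Phase d} {z : Phase d} {T : ℝ}
    (h : u = bcfConst ℝ (Phase d) z
      + (dollardWeight hμ).backward (Phase d) T (P.transformed h0 h1 u)) :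
    P.IsSolution hμ h0 h1 T u := by
  intro t ht
  have h2 := ((dollardWeight hμ).hasDerivAt_backward (P.transformed h0 h1 u) ht).const_add z
  exact h2.congr_of_eventuallyEq (Eventually.of_forall fun s => DFunLike.congr_fun h s)

theorem tendsto_of_eq_forward {u g : ℝ →ᵇ Phase d} {z : Phase d} {T : ℝ}
    (h : u = bcfConst ℝ (Phase d) z + (dollardWeight hμ).forward (Phase d) T g) :
    Tendsto u atTop (𝓝 (z + (dollardWeight hμ).total (Phase d) T g)) :=
  (((dollardWeight hμ).tendsto_forward T g).const_add z).congr fun t =>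
    (DFunLike.congr_fun h t).symm

theorem tendsto_of_eq_backward {u g : ℝ →ᵇ Phase d} {z : Phase d} {T : ℝ}
    (h : u = bcfConst ℝ (Phase d) z + (dollardWeight hμ).backward (Phase d) T g) :
    Tendsto u atTop (𝓝 z) := by
  have h2 := ((dollardWeight hμ).tendsto_backward T g).const_add z
  rw [add_zero] at h2
  exact h2.congr fun t => (DFunLike.congr_fun h t).symm

/-- Stopping makes the path constant before T, as the backward equation requires, and for large T
brings it uniformly close to the constant path w, where the contraction argument applies. -/
theorem delay_eq_const_add_backward {u : ℝ →ᵇ Phase d} {T : ℝ}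
    (hu : P.IsSolution hμ h0 h1 T u) (hmem : u ∈ admissible d) (hdel : delay T u ∈ admissible d)
    (h : Tendsto u atTop (𝓝 w)) :
    delay T u = bcfConst ℝ (Phase d) w
      + (dollardWeight hμ).backward (Phase d) T (P.transformed h0 h1 (delay T u)) := by
  have heq : ∀ t, T < t → delay T u t = u t := fun t ht => by
    rw [delay_apply, max_eq_left ht.le]
  refine (dollardWeight hμ).eq_const_add_backward (fun t => ?_) (fun t ht => ?_) (h.congr' ?_)
  · simp [delay_apply]
  · rw [P.transformed_congr h0 h1 _ hdel _ hmem t (heq t ht)]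
    refine (hu t ht).congr_of_eventuallyEq ?_
    filter_upwards [lt_mem_nhds ht] with s hs using heq s hs
  · filter_upwards [eventually_gt_atTop T] with t ht using (heq t ht).symm

theorem hasDerivAt_position {v : ℝ →ᵇ Phase d} {T : ℝ} (hT : 0 ≤ T) (hv : v ∈ admissible d)
    (h : P.IsSolution hμ h0 h1 T v) {t : ℝ} (ht : T < t) :
    HasDerivAt (fun t => (P.position t (v t), (v t).2))
      (P.field (P.position t (v t), (v t).2)) t :=
  P.hasDerivAt_of_transformed hμ h0 h1 hv (hT.trans_lt ht) (h t ht)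

/-- A solution in asymptotic coordinates describes the trajectory which starts at its initial
point. -/
theorem asymptotic_eq_of_isSolution {v : ℝ →ᵇ Phase d} (hv : v ∈ admissible d)
    (h : P.IsSolution hμ h0 h1 0 v) (hc : ∀ t, HasDerivAt c (P.field (c t)) t)
    (hc0 : c 0 = (P.position 0 (v 0), (v 0).2)) {t : ℝ} (ht : 0 ≤ t) :
    P.asymptotic t (c t) = v t := by
  have hcont : Continuous fun t => (P.position t (v t), (v t).2) := by
    have h2 := (P.isSymbol_shift h0 h1).contDiff.continuous
    have h3 := v.continuous
    unfold position
    fun_prop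
  rw [P.eq_of_hasDerivAt_Ioi h0 hc hcont.continuousWithinAt
    (fun t ht => P.hasDerivAt_position le_rfl hv h ht) hc0 ht]
  exact P.asymptotic_position t (v t)

theorem tendsto_asymptotic_of_isSolution {v : ℝ →ᵇ Phase d} (hv : v ∈ admissible d)
    (h : P.IsSolution hμ h0 h1 0 v) (hc : ∀ t, HasDerivAt c (P.field (c t)) t)
    (hc0 : c 0 = (P.position 0 (v 0), (v 0).2)) (hlim : Tendsto v atTop (𝓝 w)) :
    Tendsto (fun t => P.asymptotic t (c t)) atTop (𝓝 w) := by
  refine hlim.congr' ?_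
  filter_upwards [eventually_ge_atTop 0] with t ht
  exact (P.asymptotic_eq_of_isSolution hv h hc hc0 ht).symm

/-- For every `w` with nonzero momentum there is a trajectory with the asymptotic data `w`. -/
theorem exists_curve_tendsto_asymptotic (hμ : 1 / 2 < μ) (h0 : 0 < μ) (h1 : μ < 1)
    (hw : w.2 ≠ 0) :
    ∃ c : ℝ → Phase d, (∀ t, HasDerivAt c (P.field (c t)) t) ∧
      Tendsto (fun t => P.asymptotic t (c t)) atTop (𝓝 w) := by
  have hadm := bcfConst_mem_admissible hw
  obtain ⟨r, -, hr, hev⟩ := exists_forall_unique_solution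
    (dollardWeight hμ).tendsto_norm_backward isOpen_admissible hadm
    ((P.contDiffAt_transformed h0 h1 hadm).of_le (by simp))
  obtain ⟨T, ⟨⟨v, hv, hfix⟩, -⟩, hT⟩ := (hev.and (eventually_ge_atTop 0)).exists
  have hsol := P.isSolution_of_eq_backward hfix
  have hder := fun t (ht : T < t) => P.hasDerivAt_position hT (hr hv) hsol ht
  -- The fixed point solves the equation only after T, so the global trajectory is started from its
  -- value at T + 1.
  obtain ⟨c, hc0, hc⟩ := P.exists_curve h0 (P.position (T + 1) (v (T + 1)), (v (T + 1)).2)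
  have hc' : ∀ t, HasDerivAt (fun s => c (s - (T + 1))) (P.field (c (t - (T + 1)))) t :=
    fun t => (hc _).comp_sub_const t (T + 1)
  refine ⟨fun s => c (s - (T + 1)), hc', (tendsto_of_eq_backward hfix).congr' ?_⟩
  filter_upwards [eventually_gt_atTop T] with t ht
  have h2 := eqOn_Ioi_of_hasDerivAt (P.contDiff_field.of_le (by simp)) (lt_add_one T)
    (γ' := fun s => c (s - (T + 1))) hder (fun t _ => hc' t) (by simp [hc0]) ht
  rw [← h2, P.asymptotic_position]

theorem exists_path (hμ : 1 / 2 < μ) (h0 : 0 < μ) (h1 : μ < 1)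
    (hc : ∀ t, HasDerivAt c (P.field (c t)) t) (hξ : (c 0).2 ≠ 0)
    (hx : Tendsto (fun t => ‖(c t).1‖) atTop atTop) :
    ∃ u ∈ admissible d, (∀ t, u t = P.asymptotic (max t 0) (c (max t 0))) ∧
      P.IsSolution hμ h0 h1 0 u :=
  P.exists_asymptotic_path hμ h0 h1 hc hξ hx

theorem exists_tendsto_asymptotic (hμ : 1 / 2 < μ) (h0 : 0 < μ) (h1 : μ < 1)
    (hc : ∀ t, HasDerivAt c (P.field (c t)) t) (hξ : (c 0).2 ≠ 0)
    (hx : Tendsto (fun t => ‖(c t).1‖) atTop atTop) :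
    ∃ w : Phase d, w.2 ≠ 0 ∧ Tendsto (fun t => P.asymptotic t (c t)) atTop (𝓝 w) := by
  obtain ⟨u, hu, hut, hsol⟩ := P.exists_path hμ h0 h1 hc hξ hx
  have h2 := tendsto_of_eq_forward ((dollardWeight hμ).eq_const_add_forward
    (fun t => by simp [hut]) hsol)
  refine ⟨_, snd_ne_zero_of_tendsto hu h2, h2.congr' ?_⟩
  filter_upwards [eventually_ge_atTop 0] with t ht
  rw [hut, max_eq_left ht]

theorem tendsto_path {u : ℝ →ᵇ Phase d} (hut : ∀ t, u t = P.asymptotic (max t 0) (c (max t 0)))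
    (h : Tendsto (fun t => P.asymptotic t (c t)) atTop (𝓝 w)) : Tendsto u atTop (𝓝 w) := by
  refine h.congr' ?_
  filter_upwards [eventually_ge_atTop 0] with t ht
  rw [hut, max_eq_left ht]

/-- Trajectories are determined by their asymptotic data. -/
theorem eq_of_tendsto_asymptotic (hμ : 1 / 2 < μ) (h0 : 0 < μ) (h1 : μ < 1)
    (hnt : ∀ c : ℝ → Phase d, (∀ t, HasDerivAt c (P.field (c t)) t) → (c 0).2 ≠ 0 →
      Tendsto (fun t => ‖(c t).1‖) atTop atTop)
    {c' : ℝ → Phase d}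
    (hc : ∀ t, HasDerivAt c (P.field (c t)) t) (hc' : ∀ t, HasDerivAt c' (P.field (c' t)) t)
    (h : Tendsto (fun t => P.asymptotic t (c t)) atTop (𝓝 w))
    (h' : Tendsto (fun t => P.asymptotic t (c' t)) atTop (𝓝 w)) (hw : w.2 ≠ 0) : c = c' := by
  have hξ := P.momentum_ne_zero h0 hc h hw
  have hξ' := P.momentum_ne_zero h0 hc' h' hw
  obtain ⟨u, hu, hut, hsol⟩ := P.exists_path hμ h0 h1 hc hξ (hnt c hc hξ)
  obtain ⟨u', hu', hut', hsol'⟩ := P.exists_path hμ h0 h1 hc' hξ' (hnt c' hc' hξ')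
  have hlim := P.tendsto_path hut h
  have hlim' := P.tendsto_path hut' h'
  have hadm := bcfConst_mem_admissible hw
  obtain ⟨r, hr0, hr, hev⟩ := exists_forall_unique_solution
    (dollardWeight hμ).tendsto_norm_backward isOpen_admissible hadm
    ((P.contDiffAt_transformed h0 h1 hadm).of_le (by simp))
  have hball := Metric.closedBall_mem_nhds (bcfConst ℝ (Phase d) w) hr0
  -- Both stopped paths converge to the constant path w, so for a common large T they lie in the
  -- ball of uniqueness and agree at T. Uniqueness for the flow finishes.
  obtain ⟨T, ⟨⟨⟨-, huniq⟩, hT⟩, hm⟩, hm'⟩ := (((hev.and (eventually_ge_atTop 0)).and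
    ((tendsto_delay hlim).eventually hball)).and ((tendsto_delay hlim').eventually hball)).exists
  have heq := huniq _ hm _ hm'
    (P.delay_eq_const_add_backward (fun t ht => hsol t (hT.trans_lt ht)) hu (hr hm) hlim)
    (P.delay_eq_const_add_backward (fun t ht => hsol' t (hT.trans_lt ht)) hu' (hr hm') hlim')
  have h2 : u T = u' T := by
    have := DFunLike.congr_fun heq T
    rwa [delay_apply, delay_apply, max_self] at this
  rw [hut, hut', max_eq_left hT] at h2
  exact P.curve_unique hc hc' (P.asymptotic_injective T h2)

theorem contDiff_position_zero : ContDiff ℝ ∞ fun z : Phase d => (P.position 0 z, z.2) := by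
  simp only [position, zero_smul]
  fun_prop

theorem contDiff_asymptotic_zero : ContDiff ℝ ∞ (P.asymptotic 0) := by
  unfold asymptotic
  simp only [zero_smul]
  fun_prop

theorem isOpen_nonzeroMomentum : IsOpen (nonzeroMomentum d) :=
  isOpen_ne_fun continuous_snd continuous_const

/-- The limits exist and the wave map is a diffeomorphism. -/
theorem exists_waveMap (hμ : 1 / 2 < μ) (h0 : 0 < μ) (h1 : μ < 1)
    (hnt : ∀ c : ℝ → Phase d, (∀ t, HasDerivAt c (P.field (c t)) t) → (c 0).2 ≠ 0 →
      Tendsto (fun t => ‖(c t).1‖) atTop atTop) :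
    ∃ W : Phase d → Phase d, IsDiffeomorphismOf W (nonzeroMomentum d) ∧
    ∀ c : ℝ → Phase d, (∀ t, HasDerivAt c (P.field (c t)) t) → c 0 ∈ nonzeroMomentum d →
      ∀ w ∈ nonzeroMomentum d,
        W w = c 0 ↔ Tendsto (fun t => P.asymptotic t (c t)) atTop (𝓝 w) := by
  have hex : ∀ w : Phase d, ∃ z : Phase d, w.2 ≠ 0 → ∃ c : ℝ → Phase d, c 0 = z ∧
      (∀ t, HasDerivAt c (P.field (c t)) t) ∧
      Tendsto (fun t => P.asymptotic t (c t)) atTop (𝓝 w) := by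
    intro w
    by_cases hw : w.2 = 0
    · exact ⟨w, fun h => absurd hw h⟩
    · obtain ⟨c, hc, h⟩ := P.exists_curve_tendsto_asymptotic hμ h0 h1 hw
      exact ⟨c 0, fun _ => ⟨c, rfl, hc, h⟩⟩
  choose W hW using hex
  have hex' : ∀ z : Phase d, ∃ w : Phase d, z.2 ≠ 0 → w.2 ≠ 0 ∧
      ∀ c : ℝ → Phase d, (∀ t, HasDerivAt c (P.field (c t)) t) → c 0 = z →
      Tendsto (fun t => P.asymptotic t (c t)) atTop (𝓝 w) := by
    intro z
    by_cases hz : z.2 = 0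
    · exact ⟨z, fun h => absurd hz h⟩
    · obtain ⟨c, hc0, hc⟩ := P.exists_curve h0 z
      have hξ : (c 0).2 ≠ 0 := by rwa [hc0]
      obtain ⟨w, hw, h⟩ := P.exists_tendsto_asymptotic hμ h0 h1 hc hξ (hnt c hc hξ)
      refine ⟨w, fun _ => ⟨hw, fun c' hc' hc0' => ?_⟩⟩
      rwa [P.curve_unique hc' hc (hc0'.trans hc0.symm)]
  choose F hF using hex'
  have key : ∀ c : ℝ → Phase d, (∀ t, HasDerivAt c (P.field (c t)) t) → c 0 ∈ nonzeroMomentum d →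
      ∀ w ∈ nonzeroMomentum d,
        W w = c 0 ↔ Tendsto (fun t => P.asymptotic t (c t)) atTop (𝓝 w) := by
    intro c hc _ w hw
    obtain ⟨c', hc0', hc', h'⟩ := hW w hw
    constructor
    · intro h
      rwa [P.curve_unique hc hc' (h.symm.trans hc0'.symm)]
    · intro h
      rw [P.eq_of_tendsto_asymptotic hμ h0 h1 hnt hc hc' h h' hw, hc0']
  have hWmem : ∀ w ∈ nonzeroMomentum d, W w ∈ nonzeroMomentum d := by
    intro w hw
    obtain ⟨c, hc0, hc, h⟩ := hW w hw
    rw [← hc0]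
    exact P.momentum_ne_zero h0 hc h hw
  have hWF : ∀ w ∈ nonzeroMomentum d, F (W w) = w := by
    intro w hw
    obtain ⟨c, hc0, hc, h⟩ := hW w hw
    exact tendsto_nhds_unique ((hF _ (hWmem w hw)).2 c hc hc0) h
  have hFW : ∀ z ∈ nonzeroMomentum d, W (F z) = z := by
    intro z hz
    obtain ⟨c, hc0, hc⟩ := P.exists_curve h0 z
    rw [← hc0, key c hc (by rwa [hc0]) _ (by rw [hc0]; exact (hF z hz).1), hc0]
    exact (hF z hz).2 c hc hc0
  have hWs : ContDiffOn ℝ ∞ W (nonzeroMomentum d) := by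
    intro w hw
    refine ContDiffAt.contDiffWithinAt ?_
    obtain ⟨c, hc0, hc, h⟩ := hW w hw
    have hξ := P.momentum_ne_zero h0 hc h hw
    obtain ⟨u, hu, hut, hsol⟩ := P.exists_path hμ h0 h1 hc hξ (hnt c hc hξ)
    -- Near w, the wave map is the value at time 0 of the smooth family of solutions with limit y.
    -- The Volterra property allows the starting time 0, with no smallness of the integral operator.
    obtain ⟨S, hS, hSw, hev⟩ := (dollardWeight hμ).isVolterra_backward.exists_smooth_family
      isOpen_admissible (fun u hu => P.contDiffAt_transformed h0 h1 hu)
      (P.transformed_congr h0 h1) hu ((dollardWeight hμ).eq_const_add_backward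
        (fun t => by simp [hut]) hsol (P.tendsto_path hut h))
    have hS0 : ContDiffAt ℝ ∞ (fun y => (P.position 0 (S y 0), (S y 0).2)) w :=
      P.contDiff_position_zero.contDiffAt.comp w (contDiffAt_clm_comp
        (BoundedContinuousFunction.evalCLM ℝ 0 : (ℝ →ᵇ Phase d) →L[ℝ] Phase d) hS)
    refine hS0.congr_of_eventuallyEq ?_
    filter_upwards [hev, isOpen_nonzeroMomentum.mem_nhds hw] with y hy hy0
    obtain ⟨c', hc0', hc'⟩ := P.exists_curve h0 (P.position 0 (S y 0), (S y 0).2)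
    have hlim := P.tendsto_asymptotic_of_isSolution hy.1 (P.isSolution_of_eq_backward hy.2) hc' hc0'
      (tendsto_of_eq_backward hy.2)
    rw [← hc0']
    exact (key c' hc' (P.momentum_ne_zero h0 hc' hlim hy0) y hy0).2 hlim
  have hFs : ContDiffOn ℝ ∞ F (nonzeroMomentum d) := by
    intro z hz
    refine ContDiffAt.contDiffWithinAt ?_
    obtain ⟨c, hc0, hc⟩ := P.exists_curve h0 z
    have hξ : (c 0).2 ≠ 0 := by rwa [hc0]
    obtain ⟨u, hu, hut, hsol⟩ := P.exists_path hμ h0 h1 hc hξ (hnt c hc hξ)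
    have hu0 : u 0 = P.asymptotic 0 z := by rw [hut, max_self, hc0]
    have hfix := (dollardWeight hμ).eq_const_add_forward (fun t => by simp [hut]) hsol
    rw [hu0] at hfix
    obtain ⟨S, hS, hSw, hev⟩ := (dollardWeight hμ).isVolterra_forward.exists_smooth_family
      isOpen_admissible (fun u hu => P.contDiffAt_transformed h0 h1 hu)
      (P.transformed_congr h0 h1) hu hfix
    have hN := P.contDiffAt_transformed h0 h1 hu
    rw [← hSw] at hN
    -- The inverse map is the limit at infinity of the forward family: initial value plus total
    -- integral.
    have hG : ContDiffAt ℝ ∞ (fun y => y + (dollardWeight hμ).total (Phase d) 0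
        (P.transformed h0 h1 (S y))) (P.asymptotic 0 z) :=
      contDiffAt_id.add (contDiffAt_clm_comp _ (hN.comp _ hS))
    have hG' := hG.comp z P.contDiff_asymptotic_zero.contDiffAt
    refine hG'.congr_of_eventuallyEq ?_
    filter_upwards [P.contDiff_asymptotic_zero.continuous.continuousAt.eventually hev,
      isOpen_nonzeroMomentum.mem_nhds hz] with y hy hy0
    obtain ⟨c', hc0', hc'⟩ := P.exists_curve h0 y
    have hS0 : S (P.asymptotic 0 y) 0 = P.asymptotic 0 y := by
      conv_lhs => rw [hy.2]
      simp [TimeWeight.forward_apply]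
    have hlim := P.tendsto_asymptotic_of_isSolution hy.1 (P.isSolution_of_eq_forward hy.2) hc'
      (by rw [hc0', hS0, P.position_asymptotic]; rfl) (tendsto_of_eq_forward hy.2)
    exact tendsto_nhds_unique ((hF y hy0).2 c' hc' hc0') hlim
  exact ⟨W, ⟨hWmem, hWs, F, fun z hz => (hF z hz).1, hFs, hWF, hFW⟩, key⟩

end WaveMap

end Perturbation

/-! ### Weakening the exponent and reversing time. -/

theorem IsLongRangeMetric.mono {d : ℕ} {a : Space d → Matrix (Fin d) (Fin d) ℝ} {μ ν : ℝ}
    (ha : IsLongRangeMetric a μ) (h : ν ≤ μ) : IsLongRangeMetric a ν where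
  smooth := ha.smooth
  posDef := ha.posDef
  decay n i j k := by
    obtain ⟨C, hC, hle⟩ := ha.decay n i j k
    refine ⟨C, hC, fun x => (hle x).trans ?_⟩
    gcongr
    exact one_le_bracket x

/-- The reversal of the momentum. -/
def reversal (d : ℕ) (z : Phase d) : Phase d := (z.1, -z.2)

theorem reversal_involutive (d : ℕ) : Function.Involutive (reversal d) := fun z => by
  simp [reversal]

theorem contDiff_reversal (d : ℕ) : ContDiff ℝ ∞ (reversal d) :=
  contDiff_fst.prodMk contDiff_snd.neg

theorem reversal_mem_nonzeroMomentum {d : ℕ} {z : Phase d} (hz : z ∈ nonzeroMomentum d) :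
    reversal d z ∈ nonzeroMomentum d := neg_ne_zero.2 hz

theorem IsDiffeomorphismOf.conj {E : Type*} [NormedAddCommGroup E] [NormedSpace ℝ E] {f : E → E}
    {U : Set E} (hf : IsDiffeomorphismOf f U) {R : E → E} (hR : Function.Involutive R)
    (hRU : Set.MapsTo R U U) (hRs : ContDiff ℝ ∞ R) :
    IsDiffeomorphismOf (fun z => R (f (R z))) U := by
  obtain ⟨hfU, hfs, g, hgU, hgs, hgf, hfg⟩ := hf
  refine ⟨fun z hz => hRU (hfU (hRU hz)), hRs.comp_contDiffOn (hfs.comp hRs.contDiffOn hRU),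
    fun z => R (g (R z)), fun z hz => hRU (hgU (hRU hz)),
    hRs.comp_contDiffOn (hgs.comp hRs.contDiffOn hRU), fun z hz => ?_, fun z hz => ?_⟩
  · simp only [hR _, hgf (hRU hz)]
  · simp only [hR _, hfg (hRU hz)]

namespace Perturbation

variable {d : ℕ} {μ : ℝ} (P : Perturbation d μ) {c : ℝ → Phase d} {w : Phase d}

/-- The formula for the gradient of the modifier divides by t, so t = 0 has to be excluded
eventually. -/
theorem hasAsymptotics_iff (h0 : 0 < μ) (h1 : μ < 1) {l : Filter ℝ} (hl : ∀ᶠ t in l, t ≠ 0) :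
    HasAsymptotics P.energy l c w ↔ Tendsto (fun t => P.asymptotic t (c t)) l (𝓝 w) := by
  rw [HasAsymptotics, Prod.tendsto_iff]
  refine and_congr (tendsto_congr' ?_) Iff.rfl
  filter_upwards [hl] with t ht
  rw [P.gradient_dollard h0 h1 ht]
  rfl

theorem hasDerivAt_reversal (hc : ∀ t, HasDerivAt c (P.field (c t)) t) (t : ℝ) :
    HasDerivAt (fun t => reversal d (c (-t))) (P.field (reversal d (c (-t)))) t := by
  have h := (hc (-t)).scomp t (hasDerivAt_neg t)
  have hx : HasDerivAt (fun t => (c (-t)).1) _ t := (hasFDerivAt_fst.comp_hasDerivAt t h :)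
  have hξ : HasDerivAt (fun t => (c (-t)).2) _ t := (hasFDerivAt_snd.comp_hasDerivAt t h :)
  refine (hx.prodMk hξ.neg).congr_deriv ?_
  simp [field, reversal, add_comm]

/-- The correction tξ + `shift`(tξ) depends on tξ alone, which does not change when t and ξ both
change sign. -/
theorem asymptotic_reversal (t : ℝ) (z : Phase d) :
    P.asymptotic t (reversal d z) = reversal d (P.asymptotic (-t) z) := by
  simp [asymptotic, reversal]

theorem tendsto_asymptotic_reversal :
    Tendsto (fun t => P.asymptotic t (reversal d (c (-t)))) atTop (𝓝 (reversal d w)) ↔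
      Tendsto (fun t => P.asymptotic t (c t)) atBot (𝓝 w) := by
  have hR := (contDiff_reversal d).continuous
  simp only [asymptotic_reversal]
  constructor
  · intro h
    have h2 := ((hR.tendsto _).comp h).comp tendsto_neg_atBot_atTop
    simpa [Function.comp_def, (reversal_involutive d) _] using h2
  · intro h
    exact ((hR.tendsto _).comp h).comp tendsto_neg_atTop_atBot

end Perturbation

end ClassicalScattering

/-- The first conjunct says that `exp(t H_k)` is defined for all times. The others hold for both
signs: `l = atTop` is `t → ∞` and `l = atBot` is `t → -∞`. The limits `w = (x_±, ξ_±)` exist, and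
the map `W : (x_±, ξ_±) ↦ (x_0, ξ_0)` is a diffeomorphism of `ℝ^d × (ℝ^d ∖ {0})`. -/
theorem proposition1 (d : ℕ) (hd : 1 ≤ d)
    (a : ClassicalScattering.Space d → Matrix (Fin d) (Fin d) ℝ) (μ : ℝ) (hμ : 1 / 2 < μ)
    (ha : ClassicalScattering.IsLongRangeMetric a μ)
    (hnt : ClassicalScattering.IsNontrapping (ClassicalScattering.kinetic a)) :
    (∀ z : ClassicalScattering.Phase d, ∃! c : ℝ → ClassicalScattering.Phase d,
      ClassicalScattering.IsHamiltonCurve (ClassicalScattering.kinetic a) c ∧ c 0 = z) ∧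
    ∀ l : Filter ℝ, l = atTop ∨ l = atBot →
      (∀ c : ℝ → ClassicalScattering.Phase d,
        ClassicalScattering.IsHamiltonCurve (ClassicalScattering.kinetic a) c →
        c 0 ∈ ClassicalScattering.nonzeroMomentum d →
        ∃ w ∈ ClassicalScattering.nonzeroMomentum d,
          ClassicalScattering.HasAsymptotics (ClassicalScattering.kinetic a) l c w) ∧
      ∃ W : ClassicalScattering.Phase d → ClassicalScattering.Phase d,
        ClassicalScattering.IsDiffeomorphismOf W (ClassicalScattering.nonzeroMomentum d) ∧
        ∀ c : ℝ → ClassicalScattering.Phase d,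
          ClassicalScattering.IsHamiltonCurve (ClassicalScattering.kinetic a) c →
          c 0 ∈ ClassicalScattering.nonzeroMomentum d →
          ∀ w ∈ ClassicalScattering.nonzeroMomentum d,
            W w = c 0 ↔ ClassicalScattering.HasAsymptotics (ClassicalScattering.kinetic a) l c w := by
  open ClassicalScattering in
  -- The conclusion does not involve μ, so the decay may be weakened to an exponent in (1/2, 1). An
  -- exponent below 1 makes the radial average of B converge and `shift` a symbol of positive order.
  have h2 : 1 / 2 < min μ (3 / 4) := lt_min hμ (by norm_num)
  have h0 : 0 < min μ (3 / 4) := by linarith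
  have h1 : min μ (3 / 4) < 1 := (min_le_right _ _).trans_lt (by norm_num)
  obtain ⟨P, hP⟩ := (ha.mono (min_le_left μ (3 / 4))).exists_perturbation
  have hk : kinetic a = P.energy := by
    funext x ξ
    exact hP x ξ
  rw [hk] at hnt ⊢
  simp only [P.isHamiltonCurve_iff]
  have htop : ∀ c : ℝ → Phase d, (∀ t, HasDerivAt c (P.field (c t)) t) → (c 0).2 ≠ 0 →
      Tendsto (fun t => ‖(c t).1‖) atTop atTop :=
    fun c hc hξ => (hnt c (P.isHamiltonCurve_iff.2 hc) hξ).1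
  obtain ⟨W, hW, hWc⟩ := P.exists_waveMap h2 h0 h1 htop
  refine ⟨fun z => ?_, ?_⟩
  · obtain ⟨c, hc0, hc⟩ := P.exists_curve h0 z
    exact ⟨c, ⟨hc, hc0⟩, fun c' hc' => P.curve_unique hc'.1 hc (hc'.2.trans hc0.symm)⟩
  rintro l (rfl | rfl)
  · simp only [P.hasAsymptotics_iff h0 h1 (eventually_ne_atTop 0)]
    exact ⟨fun c hc hξ => P.exists_tendsto_asymptotic h2 h0 h1 hc hξ (htop c hc hξ), W, hW, hWc⟩
  · simp only [P.hasAsymptotics_iff h0 h1 (eventually_ne_atBot 0)]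
    have hrev : ∀ c : ℝ → Phase d, c 0 ∈ nonzeroMomentum d →
        reversal d (c (-0)) ∈ nonzeroMomentum d := fun c hξ => by
      rw [neg_zero]
      exact reversal_mem_nonzeroMomentum hξ
    -- The wave map for t → -∞ is the one for t → ∞ conjugated by momentum reversal.
    refine ⟨fun c hc hξ => ?_, fun z => reversal d (W (reversal d z)),
      hW.conj (reversal_involutive d) (fun _ => reversal_mem_nonzeroMomentum)
        (contDiff_reversal d), fun c hc hξ w hw => ?_⟩
    · have hc' := P.hasDerivAt_reversal hc
      obtain ⟨w, hw, h⟩ := P.exists_tendsto_asymptotic h2 h0 h1 hc' (hrev c hξ)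
        (htop _ hc' (hrev c hξ))
      rw [← reversal_involutive d w, P.tendsto_asymptotic_reversal] at h
      exact ⟨reversal d w, reversal_mem_nonzeroMomentum hw, h⟩
    · rw [← P.tendsto_asymptotic_reversal, ← hWc _ (P.hasDerivAt_reversal hc) (hrev c hξ) _
        (reversal_mem_nonzeroMomentum hw), neg_zero]
      exact (reversal_involutive d).eq_iff
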